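/- Let $\mu,\upsilon>-1$ and $0<\rho\le 1$. For $a,b>-1$ and $0<\sigma\le1$ put \[ \varkappa^{a,b,\sigma}(t)=\sigma(1-t)^{\sigma(a+1)-1}\bigl(1-(1-t)^\sigma\bigr)^{b},\qquad \|g\|_{0,\varkappa}=\Bigl(\int_0^1 g(t)^2\varkappa(t)\,dt\Bigr)^{1/2}, \] and let $\mathcal D_\sigma f(t)=\sigma^{-1}(1-t)^{1-\sigma}f'(t)$, with $f'$ the weak derivative of $f$ on $(0,1)$. Let $B^{1,\sigma}_{\mu,\upsilon}$ be the space of real functions $f$ on $(0,1)$ with $f\in L^2_{\varkappa^{\mu,\upsilon,\sigma}}(0,1)$ and $\mathcal D_\sigma f\in L^2_{\varkappa^{\mu+1,\upsilon+1,\sigma}}(0,1)$. For an integer $N\ge 1$ let $t_0<\dots<t_N$ be the zeros in $(0,1)$ of $t\mapsto P^{(\mu,\upsilon)}_{N+1}\bigl(1-2(1-t)^\rho\bigr)$, where $P^{(\mu,\upsilon)}_{N+1}$ is the classical Jacobi polynomial of degree $N+1$ (there are exactly $N+1$ of them), and define the interpolation operator \[ J_{N,\rho}^{\mu,\upsilon}f(t)=\sum_{j=0}^N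 f(t_j)\prod_{\substack{0\le i\le N\\ i\ne j}}\frac{(1-t)^\rho-(1-t_i)^\rho}{(1-t_j)^\rho-(1-t_i)^\rho}. \] Then there is a constant $c>0$, independent of $N$ and $f$, such that for every integer $N\ge1$ and every continuous $f:(0,1)\to\mathbb R$ for which $t\mapsto f\bigl(1-(1-t)^{1/\rho}\bigr)$ belongs to $B^{1,1}_{\mu,\upsilon}$, one has $f\in B^{1,\rho}_{\mu,\upsilon}$, $J_{N,\rho}^{\mu,\upsilon}f\in L^2_{\varkappa^{\mu,\upsilon,\rho}}(0,1)$, and \[ \|J_{N,\rho}^{\mu,\upsilon}f\|_{0,\varkappa^{\mu,\upsilon,\rho}}\le c\Bigl(\|f\|_{0,\varkappa^{\mu,\upsilon,\rho}}+N^{-1}\|\mathcal D_\rho f\|_{0,\varkappa^{\mu+1,\upsilon+1,\rho}}\Bigr). \] -/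

import Mathlib

open MeasureTheory Set
open scoped ContDiff

noncomputable section

namespace BackwardInterp

/-- The classical Jacobi polynomial of degree `n` on `[-1,1]`, orthogonal with respect to the weight
`(1 - x) ^ μ * (1 + x) ^ υ`, in its standard normalization:
`∑ k ≤ n, (n + μ + υ + 1)_k (μ + k + 1)_(n-k) / (k! (n-k)!) * ((x - 1) / 2) ^ k`,
where `(a)_k` is the rising factorial. -/
def jacobi (n : ℕ) (μ υ : ℝ) : Polynomial ℝ :=
  ∑ k ∈ Finset.range (n + 1),
    Polynomial.C
      ((ascPochhammer ℝ k).eval ((n : ℝ) + μ + υ + 1) *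
          (ascPochhammer ℝ (n - k)).eval (μ + (k : ℝ) + 1) /
        ((k.factorial : ℝ) * ((n - k).factorial : ℝ))) *
      (Polynomial.C (1 / 2 : ℝ) * (Polynomial.X - 1)) ^ k

/-- The fractional backward orthogonal function of degree `n`. -/
def backwardJacobi (n : ℕ) (μ υ ρ : ℝ) (t : ℝ) : ℝ :=
  (jacobi n μ υ).eval (1 - 2 * (1 - t) ^ ρ)

/-- The backward weight function. -/
def weight (μ υ ρ : ℝ) (t : ℝ) : ℝ :=
  ρ * (1 - t) ^ (ρ * (μ + 1) - 1) * (1 - (1 - t) ^ ρ) ^ υ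

/-- Membership in the real weighted space `L²_w(0,1)`. -/
def MemL2 (w f : ℝ → ℝ) : Prop :=
  AEStronglyMeasurable f (volume.restrict (Ioo 0 1)) ∧
    IntegrableOn (fun t => f t ^ 2 * w t) (Ioo 0 1)

/-- The weighted norm `(∫₀¹ f² w)^(1/2)`. -/
def wnorm (w f : ℝ → ℝ) : ℝ :=
  Real.sqrt (∫ t in Ioo (0 : ℝ) 1, f t ^ 2 * w t)

/-- `g` is a weak (distributional) derivative of `f` on `(0,1)`. -/
def IsWeakDeriv (f g : ℝ → ℝ) : Prop :=
  LocallyIntegrableOn f (Ioo 0 1) ∧ LocallyIntegrableOn g (Ioo 0 1) ∧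
    ∀ φ : ℝ → ℝ, ContDiff ℝ ∞ φ → HasCompactSupport φ → tsupport φ ⊆ Ioo 0 1 →
      ∫ t in Ioo (0 : ℝ) 1, f t * deriv φ t = -∫ t in Ioo (0 : ℝ) 1, g t * φ t

/-- `g` is the backward transformed derivative `(1 - t) ^ (1 - ρ) / ρ * f'` of `f` on `(0,1)`,
where `f'` is the weak derivative. For `ρ = 1` this is the weak derivative itself. -/
def IsBackwardDeriv (ρ : ℝ) (f g : ℝ → ℝ) : Prop :=
  ∃ f' : ℝ → ℝ, IsWeakDeriv f f' ∧
    ∀ᵐ t ∂(volume.restrict (Ioo (0 : ℝ) 1)), g t = (1 - t) ^ (1 - ρ) / ρ * f' t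

/-- The Jacobi-weighted Sobolev space of order `s` generated by the backward transformed
derivative: `G k` is the `k`-th iterate of that derivative applied to `f`. -/
def MemB (μ υ ρ : ℝ) (s : ℕ) (f : ℝ → ℝ) : Prop :=
  ∃ G : ℕ → ℝ → ℝ, G 0 = f ∧
    (∀ k < s, IsBackwardDeriv ρ (G k) (G (k + 1))) ∧
    ∀ k ≤ s, MemL2 (weight (μ + k) (υ + k) ρ) (G k)

/-- `t 0 < ⋯ < t N` are all the zeros in `(0,1)` of the backward orthogonal function of
degree `N + 1`. -/
def IsGaussNodes (N : ℕ) (μ υ ρ : ℝ) (t : Fin (N + 1) → ℝ) : Prop :=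
  StrictMono t ∧ range t = {x | x ∈ Ioo (0 : ℝ) 1 ∧ backwardJacobi (N + 1) μ υ ρ x = 0}

/-- The backward Lagrange basis function with index `j` for the nodes `t`. -/
def lagrangeBasis {N : ℕ} (ρ : ℝ) (t : Fin (N + 1) → ℝ) (j : Fin (N + 1)) (x : ℝ) : ℝ :=
  ∏ i ∈ Finset.univ.erase j,
    ((1 - x) ^ ρ - (1 - t i) ^ ρ) / ((1 - t j) ^ ρ - (1 - t i) ^ ρ)

/-- The interpolation operator for the nodes `t`. -/
def interp {N : ℕ} (ρ : ℝ) (t : Fin (N + 1) → ℝ) (f : ℝ → ℝ) (x : ℝ) : ℝ :=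
  ∑ j, f (t j) * lagrangeBasis ρ t j x

end BackwardInterp

end

namespace BackwardInterp

open Polynomial

/-! ### The Jacobi weight on the unit interval -/

/-! The substitution `s = 1 - (1 - t) ^ ρ` (`stretch`) removes `ρ`. It carries `weight μ υ ρ` to `s
^ υ * (1 - s) ^ μ`, the nodes to the zeros of a Jacobi polynomial on `(0,1)`, the backward
derivative to the ordinary one, and the interpolant of `f` to the Lagrange polynomial of `F = f ∘
stretch (1 / ρ)` (`weight_eq`, `interp_eq`, `rpow_mul_stretchDeriv`). On the unit interval `a = υ`
is the exponent at `0` and `b = μ` the exponent at `1`; `w` denotes `unitWeight a b` and `p` denotes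
`unitWeight (a + 1) (b + 1)`.

The squared interpolant has degree at most `2 N`, so Gauss quadrature (`IsJacobiNodes.quadrature`)
turns its integral into `∑ ω_j F(x_j)²`. This sum is bounded by `‖F‖² + N⁻² ‖F'‖²` locally. The
Chebyshev–Markov–Stieltjes inequalities (`IsJacobiNodes.stieltjes`) bound `ω_j` by the mass of `w`
between the neighbours of `x_j`. On such an interval `[u,v]`, `F(x_j)²` is at most twice a mean of
`F²` plus twice the square of `∫ |F'|`, and Cauchy–Schwarz bounds that square by `(v - u) ∫ F'²`.
This yields `N⁻²` and the weight `p` once `w` is nearly constant on the interval and `(v - u)²` is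
`O(s (1 - s) / N²)` there; that is `RegularInterval`, used in `RegularInterval.trace_le`. The
intervals overlap at most twice, so the local bounds can be summed.

The spacing of the zeros comes from the Jacobi equation, whose eigenvalue `l` is at least `N²`.
Picone's inequality with a quadratic bump bounds zero-free intervals from above
(`JacobiODE.sq_gap_le`); integrating `(p P')' = -l w P` from `0` keeps the first zero at distance of
order at least `1 / l` (`JacobiODE.endConst_le`); reflection treats the other end. Beyond the
extreme nodes `x_0 / 2` and `(1 + x_N) / 2` serve as neighbours, and doubling of `w` controls the
remaining mass (`integral_unitWeight_le_half`).

Continuity of `f` enters through `IsWeakDeriv.integral_eq_sub`: a continuous function is a primitive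
of its weak derivative. -/

/-- The Jacobi weight `s ^ a * (1 - s) ^ b` on `(0,1)`. -/
noncomputable def unitWeight (a b s : ℝ) : ℝ := s ^ a * (1 - s) ^ b

lemma unitWeight_pos (a b : ℝ) {s : ℝ} (h0 : 0 < s) (h1 : s < 1) : 0 < unitWeight a b s :=
  mul_pos (Real.rpow_pos_of_pos h0 _) (Real.rpow_pos_of_pos (by linarith) _)

lemma unitWeight_reflect (a b s : ℝ) : unitWeight a b (1 - s) = unitWeight b a s := by
  simp [unitWeight, mul_comm]

lemma unitWeight_succ (a b : ℝ) {s : ℝ} (h0 : 0 < s) (h1 : s < 1) :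
    unitWeight (a + 1) (b + 1) s = unitWeight a b s * (s * (1 - s)) := by
  have h : 0 < 1 - s := by linarith
  rw [unitWeight, unitWeight, Real.rpow_add_one h0.ne', Real.rpow_add_one h.ne']
  ring

lemma continuousOn_unitWeight (a b : ℝ) : ContinuousOn (unitWeight a b) (Ioo 0 1) := by
  unfold unitWeight
  refine ContinuousOn.mul ?_ ?_
  · exact continuousOn_id.rpow_const fun s hs => Or.inl hs.1.ne'
  · exact (continuousOn_const.sub continuousOn_id).rpow_const fun s hs =>
      Or.inl (by have := hs.2; change 1 - s ≠ 0; linarith)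

lemma measurable_unitWeight (a b : ℝ) : Measurable (unitWeight a b) := by
  unfold unitWeight
  fun_prop

lemma intervalIntegrable_unitWeight {a b : ℝ} (ha : -1 < a) (hb : -1 < b) :
    IntervalIntegrable (unitWeight a b) volume 0 1 := by
  -- On the left half only `s ^ a` is singular; the right half follows by reflection.
  have key : ∀ a b : ℝ, -1 < a → IntervalIntegrable (unitWeight a b) volume 0 (1 / 2) := by
    intro a b ha
    unfold unitWeight
    refine (intervalIntegral.intervalIntegrable_rpow' ha).mul_continuousOn ?_
    refine (continuousOn_const.sub continuousOn_id).rpow_const fun s hs => Or.inl ?_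
    rw [uIcc_of_le (by norm_num)] at hs
    have := hs.2
    change 1 - s ≠ 0
    linarith
  have h2 := ((key b a hb).comp_sub_left 1).symm
  simp only [unitWeight_reflect] at h2
  norm_num at h2
  have := (key a b ha)
  norm_num at this
  exact this.trans h2

lemma continuous_unitWeight_succ {a b : ℝ} (ha : -1 < a) (hb : -1 < b) :
    Continuous (unitWeight (a + 1) (b + 1)) := by
  unfold unitWeight
  refine Continuous.mul ?_ ?_
  · exact continuous_id.rpow_const fun _ => Or.inr (by linarith)
  · exact (continuous_const.sub continuous_id).rpow_const fun _ => Or.inr (by linarith)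

lemma unitWeight_succ_zero {a : ℝ} (b : ℝ) (ha : -1 < a) : unitWeight (a + 1) b 0 = 0 := by
  simp [unitWeight, Real.zero_rpow (by linarith : a + 1 ≠ 0)]

lemma unitWeight_succ_one (a : ℝ) {b : ℝ} (hb : -1 < b) : unitWeight a (b + 1) 1 = 0 := by
  simp [unitWeight, Real.zero_rpow (by linarith : b + 1 ≠ 0)]

lemma hasDerivAt_unitWeight_succ (a b : ℝ) {s : ℝ} (h0 : 0 < s) (h1 : s < 1) :
    HasDerivAt (unitWeight (a + 1) (b + 1))
      (((a + 1) - (a + b + 2) * s) * unitWeight a b s) s := by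
  have h : 0 < 1 - s := by linarith
  have d1 : HasDerivAt (fun s : ℝ => s ^ (a + 1)) ((a + 1) * s ^ a) s := by
    simpa using Real.hasDerivAt_rpow_const (x := s) (p := a + 1) (Or.inl h0.ne')
  have d2 : HasDerivAt (fun s : ℝ => (1 - s) ^ (b + 1)) (-((b + 1) * (1 - s) ^ b)) s := by
    have := ((hasDerivAt_id s).const_sub 1).rpow_const (p := b + 1) (Or.inl h.ne')
    convert! this using 1
    simp
    ring
  have := d1.mul d2
  unfold unitWeight
  convert! this using 1
  rw [Real.rpow_add_one h0.ne', Real.rpow_add_one h.ne']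
  ring

/-- Two points of `(0,1)` with comparable distances to both end points carry comparable
powers. -/
lemma rpow_le_of_ratio {K x y : ℝ} (hx : 0 < x) (hy : 0 < y) (hxy : x ≤ K * y) (hyx : y ≤ K * x)
    (r : ℝ) : x ^ r ≤ K ^ |r| * y ^ r := by
  have hK : 0 < K := by
    by_contra h
    have : K * y ≤ 0 := mul_nonpos_of_nonpos_of_nonneg (not_lt.1 h) hy.le
    linarith
  rcases le_total 0 r with hr | hr
  · rw [abs_of_nonneg hr, ← Real.mul_rpow hK.le hy.le]
    exact Real.rpow_le_rpow hx.le hxy hr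
  · rw [abs_of_nonpos hr, Real.rpow_neg hK.le, ← div_eq_inv_mul, le_div_iff₀ (by positivity),
      ← Real.mul_rpow hx.le hK.le]
    refine Real.rpow_le_rpow_of_nonpos hy (by linarith) hr

lemma unitWeight_le_of_ratio {K x y : ℝ} (hx : x ∈ Ioo (0 : ℝ) 1) (hy : y ∈ Ioo (0 : ℝ) 1)
    (h1 : x ≤ K * y) (h2 : y ≤ K * x) (h3 : 1 - x ≤ K * (1 - y)) (h4 : 1 - y ≤ K * (1 - x))
    (a b : ℝ) : unitWeight a b x ≤ K ^ (|a| + |b|) * unitWeight a b y := by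
  have hK : 0 < K := by
    by_contra h
    have : K * y ≤ 0 := mul_nonpos_of_nonpos_of_nonneg (not_lt.1 h) hy.1.le
    linarith [hx.1]
  have hx' : 0 < 1 - x := by linarith [hx.2]
  have hy' : 0 < 1 - y := by linarith [hy.2]
  calc unitWeight a b x ≤ (K ^ |a| * y ^ a) * (K ^ |b| * (1 - y) ^ b) :=
        mul_le_mul (rpow_le_of_ratio hx.1 hy.1 h1 h2 a) (rpow_le_of_ratio hx' hy' h3 h4 b)
          (by positivity) (by have := hy.1; positivity)
    _ = K ^ (|a| + |b|) * unitWeight a b y := by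
        rw [Real.rpow_add hK, unitWeight]; ring

/-! ### The Jacobi differential equation on the unit interval -/

/-- The polynomial `P` solves `s (1 - s) P'' + (a + 1 - (a + b + 2) s) P' + l P = 0`. -/
def JacobiODE (a b l : ℝ) (P : ℝ[X]) : Prop :=
  X * (1 - X) * derivative (derivative P) + (C (a + 1) - C (a + b + 2) * X) * derivative P +
    C l * P = 0

lemma JacobiODE.eval {a b l : ℝ} {P : ℝ[X]} (h : JacobiODE a b l P) (s : ℝ) :
    s * (1 - s) * (derivative (derivative P)).eval s +
      ((a + 1) - (a + b + 2) * s) * (derivative P).eval s + l * P.eval s = 0 := by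
  have := congrArg (Polynomial.eval s) h
  simpa using this

/-- The reflection `s ↦ 1 - s` exchanges the exponents, so every estimate near `0` also serves near
`1`. -/
lemma JacobiODE.reflect {a b l : ℝ} {P : ℝ[X]} (h : JacobiODE a b l P) :
    JacobiODE b a l (P.comp (1 - X)) := by
  have := congrArg (fun Q : ℝ[X] => Q.comp (1 - X)) h
  simp only [add_comp, mul_comp, sub_comp, X_comp, one_comp, C_comp, zero_comp] at this
  unfold JacobiODE
  have e : derivative (1 - X : ℝ[X]) = -1 := by simp
  simp only [derivative_comp, e, derivative_mul, derivative_neg, derivative_one]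
  have h1 : (C (a + b + 2) : ℝ[X]) = C (a + 1) + C (b + 1) := by rw [← C_add]; congr 1; ring
  have h2 : (C (b + a + 2) : ℝ[X]) = C (a + 1) + C (b + 1) := by rw [← C_add]; congr 1; ring
  rw [h1] at this
  rw [h2]
  linear_combination this

/-- A nonzero polynomial solution does not vanish at the singular point `0`. -/
lemma JacobiODE.eval_zero_ne {a b l : ℝ} {P : ℝ[X]} (h : JacobiODE a b l P) (ha : -1 < a)
    (hP : P ≠ 0) : P.eval 0 ≠ 0 := by
  intro h0
  apply hP
  have hk : ∀ k : ℕ, P.coeff k = 0 := by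
    intro k
    induction k with
    | zero => rw [← h0, coeff_zero_eq_eval_zero]
    | succ k ih =>
      -- The coefficient of `s ^ k` expresses `(k + 1) (k + a + 1) c_{k+1}` as a multiple of `c_k`,
      -- and `a > -1` makes the factor positive.
      have := congrArg (fun Q : ℝ[X] => Q.coeff k) h
      have e : X * (1 - X) * derivative (derivative P) +
          (C (a + 1) - C (a + b + 2) * X) * derivative P + C l * P =
          X * derivative (derivative P) - X * (X * derivative (derivative P)) +
          C (a + 1) * derivative P - C (a + b + 2) * (X * derivative P) + C l * P := by ring
      simp only [e] at this
      have hpos : ((k : ℝ) + 1) * (k + (a + 1)) ≠ 0 := by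
        have : (0 : ℝ) ≤ k := k.cast_nonneg
        have h1 : 0 < (k : ℝ) + 1 := by linarith
        have h2 : 0 < (k : ℝ) + (a + 1) := by linarith
        positivity
      refine (mul_eq_zero.1 (?_ : ((k : ℝ) + 1) * (k + (a + 1)) * P.coeff (k + 1) = 0)).resolve_left
        hpos
      -- The twice shifted term `X * (X * P'')` needs its own coefficient formula for `k = 0` and `k
      -- = 1`.
      rcases k with _ | _ | k
      · simp only [coeff_add, coeff_sub, coeff_C_mul, coeff_zero, coeff_X_mul_zero,
          coeff_derivative, ih] at this
        push_cast at this ⊢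
        linarith
      · simp only [coeff_add, coeff_sub, coeff_C_mul, coeff_zero, coeff_X_mul, coeff_X_mul_zero,
          coeff_derivative, ih] at this
        push_cast at this ⊢
        simp only [zero_add] at this ih ⊢
        linarith
      · simp only [coeff_add, coeff_sub, coeff_C_mul, coeff_zero, coeff_X_mul,
          coeff_derivative, ih] at this
        push_cast at this ⊢
        linarith
  ext k
  simp [hk k]

/-- The flux `p P'` satisfies `(p P')' = - l w P`. -/
lemma JacobiODE.hasDerivAt_flux {a b l : ℝ} {P : ℝ[X]} (h : JacobiODE a b l P) {s : ℝ}
    (h0 : 0 < s) (h1 : s < 1) :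
    HasDerivAt (fun s => unitWeight (a + 1) (b + 1) s * (derivative P).eval s)
      (-l * (unitWeight a b s * P.eval s)) s := by
  have := (hasDerivAt_unitWeight_succ a b h0 h1).mul ((derivative P).hasDerivAt s)
  convert! this using 1
  rw [unitWeight_succ a b h0 h1]
  linear_combination (-unitWeight a b s) * h.eval s

/-! ### The Jacobi polynomials as solutions of the equation -/

/-- The Jacobi polynomial of degree `n` transported to `(0,1)`. -/
noncomputable def unitJacobi (n : ℕ) (a b : ℝ) : ℝ[X] := (jacobi n b a).comp (2 * X - 1)

/-- The eigenvalue of the Jacobi operator in degree `n`. -/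
def jacobiEigenvalue (n : ℕ) (a b : ℝ) : ℝ := n * (n + a + b + 1)

lemma unitJacobi_eval (n : ℕ) (a b s : ℝ) :
    (unitJacobi n a b).eval s = (jacobi n b a).eval (2 * s - 1) := by
  simp [unitJacobi]

/-- The coefficients of the Jacobi polynomial in powers of `(x - 1) / 2`. -/
noncomputable def jacobiCoeff (n : ℕ) (a b : ℝ) (k : ℕ) : ℝ :=
  if k ≤ n then (ascPochhammer ℝ k).eval ((n : ℝ) + b + a + 1) *
          (ascPochhammer ℝ (n - k)).eval (b + (k : ℝ) + 1) /
        ((k.factorial : ℝ) * ((n - k).factorial : ℝ)) else 0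

/-- This two-term recurrence is the Jacobi equation read off in powers of `s - 1`. The factor `n -
k` vanishes at `k = n`, in agreement with the truncation of the coefficients. -/
lemma jacobiCoeff_succ (n : ℕ) (a b : ℝ) (k : ℕ) :
    ((k : ℝ) + 1) * (k + b + 1) * jacobiCoeff n a b (k + 1) =
      (n - k) * (n + k + a + b + 1) * jacobiCoeff n a b k := by
  rcases lt_trichotomy k n with h | h | h
  · obtain ⟨m, rfl⟩ : ∃ m, n = k + 1 + m := ⟨n - (k + 1), by omega⟩
    rw [jacobiCoeff, jacobiCoeff, if_pos (by omega), if_pos (by omega)]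
    have e1 : k + 1 + m - (k + 1) = m := by omega
    have e2 : k + 1 + m - k = m + 1 := by omega
    rw [e1, e2, ascPochhammer_succ_eval, ascPochhammer_succ_left]
    simp only [eval_mul, eval_X, eval_comp, eval_add, eval_one, Nat.factorial_succ]
    have f1 : (k.factorial : ℝ) ≠ 0 := by positivity
    have f2 : (m.factorial : ℝ) ≠ 0 := by positivity
    have f3 : (k : ℝ) + 1 ≠ 0 := by positivity
    have f4 : (m : ℝ) + 1 ≠ 0 := by positivity
    push_cast
    have e3 : b + ((k : ℝ) + 1) + 1 = b + k + 1 + 1 := by ring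
    rw [e3]
    field_simp
    ring
  · subst h; simp [jacobiCoeff]
  · simp [jacobiCoeff, not_le.2 h, not_le.2 (h.trans k.lt_succ_self)]

/-- The generating polynomial of the Jacobi coefficients. -/
noncomputable def jacobiAux (n : ℕ) (a b : ℝ) : ℝ[X] :=
  ∑ k ∈ Finset.range (n + 1), C (jacobiCoeff n a b k) * X ^ k

lemma jacobiAux_coeff (n : ℕ) (a b : ℝ) (k : ℕ) :
    (jacobiAux n a b).coeff k = jacobiCoeff n a b k := by
  simp only [jacobiAux, finsetSum_coeff, coeff_C_mul_X_pow]
  rw [Finset.sum_ite_eq]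
  split_ifs with h
  · rfl
  · simp only [Finset.mem_range] at h
    rw [jacobiCoeff, if_neg (by omega)]

lemma unitJacobi_eq (n : ℕ) (a b : ℝ) : unitJacobi n a b = (jacobiAux n a b).comp (X - 1) := by
  rw [unitJacobi, jacobi, jacobiAux]
  simp only [Polynomial.sum_comp, mul_comp, pow_comp, C_comp, sub_comp, X_comp, one_comp]
  refine Finset.sum_congr rfl fun k hk => ?_
  rw [jacobiCoeff, if_pos (by simpa [Nat.lt_succ_iff] using hk)]
  congr 2
  have : (2 : ℝ[X]) = C 2 := rfl
  have h2 : (C (1 / 2) * 2 : ℝ[X]) = 1 := by rw [this, ← C_mul]; norm_num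
  linear_combination (X - 1) * h2

lemma unitJacobi_natDegree_le (n : ℕ) (a b : ℝ) : (unitJacobi n a b).natDegree ≤ n := by
  rw [unitJacobi_eq]
  refine natDegree_comp_le.trans ?_
  have h1 : (jacobiAux n a b).natDegree ≤ n := by
    refine natDegree_sum_le_of_forall_le _ _ fun k hk => ?_
    refine (natDegree_C_mul_X_pow_le _ _).trans ?_
    have := Finset.mem_range.1 hk
    omega
  have h2 : (X - 1 : ℝ[X]).natDegree = 1 := natDegree_X_sub_C 1
  rw [h2, mul_one]
  exact h1

/-- At `s = 1` only the constant term in powers of `s - 1` survives, and `b > -1` makes it positive.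
-/
lemma unitJacobi_ne_zero (n : ℕ) (a : ℝ) {b : ℝ} (hb : -1 < b) : unitJacobi n a b ≠ 0 := by
  intro h
  have : (unitJacobi n a b).eval 1 = 0 := by rw [h]; simp
  rw [unitJacobi_eq, eval_comp] at this
  simp only [eval_sub, eval_X, eval_one, sub_self] at this
  rw [← coeff_zero_eq_eval_zero, jacobiAux_coeff, jacobiCoeff, if_pos (by omega)] at this
  have hp := ascPochhammer_pos (n - 0) (b + ((0 : ℕ) : ℝ) + 1) (by push_cast; linarith)
  have hf : (0 : ℝ) < ((0 : ℕ).factorial : ℝ) * ((n - 0).factorial : ℝ) := by positivity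
  simp only [ascPochhammer_zero, eval_one, one_mul] at this
  exact (div_pos hp hf).ne' this

/-- In the variable `z = s - 1` the equation becomes `z (1 + z) Q'' + (b + 1 + (a + b + 2) z) Q' - l
Q = 0`, which is `jacobiCoeff_succ` coefficient by coefficient. -/
lemma jacobiODE_unitJacobi (n : ℕ) (a b : ℝ) :
    JacobiODE a b (jacobiEigenvalue n a b) (unitJacobi n a b) := by
  have key : X * (1 + X) * derivative (derivative (jacobiAux n a b)) +
      (C (b + 1) + C (a + b + 2) * X) * derivative (jacobiAux n a b) -
      C (jacobiEigenvalue n a b) * jacobiAux n a b = 0 := by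
    have e : X * (1 + X) * derivative (derivative (jacobiAux n a b)) +
      (C (b + 1) + C (a + b + 2) * X) * derivative (jacobiAux n a b) -
      C (jacobiEigenvalue n a b) * jacobiAux n a b =
      X * derivative (derivative (jacobiAux n a b)) +
      X * (X * derivative (derivative (jacobiAux n a b))) +
      C (b + 1) * derivative (jacobiAux n a b) +
      C (a + b + 2) * (X * derivative (jacobiAux n a b)) -
      C (jacobiEigenvalue n a b) * jacobiAux n a b := by ring
    rw [e]
    ext k
    have h := jacobiCoeff_succ n a b k
    rcases k with _ | _ | k
    · simp only [coeff_add, coeff_sub, coeff_C_mul, coeff_zero, coeff_X_mul_zero,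
        coeff_derivative, jacobiAux_coeff]
      rw [jacobiEigenvalue]
      push_cast at h ⊢
      linarith
    · simp only [coeff_add, coeff_sub, coeff_C_mul, coeff_zero, coeff_X_mul, coeff_X_mul_zero,
        coeff_derivative, jacobiAux_coeff]
      rw [jacobiEigenvalue]
      push_cast at h ⊢
      simp only [zero_add] at h ⊢
      linarith
    · simp only [coeff_add, coeff_sub, coeff_C_mul, coeff_zero, coeff_X_mul,
        coeff_derivative, jacobiAux_coeff]
      rw [jacobiEigenvalue]
      push_cast at h ⊢
      linarith
  have := congrArg (fun Q : ℝ[X] => Q.comp (X - 1)) key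
  simp only [add_comp, mul_comp, sub_comp, X_comp, one_comp, C_comp, zero_comp] at this
  rw [unitJacobi_eq]
  unfold JacobiODE
  have e : derivative (X - 1 : ℝ[X]) = 1 := by simp
  simp only [derivative_comp, e, derivative_mul, derivative_one]
  have h1 : (C (a + b + 2) : ℝ[X]) = C (a + 1) + C (b + 1) := by rw [← C_add]; congr 1; ring
  rw [h1] at this ⊢
  linear_combination -this

/-- Since `a + b > -2`, the eigenvalue exceeds `(N + 1) N`. This is how `1 / l` becomes `N⁻²`. -/
lemma le_jacobiEigenvalue {a b : ℝ} (ha : -1 < a) (hb : -1 < b) {N : ℕ} (hN : 1 ≤ N) :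
    (N : ℝ) ^ 2 ≤ jacobiEigenvalue (N + 1) a b := by
  have : (1 : ℝ) ≤ N := by exact_mod_cast hN
  rw [jacobiEigenvalue]
  push_cast
  nlinarith

/-! ### Orthogonality -/

lemma intervalIntegrable_unitWeight_mul {a b : ℝ} (ha : -1 < a) (hb : -1 < b) {f : ℝ → ℝ}
    (hf : Continuous f) : IntervalIntegrable (fun s => unitWeight a b s * f s) volume 0 1 :=
  (intervalIntegrable_unitWeight ha hb).mul_continuousOn hf.continuousOn

lemma intervalIntegrable_unitWeight_mul_eval {a b : ℝ} (ha : -1 < a) (hb : -1 < b) (q : ℝ[X]) :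
    IntervalIntegrable (fun s => unitWeight a b s * q.eval s) volume 0 1 :=
  intervalIntegrable_unitWeight_mul ha hb q.continuous

/-- Lagrange's identity: the integrand is the derivative of `p (q' P - q P')`, and `p` vanishes at
both ends because `a + 1` and `b + 1` are positive. -/
lemma integral_jacobiOperator_mul {a b l : ℝ} (ha : -1 < a) (hb : -1 < b) {P : ℝ[X]}
    (h : JacobiODE a b l P) (q : ℝ[X]) :
    ∫ s in (0 : ℝ)..1, unitWeight a b s *
      ((X * (1 - X) * derivative (derivative q) +
        (C (a + 1) - C (a + b + 2) * X) * derivative q + C l * q) * P).eval s = 0 := by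
  have hF := intervalIntegral.integral_eq_sub_of_hasDerivAt_of_le zero_le_one
    (f := fun s => unitWeight (a + 1) (b + 1) s * (derivative q * P - q * derivative P).eval s)
    (f' := fun s => unitWeight a b s *
      ((X * (1 - X) * derivative (derivative q) +
        (C (a + 1) - C (a + b + 2) * X) * derivative q + C l * q) * P).eval s)
    ((continuous_unitWeight_succ ha hb).mul (Polynomial.continuous _)).continuousOn ?_
    (intervalIntegrable_unitWeight_mul_eval ha hb _)
  · rw [hF]
    simp [unitWeight_succ_one _ hb, unitWeight_succ_zero _ ha]
  · intro s hs
    have := (hasDerivAt_unitWeight_succ a b hs.1 hs.2).mul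
      ((derivative q * P - q * derivative P).hasDerivAt s)
    convert! this using 1
    rw [unitWeight_succ a b hs.1 hs.2]
    simp only [derivative_sub, derivative_mul, eval_mul, eval_add, eval_sub, eval_X, eval_C,
      eval_one]
    linear_combination (unitWeight a b s * q.eval s) * h.eval s

/-- With `l` the eigenvalue of degree `n`, the operator of `integral_jacobiOperator_mul` sends `X ^
m` to `(n - m) (n + m + a + b + 1) X ^ m + m (m + a) X ^ (m - 1)`. The leading factor is nonzero for
`m < n`, so orthogonality propagates upwards in `m`. -/
lemma integral_X_pow_mul_unitJacobi {a b : ℝ} (ha : -1 < a) (hb : -1 < b) {n m : ℕ}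
    (hmn : m < n) :
    ∫ s in (0 : ℝ)..1, unitWeight a b s * (X ^ m * unitJacobi n a b).eval s = 0 := by
  have hode := jacobiODE_unitJacobi n a b
  have hcast : (m : ℝ) + 1 ≤ n := by exact_mod_cast hmn
  have hm0 : (0 : ℝ) ≤ m := m.cast_nonneg
  have hne : (n - m : ℝ) * (n + m + a + b + 1) ≠ 0 := by
    have h1 : 0 < (n - m : ℝ) := by linarith
    have h2 : 0 < (n + m + a + b + 1 : ℝ) := by linarith
    positivity
  refine (mul_eq_zero.1 (?_ : ((n - m : ℝ) * (n + m + a + b + 1)) * _ = 0)).resolve_left hne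
  induction m with
  | zero =>
    have := integral_jacobiOperator_mul ha hb hode 1
    have e : ∀ s : ℝ, unitWeight a b s * ((X * (1 - X) * derivative (derivative 1) +
        (C (a + 1) - C (a + b + 2) * X) * derivative 1 + C (jacobiEigenvalue n a b) * 1) *
          unitJacobi n a b).eval s =
        ((n - (0 : ℕ) : ℝ) * (n + (0 : ℕ) + a + b + 1)) *
          (unitWeight a b s * (X ^ 0 * unitJacobi n a b).eval s) := by
      intro s
      simp [jacobiEigenvalue]
      ring
    simp only [e] at this
    rwa [intervalIntegral.integral_const_mul] at this
  | succ m ih =>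
    have hcast' : (m : ℝ) + 1 ≤ n := by push_cast at hcast; linarith
    have hm0' : (0 : ℝ) ≤ m := m.cast_nonneg
    have hne' : (n - m : ℝ) * (n + m + a + b + 1) ≠ 0 := by
      have h1 : 0 < (n - m : ℝ) := by linarith
      have h2 : 0 < (n + m + a + b + 1 : ℝ) := by push_cast at hcast; linarith
      positivity
    have ih' := (mul_eq_zero.1 (ih (by omega) hcast' hm0' hne')).resolve_left hne'
    have := integral_jacobiOperator_mul ha hb hode (X ^ (m + 1))
    have e : ∀ s : ℝ, unitWeight a b s * ((X * (1 - X) * derivative (derivative (X ^ (m + 1))) +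
        (C (a + 1) - C (a + b + 2) * X) * derivative (X ^ (m + 1)) +
          C (jacobiEigenvalue n a b) * X ^ (m + 1)) * unitJacobi n a b).eval s =
        ((n - (m + 1 : ℕ) : ℝ) * (n + (m + 1 : ℕ) + a + b + 1)) *
          (unitWeight a b s * (X ^ (m + 1) * unitJacobi n a b).eval s) +
        ((m + 1) * (m + 1 + a)) * (unitWeight a b s * (X ^ m * unitJacobi n a b).eval s) := by
      intro s
      rcases m with _ | m
      · simp [jacobiEigenvalue]
        ring
      · simp [jacobiEigenvalue]
        ring
    simp only [e] at this
    rw [intervalIntegral.integral_add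
      ((intervalIntegrable_unitWeight_mul_eval ha hb _).const_mul _)
      ((intervalIntegrable_unitWeight_mul_eval ha hb _).const_mul _),
      intervalIntegral.integral_const_mul, intervalIntegral.integral_const_mul, ih', mul_zero,
      add_zero] at this
    exact this

lemma integral_mul_unitJacobi {a b : ℝ} (ha : -1 < a) (hb : -1 < b) {n : ℕ} {q : ℝ[X]}
    (hq : q.natDegree < n) :
    ∫ s in (0 : ℝ)..1, unitWeight a b s * (q * unitJacobi n a b).eval s = 0 := by
  have e : ∀ s : ℝ, unitWeight a b s * (q * unitJacobi n a b).eval s =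
      ∑ m ∈ Finset.range (q.natDegree + 1),
        q.coeff m * (unitWeight a b s * (X ^ m * unitJacobi n a b).eval s) := by
    intro s
    rw [eval_mul, eval_eq_sum_range, Finset.sum_mul, Finset.mul_sum]
    refine Finset.sum_congr rfl fun m _ => ?_
    simp only [eval_mul, eval_pow, eval_X]
    ring
  simp only [e]
  rw [intervalIntegral.integral_finsetSum]
  · refine Finset.sum_eq_zero fun m hm => ?_
    rw [intervalIntegral.integral_const_mul, integral_X_pow_mul_unitJacobi ha hb
      (by have := Finset.mem_range.1 hm; omega), mul_zero]
  · intro m _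
    exact (intervalIntegrable_unitWeight_mul_eval ha hb _).const_mul _

/-! ### Zeros -/

lemma integral_unitWeight_mul_pos {a b : ℝ} (ha : -1 < a) (hb : -1 < b) {R : ℝ[X]} (hR : R ≠ 0)
    (h : ∀ s ∈ Ioo (0 : ℝ) 1, 0 ≤ R.eval s) :
    0 < ∫ s in (0 : ℝ)..1, unitWeight a b s * R.eval s := by
  rw [intervalIntegral.integral_of_le zero_le_one, integral_Ioc_eq_integral_Ioo]
  rw [setIntegral_pos_iff_support_of_nonneg_ae]
  · have hsub : Ioo (0 : ℝ) 1 \ (R.roots.toFinset : Set ℝ) ⊆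
        Function.support (fun s => unitWeight a b s * R.eval s) ∩ Ioo 0 1 := by
      intro s hs
      refine ⟨?_, hs.1⟩
      have : R.eval s ≠ 0 := by
        intro h0
        exact hs.2 (by simpa [hR] using h0)
      exact mul_ne_zero (unitWeight_pos a b hs.1.1 hs.1.2).ne' this
    refine lt_of_lt_of_le ?_ (measure_mono hsub)
    rw [measure_sdiff_null (Finset.measure_zero _ _)]
    simp
  · refine (ae_restrict_iff' measurableSet_Ioo).2 (Filter.Eventually.of_forall fun s hs => ?_)
    exact mul_nonneg (unitWeight_pos a b hs.1 hs.2).le (h s hs)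
  · exact (intervalIntegrable_iff_integrableOn_Ioo_of_le zero_le_one).1
      (intervalIntegrable_unitWeight_mul_eval ha hb _)

/-- Multiplication by suitable linear factors, one for each of some roots of `P` in `(0,1)`,
removes all sign changes of `P` on `(0,1)`. -/
lemma exists_finset_roots_sign (P : ℝ[X]) (hP : P ≠ 0) :
    ∃ S : Finset ℝ, (∀ r ∈ S, r ∈ Ioo (0 : ℝ) 1 ∧ P.eval r = 0) ∧
      ((∀ s ∈ Ioo (0 : ℝ) 1, 0 ≤ (Lagrange.nodal S id * P).eval s) ∨
       (∀ s ∈ Ioo (0 : ℝ) 1, (Lagrange.nodal S id * P).eval s ≤ 0)) := by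
  induction hn : P.natDegree generalizing P with
  | zero =>
    refine ⟨∅, by simp, ?_⟩
    rw [natDegree_eq_zero] at hn
    obtain ⟨c, rfl⟩ := hn
    simp only [Lagrange.nodal_empty, one_mul, eval_C]
    rcases le_total 0 c with h | h
    · exact Or.inl fun _ _ => h
    · exact Or.inr fun _ _ => h
  | succ n ih =>
    by_cases hroot : ∃ r ∈ Ioo (0 : ℝ) 1, P.eval r = 0
    · obtain ⟨r, hr, hr0⟩ := hroot
      obtain ⟨Q, rfl⟩ := dvd_iff_isRoot.2 hr0
      have hQ : Q ≠ 0 := right_ne_zero_of_mul hP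
      have hdeg : Q.natDegree = n := by
        rw [natDegree_mul (X_sub_C_ne_zero r) hQ, natDegree_X_sub_C] at hn
        omega
      obtain ⟨S, hS, hsign⟩ := ih Q hQ hdeg
      -- Restoring the factor `X - C r` toggles membership of `r`. If `r` is in `S`, the new factor
      -- replaces the one in the nodal polynomial; otherwise it is squared by inserting `r`.
      by_cases hrS : r ∈ S
      · refine ⟨S.erase r, fun x hx => ?_, ?_⟩
        · have := hS x (Finset.mem_of_mem_erase hx)
          exact ⟨this.1, by simp [this.2]⟩
        · have : Lagrange.nodal (S.erase r) id * ((X - C r) * Q) = Lagrange.nodal S id * Q := by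
            rw [Lagrange.nodal_eq_mul_nodal_erase hrS]
            simp only [id]
            ring
          rw [this]
          exact hsign
      · refine ⟨insert r S, fun x hx => ?_, ?_⟩
        · rcases Finset.mem_insert.1 hx with rfl | hx
          · exact ⟨hr, hr0⟩
          · exact ⟨(hS x hx).1, by simp [(hS x hx).2]⟩
        · have : Lagrange.nodal (insert r S) id * ((X - C r) * Q) =
              (X - C r) ^ 2 * (Lagrange.nodal S id * Q) := by
            rw [Lagrange.nodal_insert_eq_nodal hrS]
            simp only [id]
            ring
          rw [this]
          have e : ∀ s, ((X - C r) ^ 2 * (Lagrange.nodal S id * Q)).eval s =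
              (s - r) ^ 2 * (Lagrange.nodal S id * Q).eval s := by
            intro s; rw [eval_mul]; simp
          simp only [e]
          exact hsign.imp (fun h s hs => mul_nonneg (sq_nonneg _) (h s hs))
            (fun h s hs => mul_nonpos_of_nonneg_of_nonpos (sq_nonneg _) (h s hs))
    · refine ⟨∅, by simp, ?_⟩
      simp only [Lagrange.nodal_empty, one_mul]
      by_contra hcon
      push Not at hcon
      obtain ⟨⟨x, hx, hx0⟩, ⟨y, hy, hy0⟩⟩ := hcon
      have := isPreconnected_Ioo.intermediate_value hx hy P.continuous.continuousOn
        ⟨hx0.le, hy0.le⟩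
      exact hroot this

/-- `x 0 < ⋯ < x N` are all the zeros in `(0,1)` of the Jacobi polynomial of degree `N + 1`. -/
structure IsJacobiNodes (N : ℕ) (a b : ℝ) (x : ℕ → ℝ) : Prop where
  strictMonoOn : StrictMonoOn x (Iic N)
  mem : ∀ i ≤ N, x i ∈ Ioo (0 : ℝ) 1
  root : ∀ i ≤ N, (unitJacobi (N + 1) a b).eval (x i) = 0
  exhaust : ∀ s ∈ Ioo (0 : ℝ) 1, (unitJacobi (N + 1) a b).eval s = 0 → ∃ i ≤ N, x i = s

/-- With fewer than `n` sign-correcting roots, their nodal polynomial would be orthogonal to `P` by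
degree, while its product with `P` is nonzero and of one sign. The degree of `P` caps the number of
roots at `n`. -/
lemma exists_strictMono_zeros {a b : ℝ} (ha : -1 < a) (hb : -1 < b) (n : ℕ) :
    ∃ x : Fin n → ℝ, StrictMono x ∧
      range x = {s | s ∈ Ioo (0 : ℝ) 1 ∧ (unitJacobi n a b).eval s = 0} := by
  set P := unitJacobi n a b with hPdef
  have hP : P ≠ 0 := unitJacobi_ne_zero n a hb
  obtain ⟨S, hS, hsign⟩ := exists_finset_roots_sign P hP
  have hne : Lagrange.nodal S id * P ≠ 0 := mul_ne_zero Lagrange.nodal_ne_zero hP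
  have hcard : n ≤ S.card := by
    by_contra hlt
    have h0 := integral_mul_unitJacobi ha hb (q := Lagrange.nodal S id) (n := n)
      (by rw [Lagrange.natDegree_nodal]; omega)
    rcases hsign with h | h
    · exact (integral_unitWeight_mul_pos ha hb hne h).ne' h0
    · have := integral_unitWeight_mul_pos ha hb (neg_ne_zero.2 hne)
        (fun s hs => by rw [eval_neg]; linarith [h s hs])
      simp only [eval_neg, mul_neg, intervalIntegral.integral_neg] at this
      linarith
  have hsub : S ⊆ P.roots.toFinset := fun r hr => by
    simpa [hP] using (hS r hr).2
  have hle : P.roots.toFinset.card ≤ n :=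
    (Multiset.toFinset_card_le _).trans ((card_roots' P).trans (unitJacobi_natDegree_le n a b))
  have heq : S = P.roots.toFinset := Finset.eq_of_subset_of_card_le hsub (hle.trans hcard)
  have hc : S.card = n := le_antisymm (heq ▸ hle) hcard
  refine ⟨S.orderEmbOfFin hc, (S.orderEmbOfFin hc).strictMono, ?_⟩
  rw [Finset.range_orderEmbOfFin]
  ext s
  constructor
  · exact fun hs => hS s hs
  · rintro ⟨_, hs⟩
    rw [heq]
    simpa [hP] using hs

/-! ### Gauss quadrature -/

section Quadrature

variable {N : ℕ} {a b : ℝ} {x : ℕ → ℝ}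

lemma IsJacobiNodes.injOn (hx : IsJacobiNodes N a b x) :
    Set.InjOn x (Finset.range (N + 1) : Finset ℕ) := by
  refine hx.strictMonoOn.injOn.mono fun i hi => ?_
  have := Finset.mem_range.1 hi
  exact Nat.lt_succ_iff.1 this

/-- The weights of the Gauss quadrature formula. -/
noncomputable def christoffel (N : ℕ) (a b : ℝ) (x : ℕ → ℝ) (j : ℕ) : ℝ :=
  ∫ s in (0 : ℝ)..1, unitWeight a b s * (Lagrange.basis (Finset.range (N + 1)) x j).eval s

/-- The remainder of `P` modulo the nodal polynomial has degree at most `N` and `N + 1` zeros, so it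
vanishes; the quotient is constant by degree. -/
lemma IsJacobiNodes.exists_eq_C_mul_nodal (hx : IsJacobiNodes N a b x) (hb : -1 < b) :
    ∃ c : ℝ, c ≠ 0 ∧ Lagrange.nodal (Finset.range (N + 1)) x = C c * unitJacobi (N + 1) a b := by
  set P := unitJacobi (N + 1) a b with hPdef
  set M := Lagrange.nodal (Finset.range (N + 1)) x with hM
  have hmon : M.Monic := Lagrange.nodal_monic
  have hP : P ≠ 0 := unitJacobi_ne_zero _ a hb
  have hmod : P %ₘ M = 0 := by
    refine eq_zero_of_degree_lt_of_eval_index_eq_zero _ hx.injOn ?_ ?_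
    · have := degree_modByMonic_lt P hmon
      rwa [Lagrange.degree_nodal] at this
    · intro i hi
      have h := congrArg (Polynomial.eval (x i)) (modByMonic_add_div P M)
      rw [eval_add, eval_mul, Lagrange.eval_nodal_at_node hi, zero_mul, add_zero] at h
      rw [h]
      exact hx.root i (Nat.lt_succ_iff.1 (Finset.mem_range.1 hi))
  have hdiv : M * (P /ₘ M) = P := by
    have := modByMonic_add_div P M
    rwa [hmod, zero_add] at this
  have hdeg : (P /ₘ M).natDegree = 0 := by
    rw [natDegree_divByMonic _ hmon, Lagrange.natDegree_nodal, Finset.card_range]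
    have : P.natDegree ≤ N + 1 := unitJacobi_natDegree_le (N + 1) a b
    omega
  obtain ⟨c, hc⟩ := natDegree_eq_zero.1 hdeg
  have hc0 : c ≠ 0 := by
    rintro rfl
    rw [← hc, C_0, mul_zero] at hdiv
    exact hP hdiv.symm
  refine ⟨c⁻¹, inv_ne_zero hc0, ?_⟩
  rw [← hdiv, ← hc, mul_comm M, ← mul_assoc, ← C_mul, inv_mul_cancel₀ hc0, C_1, one_mul]

/-- Divide `q` by the nodal polynomial. The quotient has degree at most `N`, so its contribution is
killed by orthogonality; the remainder is its own interpolant and has the same nodal values as `q`.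
-/
theorem IsJacobiNodes.quadrature (hx : IsJacobiNodes N a b x) (ha : -1 < a) (hb : -1 < b)
    {q : ℝ[X]} (hq : q.natDegree ≤ 2 * N + 1) :
    ∫ s in (0 : ℝ)..1, unitWeight a b s * q.eval s =
      ∑ j ∈ Finset.range (N + 1), christoffel N a b x j * q.eval (x j) := by
  obtain ⟨c, hc0, hc⟩ := hx.exists_eq_C_mul_nodal hb
  set M := Lagrange.nodal (Finset.range (N + 1)) x with hM
  have hmon : M.Monic := Lagrange.nodal_monic
  have hdivdeg : (C c * (q /ₘ M)).natDegree < N + 1 := by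
    refine (natDegree_C_mul_le _ _).trans_lt ?_
    rw [natDegree_divByMonic _ hmon, Lagrange.natDegree_nodal, Finset.card_range]
    omega
  have hval : ∀ i ∈ Finset.range (N + 1), (q %ₘ M).eval (x i) = q.eval (x i) := by
    intro i hi
    have h := congrArg (Polynomial.eval (x i)) (modByMonic_add_div q M)
    rwa [eval_add, eval_mul, Lagrange.eval_nodal_at_node hi, zero_mul, add_zero] at h
  have hint : q %ₘ M = Lagrange.interpolate (Finset.range (N + 1)) x fun i => q.eval (x i) := by
    refine Lagrange.eq_interpolate_of_eval_eq _ hx.injOn ?_ hval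
    have := degree_modByMonic_lt q hmon
    rwa [Lagrange.degree_nodal] at this
  have hsplit : ∀ s : ℝ, unitWeight a b s * q.eval s =
      unitWeight a b s * (q %ₘ M).eval s +
        unitWeight a b s * (C c * (q /ₘ M) * unitJacobi (N + 1) a b).eval s := by
    intro s
    conv_lhs => rw [← modByMonic_add_div q M]
    nth_rewrite 2 [hc]
    simp only [eval_add, eval_mul, eval_C]
    ring
  simp only [hsplit]
  rw [intervalIntegral.integral_add
    (intervalIntegrable_unitWeight_mul_eval ha hb _)
    (intervalIntegrable_unitWeight_mul_eval ha hb _),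
    integral_mul_unitJacobi ha hb hdivdeg, add_zero, hint]
  simp only [Lagrange.interpolate_apply, eval_finsetSum, eval_mul, eval_C, Finset.mul_sum]
  rw [intervalIntegral.integral_finsetSum]
  · refine Finset.sum_congr rfl fun j _ => ?_
    rw [christoffel, ← intervalIntegral.integral_mul_const]
    congr 1
    ext s
    ring
  · intro j _
    refine intervalIntegrable_unitWeight_mul ha hb (f := fun s => q.eval (x j) *
      (Lagrange.basis (Finset.range (N + 1)) x j).eval s) ?_
    exact continuous_const.mul (Polynomial.continuous _)

end Quadrature

/-! ### The Chebyshev–Markov–Stieltjes inequalities -/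

/-- The distribution function of the Jacobi weight. -/
noncomputable def weightPrimitive (a b s : ℝ) : ℝ := ∫ t in (0 : ℝ)..s, unitWeight a b t

section Primitive

variable {a b : ℝ}

lemma intervalIntegrable_unitWeight_of_mem (ha : -1 < a) (hb : -1 < b) {x y : ℝ}
    (hx : x ∈ Icc (0 : ℝ) 1) (hy : y ∈ Icc (0 : ℝ) 1) :
    IntervalIntegrable (unitWeight a b) volume x y := by
  refine (intervalIntegrable_unitWeight ha hb).mono_set ?_
  rw [uIcc_of_le zero_le_one]
  exact uIcc_subset_Icc hx hy

lemma weightPrimitive_sub (ha : -1 < a) (hb : -1 < b) {x y : ℝ}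
    (hx : x ∈ Icc (0 : ℝ) 1) (hy : y ∈ Icc (0 : ℝ) 1) :
    weightPrimitive a b y - weightPrimitive a b x = ∫ t in x..y, unitWeight a b t :=
  intervalIntegral.integral_interval_sub_left
    (intervalIntegrable_unitWeight_of_mem ha hb ⟨le_rfl, zero_le_one⟩ hy)
    (intervalIntegrable_unitWeight_of_mem ha hb ⟨le_rfl, zero_le_one⟩ hx)

@[simp] lemma weightPrimitive_zero : weightPrimitive a b 0 = 0 := by simp [weightPrimitive]

lemma integral_unitWeight_pos (ha : -1 < a) (hb : -1 < b) {x y : ℝ} (hx : 0 ≤ x) (hxy : x < y)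
    (hy : y ≤ 1) : 0 < ∫ t in x..y, unitWeight a b t :=
  intervalIntegral.intervalIntegral_pos_of_pos_on
    (intervalIntegrable_unitWeight_of_mem ha hb ⟨hx, hxy.le.trans hy⟩ ⟨hx.trans hxy.le, hy⟩)
    (fun _ ht => unitWeight_pos a b (hx.trans_lt ht.1) (ht.2.trans_le hy)) hxy

lemma weightPrimitive_strictMonoOn (ha : -1 < a) (hb : -1 < b) :
    StrictMonoOn (weightPrimitive a b) (Icc 0 1) := by
  intro x hx y hy hxy
  have := integral_unitWeight_pos ha hb hx.1 hxy hy.2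
  rw [← weightPrimitive_sub ha hb hx hy] at this
  linarith

lemma continuousOn_weightPrimitive (ha : -1 < a) (hb : -1 < b) :
    ContinuousOn (weightPrimitive a b) (Icc 0 1) := by
  have := intervalIntegral.continuousOn_primitive_interval (a := 0) (b := 1)
    (f := unitWeight a b) (μ := volume) (by
      rw [uIcc_of_le zero_le_one]
      exact (intervalIntegrable_iff_integrableOn_Icc_of_le zero_le_one).1
        (intervalIntegrable_unitWeight ha hb))
  rwa [uIcc_of_le zero_le_one] at this

lemma hasDerivAt_weightPrimitive (ha : -1 < a) (hb : -1 < b) {s : ℝ} (hs : s ∈ Ioo (0 : ℝ) 1) :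
    HasDerivAt (weightPrimitive a b) (unitWeight a b s) s := by
  refine intervalIntegral.integral_hasDerivAt_right
    (intervalIntegrable_unitWeight_of_mem ha hb ⟨le_rfl, zero_le_one⟩ ⟨hs.1.le, hs.2.le⟩) ?_ ?_
  · exact (measurable_unitWeight a b).stronglyMeasurable.stronglyMeasurableAtFilter
  · exact (continuousOn_unitWeight a b).continuousAt (Ioo_mem_nhds hs.1 hs.2)

end Primitive

/-- The antiderivative gains only one degree, which matches test polynomials of degree `2 N` with a
quadrature exact up to degree `2 N + 1`. -/
lemma exists_derivative_eq (q : ℝ[X]) :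
    ∃ r : ℝ[X], derivative r = q ∧ r.natDegree ≤ q.natDegree + 1 := by
  refine ⟨∑ k ∈ Finset.range (q.natDegree + 1), C (q.coeff k / (k + 1)) * X ^ (k + 1), ?_, ?_⟩
  · conv_rhs => rw [q.as_sum_range_C_mul_X_pow]
    rw [derivative_sum]
    refine Finset.sum_congr rfl fun k _ => ?_
    rw [derivative_C_mul_X_pow]
    congr 2
    have : (k : ℝ) + 1 ≠ 0 := by positivity
    push_cast
    field_simp
  · refine natDegree_sum_le_of_forall_le _ _ fun k hk => ?_
    refine (natDegree_C_mul_X_pow_le _ _).trans ?_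
    have := Finset.mem_range.1 hk
    omega

section Stieltjes

variable {N : ℕ} {a b : ℝ} {x : ℕ → ℝ}

/-- The difference of the distribution functions of the Jacobi weight and of the Gauss quadrature
formula. -/
noncomputable def discrepancy (N : ℕ) (a b : ℝ) (x : ℕ → ℝ) (s : ℝ) : ℝ :=
  weightPrimitive a b s -
    ∑ i ∈ Finset.range (N + 1), christoffel N a b x i * (Ioi (x i)).indicator (fun _ => 1) s

lemma discrepancy_eq {s : ℝ} {m : ℕ} (hm : m ≤ N + 1) (h1 : ∀ i < m, x i < s)
    (h2 : ∀ i, m ≤ i → i ≤ N → s ≤ x i) :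
    discrepancy N a b x s = weightPrimitive a b s - ∑ i ∈ Finset.range m, christoffel N a b x i := by
  rw [discrepancy]
  congr 1
  have hsub : Finset.range m ⊆ Finset.range (N + 1) := Finset.range_mono hm
  rw [← Finset.sum_subset hsub]
  · refine Finset.sum_congr rfl fun i hi => ?_
    rw [indicator_of_mem (mem_Ioi.2 (h1 i (Finset.mem_range.1 hi))), mul_one]
  · intro i hi hi'
    simp only [Finset.mem_range, not_lt] at hi hi'
    rw [indicator_of_notMem, mul_zero]
    simpa using h2 i hi' (by omega)

lemma intervalIntegrable_indicator_mul (c : ℝ) (q : ℝ[X]) :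
    IntervalIntegrable (fun s => (Ioi c).indicator (fun _ => (1 : ℝ)) s * q.eval s)
      volume 0 1 := by
  have e : (fun s => (Ioi c).indicator (fun _ => (1 : ℝ)) s * q.eval s) =
      (Ioi c).indicator (fun s => q.eval s) := by
    ext s
    by_cases hs : s ∈ Ioi c <;> simp [hs]
  rw [e, intervalIntegrable_iff]
  exact (q.continuous.intervalIntegrable 0 1).def'.indicator measurableSet_Ioi

lemma integral_indicator_mul {c : ℝ} (hc : c ∈ Icc (0 : ℝ) 1) (r : ℝ[X]) :
    ∫ s in (0 : ℝ)..1, (Ioi c).indicator (fun _ => (1 : ℝ)) s * (derivative r).eval s =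
      r.eval 1 - r.eval c := by
  have e : (fun s => (Ioi c).indicator (fun _ => (1 : ℝ)) s * (derivative r).eval s) =
      (Ioi c).indicator (fun s => (derivative r).eval s) := by
    ext s
    by_cases hs : s ∈ Ioi c <;> simp [hs]
  rw [e, intervalIntegral.integral_of_le zero_le_one, setIntegral_indicator measurableSet_Ioi,
    Ioc_inter_Ioi, max_eq_right hc.1, ← intervalIntegral.integral_of_le hc.2]
  exact intervalIntegral.integral_eq_sub_of_hasDerivAt (fun s _ => r.hasDerivAt s)
    ((derivative r).continuous.intervalIntegrable _ _)

lemma intervalIntegrable_weightPrimitive_mul (ha : -1 < a) (hb : -1 < b) (q : ℝ[X]) :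
    IntervalIntegrable (fun s => weightPrimitive a b s * q.eval s) volume 0 1 := by
  refine ContinuousOn.intervalIntegrable ?_
  rw [uIcc_of_le zero_le_one]
  exact (continuousOn_weightPrimitive ha hb).mul q.continuous.continuousOn

lemma integral_weightPrimitive_mul (ha : -1 < a) (hb : -1 < b) (r : ℝ[X]) :
    ∫ s in (0 : ℝ)..1, weightPrimitive a b s * (derivative r).eval s =
      weightPrimitive a b 1 * r.eval 1 - ∫ s in (0 : ℝ)..1, unitWeight a b s * r.eval s := by
  have h := intervalIntegral.integral_eq_sub_of_hasDerivAt_of_le zero_le_one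
    (f := fun s => weightPrimitive a b s * r.eval s)
    (f' := fun s => unitWeight a b s * r.eval s +
      weightPrimitive a b s * (derivative r).eval s)
    ((continuousOn_weightPrimitive ha hb).mul r.continuous.continuousOn)
    (fun s hs => (hasDerivAt_weightPrimitive ha hb hs).mul (r.hasDerivAt s))
    ((intervalIntegrable_unitWeight_mul_eval ha hb r).add
      (intervalIntegrable_weightPrimitive_mul ha hb _))
  rw [intervalIntegral.integral_add (intervalIntegrable_unitWeight_mul_eval ha hb r)
      (intervalIntegrable_weightPrimitive_mul ha hb _)] at h
  simp only [weightPrimitive_zero, zero_mul, sub_zero] at h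
  linarith

lemma IsJacobiNodes.sum_christoffel (hx : IsJacobiNodes N a b x) (ha : -1 < a) (hb : -1 < b) :
    ∑ i ∈ Finset.range (N + 1), christoffel N a b x i = weightPrimitive a b 1 := by
  have := hx.quadrature ha hb (q := 1) (by simp)
  simp only [eval_one, mul_one] at this
  exact this.symm

lemma intervalIntegrable_discrepancy_mul (ha : -1 < a) (hb : -1 < b) (q : ℝ[X]) :
    IntervalIntegrable (fun s => discrepancy N a b x s * q.eval s) volume 0 1 := by
  have e : (fun s => discrepancy N a b x s * q.eval s) = fun s =>
      weightPrimitive a b s * q.eval s - ∑ i ∈ Finset.range (N + 1), christoffel N a b x i *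
        ((Ioi (x i)).indicator (fun _ => 1) s * q.eval s) := by
    ext s
    rw [discrepancy, sub_mul, Finset.sum_mul]
    congr 1
    exact Finset.sum_congr rfl fun i _ => by ring
  rw [e]
  refine (intervalIntegrable_weightPrimitive_mul ha hb q).sub ?_
  have := IntervalIntegrable.sum (μ := volume) (a := 0) (b := 1) (Finset.range (N + 1))
    (f := fun i s => christoffel N a b x i *
        ((Ioi (x i)).indicator (fun _ => (1 : ℝ)) s * q.eval s))
    (fun i _ => (intervalIntegrable_indicator_mul (x i) q).const_mul _)
  convert! this using 1
  ext s
  simp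

/-- Integration by parts turns the integral into the quadrature error of an antiderivative of `q`,
which is zero. The boundary terms at `1` cancel because both distributions have the same total mass.
-/
lemma IsJacobiNodes.integral_discrepancy_mul (hx : IsJacobiNodes N a b x) (ha : -1 < a)
    (hb : -1 < b) {q : ℝ[X]} (hq : q.natDegree ≤ 2 * N) :
    ∫ s in (0 : ℝ)..1, discrepancy N a b x s * q.eval s = 0 := by
  obtain ⟨r, rfl, hr⟩ := exists_derivative_eq q
  have e : ∀ s, discrepancy N a b x s * (derivative r).eval s =
      weightPrimitive a b s * (derivative r).eval s -
        ∑ i ∈ Finset.range (N + 1), christoffel N a b x i *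
        ((Ioi (x i)).indicator (fun _ => 1) s * (derivative r).eval s) := by
    intro s
    rw [discrepancy, sub_mul, Finset.sum_mul]
    congr 1
    exact Finset.sum_congr rfl fun i _ => by ring
  have hi : ∀ i ∈ Finset.range (N + 1), IntervalIntegrable (fun s => christoffel N a b x i *
        ((Ioi (x i)).indicator (fun _ => (1 : ℝ)) s * (derivative r).eval s)) volume 0 1 :=
    fun i _ => (intervalIntegrable_indicator_mul (x i) _).const_mul _
  have hs : IntervalIntegrable (fun s => ∑ i ∈ Finset.range (N + 1), christoffel N a b x i *
        ((Ioi (x i)).indicator (fun _ => (1 : ℝ)) s * (derivative r).eval s)) volume 0 1 := by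
    convert! IntervalIntegrable.sum (μ := volume) (a := 0) (b := 1) (Finset.range (N + 1)) hi
      using 1
    ext s
    simp
  simp only [e]
  rw [intervalIntegral.integral_sub (intervalIntegrable_weightPrimitive_mul ha hb _) hs,
    intervalIntegral.integral_finsetSum hi, integral_weightPrimitive_mul ha hb,
    hx.quadrature ha hb (hr.trans (by omega)), ← hx.sum_christoffel ha hb, Finset.sum_mul,
    ← Finset.sum_sub_distrib, ← Finset.sum_sub_distrib]
  refine Finset.sum_eq_zero fun i hi => ?_
  have hmem := hx.mem i (Nat.lt_succ_iff.1 (Finset.mem_range.1 hi))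
  rw [intervalIntegral.integral_const_mul, integral_indicator_mul ⟨hmem.1.le, hmem.2.le⟩]
  ring

lemma IsJacobiNodes.exists_lt_lt (hx : IsJacobiNodes N a b x) {s : ℝ}
    (hs : ∀ i ≤ N, s ≠ x i) :
    ∃ m ≤ N + 1, (∀ i < m, x i < s) ∧ ∀ i, m ≤ i → i ≤ N → s < x i := by
  classical
  by_cases h : ∃ m, m ≤ N ∧ s < x m
  · refine ⟨Nat.find h, (Nat.find_spec h).1.trans (Nat.le_succ N), fun i hi => ?_,
      fun i hi hiN => ?_⟩
    · have hiN : i ≤ N := hi.le.trans (Nat.find_spec h).1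
      have := Nat.find_min h hi
      push Not at this
      exact lt_of_le_of_ne (this hiN) (hs i hiN).symm
    · exact (Nat.find_spec h).2.trans_le
        (hx.strictMonoOn.monotoneOn (Nat.find_spec h).1 hiN hi)
  · push Not at h
    exact ⟨N + 1, le_rfl, fun i hi => lt_of_le_of_ne (h i (by omega)) (hs i (by omega)).symm,
      fun i h1 h2 => by omega⟩

/-- If the sign changes of the discrepancy between consecutive nodes occur at the `y i`, then the
product of all the corresponding linear factors has the sign opposite to the discrepancy. -/
lemma IsJacobiNodes.discrepancy_mul_nonpos (hx : IsJacobiNodes N a b x) (ha : -1 < a)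
    (hb : -1 < b) {y : ℕ → ℝ} (hy : ∀ i < N, y i ∈ Icc (x i) (x (i + 1)))
    (hneg : ∀ i < N, ∀ s ∈ Ioo (x i) (y i),
      weightPrimitive a b s ≤ ∑ j ∈ Finset.range (i + 1), christoffel N a b x j)
    (hpos : ∀ i < N, ∀ s ∈ Ioo (y i) (x (i + 1)),
      ∑ j ∈ Finset.range (i + 1), christoffel N a b x j ≤ weightPrimitive a b s)
    {s : ℝ} (hs : s ∈ Ioo (0 : ℝ) 1) (hsx : ∀ i ≤ N, s ≠ x i) (hsy : ∀ i < N, s ≠ y i) :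
    discrepancy N a b x s *
      ((∏ i ∈ Finset.range (N + 1), (s - x i)) * ∏ i ∈ Finset.range N, (s - y i)) ≤ 0 := by
  obtain ⟨m, hm, hlt, hgt⟩ := hx.exists_lt_lt hsx
  rw [discrepancy_eq hm hlt fun i h1 h2 => (hgt i h1 h2).le]
  -- Pair `y i` with `x (i + 1)`: the pair is nonnegative unless `s` lies in the gap between `x i`
  -- and `x (i + 1)`, that is `i + 1 = m`. Only `s - x 0` and at most one pair can affect the sign.
  have e : (∏ i ∈ Finset.range (N + 1), (s - x i)) * ∏ i ∈ Finset.range N, (s - y i) =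
      (s - x 0) * ∏ i ∈ Finset.range N, ((s - x (i + 1)) * (s - y i)) := by
    rw [Finset.prod_range_succ', Finset.prod_mul_distrib]
    ring
  rw [e]
  have hfac : ∀ i ∈ Finset.range N, i + 1 ≠ m → 0 ≤ (s - x (i + 1)) * (s - y i) := by
    intro i hi hne
    have hi' := Finset.mem_range.1 hi
    rcases lt_or_gt_of_ne hne with h | h
    · have h1 := hlt (i + 1) h
      have h2 := (hy i hi').2
      exact mul_nonneg (by linarith) (by linarith)
    · have h1 := hgt i (by omega) hi'.le
      have h2 := (hy i hi').1
      have h3 := hgt (i + 1) (by omega) (by omega)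
      exact mul_nonneg_of_nonpos_of_nonpos (by linarith) (by linarith)
  have hmono := (weightPrimitive_strictMonoOn ha hb).monotoneOn
  rcases Nat.eq_zero_or_pos m with rfl | hmpos
  · have h0 := hgt 0 le_rfl (Nat.zero_le _)
    have hW := hmono ⟨le_rfl, zero_le_one⟩ ⟨hs.1.le, hs.2.le⟩ hs.1.le
    rw [weightPrimitive_zero] at hW
    simp only [Finset.range_zero, Finset.sum_empty, sub_zero]
    refine mul_nonpos_of_nonneg_of_nonpos hW (mul_nonpos_of_nonpos_of_nonneg (by linarith) ?_)
    exact Finset.prod_nonneg fun i hi => hfac i hi (by omega)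
  · have h0 := hlt 0 hmpos
    rcases Nat.lt_or_ge N m with hmN | hmN
    · obtain rfl : m = N + 1 := by omega
      have hW := hmono ⟨hs.1.le, hs.2.le⟩ ⟨zero_le_one, le_rfl⟩ hs.2.le
      rw [hx.sum_christoffel ha hb]
      refine mul_nonpos_of_nonpos_of_nonneg (by linarith) (mul_nonneg (by linarith) ?_)
      refine Finset.prod_nonneg fun i hi => hfac i hi ?_
      have := Finset.mem_range.1 hi
      omega
    · obtain ⟨k, rfl⟩ : ∃ k, m = k + 1 := ⟨m - 1, by omega⟩
      have hk : k ∈ Finset.range N := Finset.mem_range.2 (by omega)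
      have hkN : k < N := by omega
      rw [← Finset.mul_prod_erase _ _ hk]
      have hrest : 0 ≤ ∏ i ∈ (Finset.range N).erase k, ((s - x (i + 1)) * (s - y i)) := by
        refine Finset.prod_nonneg fun i hi => hfac i (Finset.mem_of_mem_erase hi) ?_
        have := Finset.ne_of_mem_erase hi
        omega
      have h1 := hlt k (by omega)
      have h2 := hgt (k + 1) le_rfl (by omega)
      have hkey : 0 ≤ (weightPrimitive a b s - ∑ i ∈ Finset.range (k + 1), christoffel N a b x i) *
          (s - y k) := by
        rcases lt_or_gt_of_ne (hsy k hkN) with h | h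
        · have := hneg k hkN s ⟨h1, h⟩
          exact mul_nonneg_of_nonpos_of_nonpos (by linarith) (by linarith)
        · have := hpos k hkN s ⟨h, h2⟩
          exact mul_nonneg (by linarith) (by linarith)
      have h3 : (s - x 0) * (s - x (k + 1)) ≤ 0 :=
        mul_nonpos_of_nonneg_of_nonpos (by linarith) (by linarith)
      have := mul_nonpos_of_nonneg_of_nonpos (mul_nonneg hkey hrest) h3
      linarith

/-- A sign change of the discrepancy between two consecutive nodes cannot coincide with a node. -/
lemma IsJacobiNodes.crossing_ne (hx : IsJacobiNodes N a b x) (ha : -1 < a)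
    (hb : -1 < b) {y : ℕ → ℝ} (hy : ∀ i < N, y i ∈ Icc (x i) (x (i + 1)))
    (hneg : ∀ i < N, ∀ s ∈ Ioo (x i) (y i),
      weightPrimitive a b s ≤ ∑ j ∈ Finset.range (i + 1), christoffel N a b x j)
    (hpos : ∀ i < N, ∀ s ∈ Ioo (y i) (x (i + 1)),
      ∑ j ∈ Finset.range (i + 1), christoffel N a b x j ≤ weightPrimitive a b s)
    {i j : ℕ} (hi : i < N) (hj : j ≤ N) : y i ≠ x j := by
  intro hij
  set A : ℝ[X] := Lagrange.nodal (Finset.range (N + 1)) x with hA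
  set B : ℝ[X] := Lagrange.nodal (Finset.range N) y with hB
  have hjm : j ∈ Finset.range (N + 1) := Finset.mem_range.2 (by omega)
  have him : i ∈ Finset.range N := Finset.mem_range.2 hi
  -- A coincidence makes `(X - C (x j)) ^ 2` a factor of the product of degree `2 N + 1`. Removing
  -- it leaves `D`, whose product with the discrepancy still has one sign although its degree is low
  -- enough for orthogonality.
  set D : ℝ[X] := Lagrange.nodal ((Finset.range (N + 1)).erase j) x *
    Lagrange.nodal ((Finset.range N).erase i) y with hD
  have hfac : A * B = (X - C (x j)) ^ 2 * D := by
    rw [hA, hB, Lagrange.nodal_eq_mul_nodal_erase hjm, Lagrange.nodal_eq_mul_nodal_erase him, hij,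
      hD]
    ring
  have hD0 : D ≠ 0 := mul_ne_zero Lagrange.nodal_ne_zero Lagrange.nodal_ne_zero
  have hDdeg : D.natDegree ≤ 2 * N := by
    refine natDegree_mul_le.trans ?_
    rw [Lagrange.natDegree_nodal, Lagrange.natDegree_nodal, Finset.card_erase_of_mem hjm,
      Finset.card_erase_of_mem him, Finset.card_range, Finset.card_range]
    omega
  have hzero := hx.integral_discrepancy_mul ha hb hDdeg
  set E : Set ℝ := x '' (Iic N) ∪ y '' (Iio N) with hE
  have hEfin : E.Finite := ((finite_Iic N).image _).union ((finite_Iio N).image _)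
  have hsign : ∀ s ∈ Ioo (0 : ℝ) 1 \ E, 0 ≤ -(discrepancy N a b x s * D.eval s) := by
    rintro s ⟨hs, hsE⟩
    have hsx : ∀ i ≤ N, s ≠ x i := fun i hi h => hsE (Or.inl ⟨i, hi, h.symm⟩)
    have hsy : ∀ i < N, s ≠ y i := fun i hi h => hsE (Or.inr ⟨i, hi, h.symm⟩)
    have h := hx.discrepancy_mul_nonpos ha hb hy hneg hpos hs hsx hsy
    rw [← Lagrange.eval_nodal, ← Lagrange.eval_nodal, ← eval_mul, hfac, eval_mul] at h
    have hsq : 0 < (s - x j) ^ 2 := by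
      have := sub_ne_zero.2 (hsx j hj)
      positivity
    simp only [eval_pow, eval_sub, eval_X, eval_C] at h
    by_contra hcon
    push Not at hcon
    nlinarith
  have hx0 := hx.mem 0 (Nat.zero_le _)
  have hpos' : 0 < ∫ s in (0 : ℝ)..1, -(discrepancy N a b x s * D.eval s) := by
    rw [intervalIntegral.integral_of_le zero_le_one, integral_Ioc_eq_integral_Ioo,
      setIntegral_pos_iff_support_of_nonneg_ae]
    -- To the left of the first node the discrepancy is the primitive of the weight, hence positive;
    -- this makes the integral strictly positive.
    · have hsub : Ioo (0 : ℝ) (x 0) \ (D.roots.toFinset : Set ℝ) ⊆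
          Function.support (fun s => -(discrepancy N a b x s * D.eval s)) ∩ Ioo 0 1 := by
        rintro s ⟨hs, hsD⟩
        refine ⟨?_, hs.1, hs.2.trans hx0.2⟩
        have h1 : D.eval s ≠ 0 := fun h0 => hsD (by simpa [hD0] using h0)
        have h2 : discrepancy N a b x s ≠ 0 := by
          rw [discrepancy_eq (m := 0) (Nat.zero_le _) (fun i hi => by omega) fun i _ hi =>
            hs.2.le.trans (hx.strictMonoOn.monotoneOn (Nat.zero_le N) hi (Nat.zero_le i))]
          simp only [Finset.range_zero, Finset.sum_empty, sub_zero]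
          have := weightPrimitive_strictMonoOn ha hb ⟨le_rfl, zero_le_one⟩
            ⟨hs.1.le, (hs.2.trans hx0.2).le⟩ hs.1
          rw [weightPrimitive_zero] at this
          exact this.ne'
        exact neg_ne_zero.2 (mul_ne_zero h2 h1)
      refine lt_of_lt_of_le ?_ (measure_mono hsub)
      rw [measure_sdiff_null (Finset.measure_zero _ _)]
      simpa using hx0.1
    · have h1 : ∀ᵐ s ∂(volume.restrict (Ioo (0 : ℝ) 1)), s ∉ E :=
        ae_restrict_of_ae (compl_mem_ae_iff.2 (hEfin.measure_zero _))
      filter_upwards [h1, ae_restrict_mem measurableSet_Ioo] with s h1 h2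
      exact hsign s ⟨h2, h1⟩
    · exact (intervalIntegrable_iff_integrableOn_Ioo_of_le zero_le_one).1
        (intervalIntegrable_discrepancy_mul ha hb D).neg
  rw [intervalIntegral.integral_neg, hzero, neg_zero] at hpos'
  exact lt_irrefl _ hpos'

/-- When the level `S` is not attained, the crossing is placed at an endpoint. The last two clauses
record this, so that a failing Stieltjes inequality puts a crossing at a node. -/
lemma exists_crossing {f : ℝ → ℝ} {u v S : ℝ} (huv : u ≤ v) (hf : ContinuousOn f (Icc u v))
    (hm : MonotoneOn f (Icc u v)) :
    ∃ y ∈ Icc u v, (∀ s ∈ Ioo u y, f s ≤ S) ∧ (∀ s ∈ Ioo y v, S ≤ f s) ∧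
      (S < f u → y = u) ∧ (f v < S → y = v) := by
  have hu : u ∈ Icc u v := ⟨le_rfl, huv⟩
  have hv : v ∈ Icc u v := ⟨huv, le_rfl⟩
  rcases lt_or_ge S (f u) with h1 | h1
  · exact ⟨u, hu, fun s hs => absurd hs.1 (not_lt.2 hs.2.le),
      fun s hs => h1.le.trans (hm hu ⟨hs.1.le, hs.2.le⟩ hs.1.le), fun _ => rfl,
      fun h => absurd (hm hu hv huv) (by linarith)⟩
  · rcases lt_or_ge (f v) S with h2 | h2
    · exact ⟨v, hv, fun s hs => (hm ⟨hs.1.le, hs.2.le⟩ hv hs.2.le).trans h2.le,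
        fun s hs => absurd hs.1 (not_lt.2 hs.2.le), fun h => absurd h (not_lt.2 h1), fun _ => rfl⟩
    · obtain ⟨y, hy, hyS⟩ := intermediate_value_Icc huv hf ⟨h1, h2⟩
      exact ⟨y, hy,
        fun s hs => (hm ⟨hs.1.le, hs.2.le.trans hy.2⟩ hy hs.2.le).trans hyS.le,
        fun s hs => hyS.ge.trans (hm hy ⟨hy.1.trans hs.1.le, hs.2.le⟩ hs.1.le),
        fun h => absurd h (not_lt.2 h1), fun h => absurd h (not_lt.2 h2)⟩

/-- The Chebyshev–Markov–Stieltjes inequalities. -/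
theorem IsJacobiNodes.stieltjes (hx : IsJacobiNodes N a b x) (ha : -1 < a) (hb : -1 < b) {j : ℕ}
    (hj : j ≤ N) :
    ∑ i ∈ Finset.range j, christoffel N a b x i ≤ weightPrimitive a b (x j) ∧
      weightPrimitive a b (x j) ≤ ∑ i ∈ Finset.range (j + 1), christoffel N a b x i := by
  have hmono := (weightPrimitive_strictMonoOn ha hb).monotoneOn
  have hex : ∀ i, ∃ y, i < N → y ∈ Icc (x i) (x (i + 1)) ∧
      (∀ s ∈ Ioo (x i) y, weightPrimitive a b s ≤
        ∑ j ∈ Finset.range (i + 1), christoffel N a b x j) ∧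
      (∀ s ∈ Ioo y (x (i + 1)), ∑ j ∈ Finset.range (i + 1), christoffel N a b x j ≤
        weightPrimitive a b s) ∧
      (∑ j ∈ Finset.range (i + 1), christoffel N a b x j < weightPrimitive a b (x i) → y = x i) ∧
      (weightPrimitive a b (x (i + 1)) < ∑ j ∈ Finset.range (i + 1), christoffel N a b x j →
        y = x (i + 1)) := by
    intro i
    by_cases hi : i < N
    · have h1 := hx.mem i hi.le
      have h2 := hx.mem (i + 1) hi
      have hsub : Icc (x i) (x (i + 1)) ⊆ Icc 0 1 := Icc_subset_Icc h1.1.le h2.2.le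
      obtain ⟨y, hy, h⟩ := exists_crossing (S := ∑ j ∈ Finset.range (i + 1), christoffel N a b x j)
        (hx.strictMonoOn.monotoneOn hi.le hi (Nat.le_succ i))
        ((continuousOn_weightPrimitive ha hb).mono hsub) (hmono.mono hsub)
      exact ⟨y, fun _ => ⟨hy, h⟩⟩
    · exact ⟨0, fun h => absurd h hi⟩
  choose y hy using hex
  have hcross : ∀ {i j : ℕ}, i < N → j ≤ N → y i ≠ x j := fun hi hj =>
    hx.crossing_ne ha hb (fun i hi => (hy i hi).1) (fun i hi => (hy i hi).2.1)
      (fun i hi => (hy i hi).2.2.1) hi hj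
  have hmem := hx.mem j hj
  -- A failure would place the crossing of a gap adjacent to `x j` at `x j` itself, which `hcross`
  -- excludes. Where that gap is absent, at an extreme node, the bound by zero or by the total mass
  -- suffices.
  constructor
  · rcases j with _ | k
    · simpa using hmono ⟨le_rfl, zero_le_one⟩ ⟨hmem.1.le, hmem.2.le⟩ hmem.1.le
    · by_contra hcon
      exact hcross (Nat.lt_of_succ_le hj) hj ((hy k hj).2.2.2.2 (not_le.1 hcon))
  · rcases hj.lt_or_eq with hlt | rfl
    · by_contra hcon
      exact hcross hlt hj ((hy j hlt).2.2.2.1 (not_le.1 hcon))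
    · rw [hx.sum_christoffel ha hb]
      exact hmono ⟨hmem.1.le, hmem.2.le⟩ ⟨zero_le_one, le_rfl⟩ hmem.2.le

end Stieltjes

/-! ### Spacing of the zeros -/

section Spacing

variable {a b l : ℝ} {P : ℝ[X]}

/-- Picone's inequality for the Jacobi equation and the test function `(s - u) * (v - s)`. -/
lemma JacobiODE.picone (h : JacobiODE a b l P) {u v : ℝ} (hu : 0 < u) (huv : u ≤ v) (hv : v < 1)
    (hP : ∀ s ∈ Icc u v, P.eval s ≠ 0) :
    l * ∫ s in u..v, unitWeight a b s * ((s - u) * (v - s)) ^ 2 ≤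
      ∫ s in u..v, unitWeight (a + 1) (b + 1) s * (u + v - 2 * s) ^ 2 := by
  have hsub : Icc u v ⊆ Ioo 0 1 := fun s hs => ⟨hu.trans_le hs.1, hs.2.trans_lt hv⟩
  have hcw : ContinuousOn (unitWeight a b) (Icc u v) := (continuousOn_unitWeight a b).mono hsub
  have hcp : ContinuousOn (unitWeight (a + 1) (b + 1)) (Icc u v) :=
    (continuousOn_unitWeight _ _).mono hsub
  have hcr : ContinuousOn (fun s => (derivative P).eval s / P.eval s) (Icc u v) :=
    (derivative P).continuous.continuousOn.div P.continuous.continuousOn hP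
  set f1 : ℝ → ℝ := fun s => unitWeight a b s * ((s - u) * (v - s)) ^ 2 with hf1
  set f2 : ℝ → ℝ := fun s => unitWeight (a + 1) (b + 1) s * (u + v - 2 * s) ^ 2 with hf2
  set f3 : ℝ → ℝ := fun s => unitWeight (a + 1) (b + 1) s *
    ((u + v - 2 * s) - (s - u) * (v - s) * ((derivative P).eval s / P.eval s)) ^ 2 with hf3
  have hc1 : ContinuousOn f1 (Icc u v) := hcw.mul (by fun_prop)
  have hc2 : ContinuousOn f2 (Icc u v) := hcp.mul (by fun_prop)
  have hc3 : ContinuousOn f3 (Icc u v) := by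
    refine hcp.mul (ContinuousOn.pow (ContinuousOn.sub (by fun_prop) ?_) 2)
    exact ContinuousOn.mul (by fun_prop) hcr
  have hi1 := hc1.intervalIntegrable_of_Icc (μ := volume) huv
  have hi2 := hc2.intervalIntegrable_of_Icc (μ := volume) huv
  have hi3 := hc3.intervalIntegrable_of_Icc (μ := volume) huv
  -- Picone's identity with `φ = (s - u) (v - s)`: the derivative of `p P' φ² / P` is `p φ'² - l w
  -- φ² - p (φ' - φ P' / P)²`. The boundary terms vanish with `φ`, and the last square is discarded.
  have hderiv : ∀ s ∈ uIcc u v, HasDerivAt (fun s =>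
      unitWeight (a + 1) (b + 1) s * (derivative P).eval s * ((s - u) * (v - s)) ^ 2 / P.eval s)
      (f2 s - l * f1 s - f3 s) s := by
    intro s hs
    rw [uIcc_of_le huv] at hs
    have hs' := hsub hs
    have hφ : HasDerivAt (fun s : ℝ => ((s - u) * (v - s)) ^ 2)
        (2 * ((s - u) * (v - s)) * (u + v - 2 * s)) s := by
      have := (((hasDerivAt_id s).sub_const u).mul ((hasDerivAt_id s).const_sub v)).pow 2
      convert! this using 1
      simp only [Pi.mul_apply, id]
      push_cast
      ring
    have := ((h.hasDerivAt_flux hs'.1 hs'.2).mul hφ).div (P.hasDerivAt s) (hP s hs)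
    convert! this using 1
    have hne := hP s hs
    simp only [hf1, hf2, hf3, Pi.mul_apply]
    field_simp
    ring
  have hFTC := intervalIntegral.integral_eq_sub_of_hasDerivAt hderiv
    ((hi2.sub (hi1.const_mul l)).sub hi3)
  have hnonneg : 0 ≤ ∫ s in u..v, f3 s := by
    refine intervalIntegral.integral_nonneg huv fun s hs => ?_
    exact mul_nonneg (unitWeight_pos _ _ (hsub hs).1 (hsub hs).2).le (sq_nonneg _)
  rw [intervalIntegral.integral_sub (hi2.sub (hi1.const_mul l)) hi3,
    intervalIntegral.integral_sub hi2 (hi1.const_mul l),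
    intervalIntegral.integral_const_mul] at hFTC
  simp only [sub_self, zero_mul, mul_zero, ne_eq, OfNat.ofNat_ne_zero, not_false_eq_true,
    zero_pow, zero_div] at hFTC
  linarith

lemma integral_bump_sq (u v : ℝ) :
    ∫ s in u..v, ((s - u) * (v - s)) ^ 2 = (v - u) ^ 5 / 30 := by
  have hd : ∀ s ∈ uIcc u v, HasDerivAt (fun s => (v - u) ^ 2 * (s - u) ^ 3 / 3 -
      (v - u) * (s - u) ^ 4 / 2 + (s - u) ^ 5 / 5) (((s - u) * (v - s)) ^ 2) s := by
    intro s _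
    have h := (hasDerivAt_id s).sub_const u
    have := ((((h.pow 3).const_mul ((v - u) ^ 2)).div_const 3).sub
      (((h.pow 4).const_mul (v - u)).div_const 2)).add ((h.pow 5).div_const 5)
    convert! this using 1
    simp
    ring
  rw [intervalIntegral.integral_eq_sub_of_hasDerivAt hd
    (Continuous.intervalIntegrable (by fun_prop) _ _)]
  ring

lemma integral_deriv_bump_sq (u v : ℝ) :
    ∫ s in u..v, (u + v - 2 * s) ^ 2 = (v - u) ^ 3 / 3 := by
  have hd : ∀ s ∈ uIcc u v, HasDerivAt (fun s => -(u + v - 2 * s) ^ 3 / 6)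
      ((u + v - 2 * s) ^ 2) s := by
    intro s _
    have := ((((hasDerivAt_id s).const_mul 2).const_sub (u + v)).pow 3).neg.div_const 6
    convert! this using 1
    simp
    ring
  rw [intervalIntegral.integral_eq_sub_of_hasDerivAt hd
    (Continuous.intervalIntegrable (by fun_prop) _ _)]
  ring

/-- The constant in the upper bound for the length of a zero-free interval. -/
noncomputable def gapConst (a b : ℝ) : ℝ := 10 * ((2 : ℝ) ^ (|a| + |b|) * 2 ^ (|a| + |b|))

lemma one_le_gapConst (a b : ℝ) : 1 ≤ gapConst a b := by
  have : (1 : ℝ) ≤ 2 ^ (|a| + |b|) := Real.one_le_rpow (by norm_num) (by positivity)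
  rw [gapConst]
  nlinarith

lemma gapConst_comm (a b : ℝ) : gapConst a b = gapConst b a := by
  rw [gapConst, gapConst, add_comm]

/-- The ratio conditions keep the weight within a fixed factor of its value at `u`, so Picone's
inequality reduces to comparing `(v - u) ^ 5 / 30` with `(v - u) ^ 3 / 3`. -/
lemma JacobiODE.sq_gap_le_of_Icc (h : JacobiODE a b l P) (hl : 0 ≤ l) {u v : ℝ} (hu : 0 < u)
    (huv : u < v) (hv : v < 1) (h1 : v ≤ 2 * u) (h2 : 1 - u ≤ 2 * (1 - v))
    (hP : ∀ s ∈ Icc u v, P.eval s ≠ 0) :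
    l * (v - u) ^ 2 ≤ gapConst a b * (v * (1 - u)) := by
  have hu1 : u ∈ Ioo (0 : ℝ) 1 := ⟨hu, huv.trans hv⟩
  have hmem : ∀ s ∈ Icc u v, s ∈ Ioo (0 : ℝ) 1 := fun s hs => ⟨hu.trans_le hs.1, hs.2.trans_lt hv⟩
  set M : ℝ := (2 : ℝ) ^ (|a| + |b|) with hM
  have hMpos : 0 < M := by positivity
  have hw0 := unitWeight_pos a b hu1.1 hu1.2
  have hup : ∀ s ∈ Icc u v, unitWeight a b s ≤ M * unitWeight a b u := fun s hs =>
    unitWeight_le_of_ratio (hmem s hs) hu1 (by linarith [hs.2]) (by linarith [hs.1])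
      (by linarith [hs.1, hs.2]) (by linarith [hs.1, hs.2]) a b
  have hlo : ∀ s ∈ Icc u v, unitWeight a b u ≤ M * unitWeight a b s := fun s hs =>
    unitWeight_le_of_ratio hu1 (hmem s hs) (by linarith [hs.1]) (by linarith [hs.2])
      (by linarith [hs.1, hs.2]) (by linarith [hs.1, hs.2]) a b
  have hsub : Icc u v ⊆ Ioo 0 1 := hmem
  have hpic := h.picone hu huv.le hv hP
  have hlow : unitWeight a b u / M * ((v - u) ^ 5 / 30) ≤
      ∫ s in u..v, unitWeight a b s * ((s - u) * (v - s)) ^ 2 := by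
    rw [← integral_bump_sq, ← intervalIntegral.integral_const_mul]
    refine intervalIntegral.integral_mono_on huv.le
      (Continuous.intervalIntegrable (by fun_prop) _ _) ?_ fun s hs => ?_
    · exact (((continuousOn_unitWeight a b).mono hsub).mul
        (by fun_prop)).intervalIntegrable_of_Icc huv.le
    · refine mul_le_mul_of_nonneg_right ?_ (sq_nonneg _)
      rw [div_le_iff₀ hMpos, mul_comm]
      exact hlo s hs
  have hhigh : ∫ s in u..v, unitWeight (a + 1) (b + 1) s * (u + v - 2 * s) ^ 2 ≤
      M * unitWeight a b u * (v * (1 - u)) * ((v - u) ^ 3 / 3) := by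
    rw [← integral_deriv_bump_sq, ← intervalIntegral.integral_const_mul]
    refine intervalIntegral.integral_mono_on huv.le ?_
      (Continuous.intervalIntegrable (by fun_prop) _ _) fun s hs => ?_
    · exact (((continuousOn_unitWeight _ _).mono hsub).mul
        (by fun_prop)).intervalIntegrable_of_Icc huv.le
    · refine mul_le_mul_of_nonneg_right ?_ (sq_nonneg _)
      rw [unitWeight_succ a b (hmem s hs).1 (hmem s hs).2]
      have := hmem s hs
      exact mul_le_mul (hup s hs) (mul_le_mul hs.2 (by linarith [hs.1]) (by linarith [this.2])
        (by linarith)) (mul_nonneg this.1.le (by linarith [this.2])) (by positivity)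
  have hd : 0 < v - u := sub_pos.2 huv
  have hall : l * (unitWeight a b u / M * ((v - u) ^ 5 / 30)) ≤
      M * unitWeight a b u * (v * (1 - u)) * ((v - u) ^ 3 / 3) :=
    (mul_le_mul_of_nonneg_left hlow hl).trans (hpic.trans hhigh)
  have hfac : 0 < unitWeight a b u / M * ((v - u) ^ 3 / 30) := by positivity
  refine le_of_mul_le_mul_left ?_ hfac
  calc unitWeight a b u / M * ((v - u) ^ 3 / 30) * (l * (v - u) ^ 2)
      = l * (unitWeight a b u / M * ((v - u) ^ 5 / 30)) := by ring
    _ ≤ _ := hall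
    _ = _ := by
      -- The factor `10` is `30 / 3`, and the two powers of `2` come from the lower and the upper
      -- comparison of the weight.
      rw [gapConst, ← hM]
      field_simp
      ring

/-- A zero-free interval `(u,v)` of a solution has length `O(√(v (1 - u) / l))`. -/
lemma JacobiODE.sq_gap_le (h : JacobiODE a b l P) (hl : 0 ≤ l) {u v : ℝ}
    (huv : u < v) (h1 : v ≤ 2 * u) (h2 : 1 - u ≤ 2 * (1 - v))
    (hP : ∀ s ∈ Ioo u v, P.eval s ≠ 0) :
    l * (v - u) ^ 2 ≤ gapConst a b * (v * (1 - u)) := by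
  -- `P` may vanish at `u` and `v`, so the closed-interval bound is applied to `[u + e, v - e]` and
  -- `e` tends to `0`.
  have hev : ∀ᶠ e in nhdsWithin (0 : ℝ) (Ioi 0),
      l * ((v - e) - (u + e)) ^ 2 ≤ gapConst a b * ((v - e) * (1 - (u + e))) := by
    filter_upwards [Ioo_mem_nhdsGT (show (0 : ℝ) < (v - u) / 2 by linarith)] with e he
    have h3 := he.1
    have h4 := he.2
    exact h.sq_gap_le_of_Icc hl (by linarith) (by linarith) (by linarith) (by linarith)
      (by linarith) fun s hs => hP s ⟨by linarith [hs.1], by linarith [hs.2]⟩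
  have t1 : Filter.Tendsto (fun e : ℝ => l * ((v - e) - (u + e)) ^ 2) (nhdsWithin 0 (Ioi 0))
      (nhds (l * ((v - 0) - (u + 0)) ^ 2)) :=
    ((by fun_prop : Continuous fun e : ℝ => l * ((v - e) - (u + e)) ^ 2).tendsto 0).mono_left
      nhdsWithin_le_nhds
  have t2 : Filter.Tendsto (fun e : ℝ => gapConst a b * ((v - e) * (1 - (u + e))))
      (nhdsWithin 0 (Ioi 0)) (nhds (gapConst a b * ((v - 0) * (1 - (u + 0))))) :=
    ((by fun_prop : Continuous fun e : ℝ =>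
      gapConst a b * ((v - e) * (1 - (u + e)))).tendsto 0).mono_left nhdsWithin_le_nhds
  simpa using le_of_tendsto_of_tendsto t1 t2 hev

/-! ### The distance of the zeros from the end points -/

/-- The constant in the lower bound for the smallest zero. -/
noncomputable def endConst (a b : ℝ) : ℝ :=
  min (1 / 2) ((a + 1) / ((2 : ℝ) ^ |b| * 2 ^ (b + 1)))

lemma endConst_pos (ha : -1 < a) (b : ℝ) : 0 < endConst a b := by
  have : 0 < a + 1 := by linarith
  rw [endConst]
  positivity

/-- The flux `p P'` starts at `0` and decreases, hence so does `P`. Since then `0 < P ≤ P(0)`, the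
flux is at least `-M s ^ (a + 1)`, which bounds `P'` below by a multiple of `-l P(0)`. A fall from
`P(0)` to `0` at this slope takes a length of order at least `1 / l`. -/
lemma JacobiODE.endConst_le_of_pos (h : JacobiODE a b l P) (ha : -1 < a) (hb : -1 < b)
    (hl : 1 ≤ l) {v : ℝ} (hv0 : 0 < v) (hv1 : v < 1) (hv : P.eval v = 0)
    (hP : ∀ s ∈ Ico 0 v, 0 < P.eval s) : endConst a b ≤ l * v := by
  rcases lt_or_ge (1 / 2) v with hhalf | hhalf
  · exact (min_le_left _ _).trans (by nlinarith)
  refine (min_le_right _ _).trans ?_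
  have ha1 : 0 < a + 1 := by linarith
  have hb1 : 0 < b + 1 := by linarith
  set p := unitWeight (a + 1) (b + 1) with hp
  have hflux : ContinuousOn (fun s => p s * (derivative P).eval s) (Icc 0 v) :=
    ((continuous_unitWeight_succ ha hb).mul (derivative P).continuous).continuousOn
  have hp0 : p 0 = 0 := unitWeight_succ_zero _ ha
  have hanti : AntitoneOn (fun s => p s * (derivative P).eval s) (Icc 0 v) := by
    refine antitoneOn_of_deriv_nonpos (convex_Icc 0 v) hflux ?_ ?_
    · rw [interior_Icc]
      exact fun s hs => (h.hasDerivAt_flux hs.1 (hs.2.trans hv1)).differentiableAt.differentiableWithinAt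
    · rw [interior_Icc]
      intro s hs
      rw [(h.hasDerivAt_flux hs.1 (hs.2.trans hv1)).deriv]
      have h1 := unitWeight_pos a b hs.1 (hs.2.trans hv1)
      have h2 := hP s ⟨hs.1.le, hs.2⟩
      have : 0 ≤ l * (unitWeight a b s * P.eval s) := by positivity
      linarith
  have hder : ∀ s ∈ Ioo 0 v, (derivative P).eval s ≤ 0 := by
    intro s hs
    have := hanti ⟨le_rfl, hv0.le⟩ ⟨hs.1.le, hs.2.le⟩ hs.1.le
    simp only [hp0, zero_mul] at this
    have h1 : 0 < p s := unitWeight_pos _ _ hs.1 (hs.2.trans hv1)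
    by_contra hcon
    nlinarith
  have hPanti : AntitoneOn (fun s => P.eval s) (Icc 0 v) := by
    refine antitoneOn_of_deriv_nonpos (convex_Icc 0 v) P.continuous.continuousOn
      P.differentiable.differentiableOn ?_
    rw [interior_Icc]
    intro s hs
    rw [Polynomial.deriv]
    exact hder s hs
  have hP0 : 0 < P.eval 0 := hP 0 ⟨le_rfl, hv0⟩
  -- `M * s ^ (a + 1)` is the integral over `(0,s)` of the bound `l * P(0) * 2 ^ |b| * s ^ a` for `l
  -- w P`.
  set M : ℝ := l * P.eval 0 * 2 ^ |b| / (a + 1) with hM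
  have hmono : MonotoneOn (fun s => p s * (derivative P).eval s + M * s ^ (a + 1)) (Icc 0 v) := by
    have hd : ∀ s ∈ Ioo 0 v, HasDerivAt
        (fun s => p s * (derivative P).eval s + M * s ^ (a + 1))
        (-l * (unitWeight a b s * P.eval s) + M * ((a + 1) * s ^ a)) s := by
      intro s hs
      refine (h.hasDerivAt_flux hs.1 (hs.2.trans hv1)).add (HasDerivAt.const_mul _ ?_)
      simpa using Real.hasDerivAt_rpow_const (x := s) (p := a + 1) (Or.inl hs.1.ne')
    refine monotoneOn_of_deriv_nonneg (convex_Icc 0 v) ?_ ?_ ?_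
    · refine hflux.add (Continuous.continuousOn (continuous_const.mul ?_))
      exact continuous_id.rpow_const fun _ => Or.inr ha1.le
    · rw [interior_Icc]
      exact fun s hs => (hd s hs).differentiableAt.differentiableWithinAt
    · rw [interior_Icc]
      intro s hs
      rw [(hd s hs).deriv]
      have h1 : (1 - s) ^ b ≤ 2 ^ |b| := by
        have := rpow_le_of_ratio (K := 2) (x := 1 - s) (y := 1) (by linarith [hs.2]) one_pos
          (by linarith [hs.1]) (by linarith [hs.2]) b
        simpa using this
      have h2 : P.eval s ≤ P.eval 0 := hPanti ⟨le_rfl, hv0.le⟩ ⟨hs.1.le, hs.2.le⟩ hs.1.le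
      have h3 : (1 - s) ^ b * P.eval s ≤ 2 ^ |b| * P.eval 0 :=
        mul_le_mul h1 h2 (hP s ⟨hs.1.le, hs.2⟩).le (by positivity)
      have h4 : 0 ≤ s ^ a := Real.rpow_nonneg hs.1.le _
      have e : -l * (unitWeight a b s * P.eval s) + M * ((a + 1) * s ^ a) =
          l * s ^ a * (2 ^ |b| * P.eval 0 - (1 - s) ^ b * P.eval s) := by
        rw [unitWeight, hM]
        field_simp
        ring
      rw [e]
      exact mul_nonneg (by positivity) (by linarith)
  have hlow : ∀ s ∈ Ioo 0 v, -(M * 2 ^ (b + 1)) ≤ (derivative P).eval s := by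
    intro s hs
    have := hmono ⟨le_rfl, hv0.le⟩ ⟨hs.1.le, hs.2.le⟩ hs.1.le
    simp only [hp0, zero_mul, Real.zero_rpow ha1.ne', mul_zero, add_zero] at this
    have hspos : 0 < s ^ (a + 1) := Real.rpow_pos_of_pos hs.1 _
    have hge : 1 ≤ (1 - s) ^ (b + 1) * 2 ^ (b + 1) := by
      rw [← Real.mul_rpow (by linarith [hs.2]) (by norm_num)]
      exact Real.one_le_rpow (by linarith [hs.2]) hb1.le
    have hMpos : 0 < M := by positivity
    have h2 : 0 ≤ (1 - s) ^ (b + 1) * (derivative P).eval s + M := by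
      have : 0 ≤ s ^ (a + 1) * ((1 - s) ^ (b + 1) * (derivative P).eval s + M) := by
        rw [hp] at this
        simp only [unitWeight] at this
        linarith
      exact nonneg_of_mul_nonneg_right this hspos
    by_contra hcon
    push Not at hcon
    have hb2 : 0 < (1 - s) ^ (b + 1) := Real.rpow_pos_of_pos (by linarith [hs.2]) _
    nlinarith
  have hmvt : -(M * 2 ^ (b + 1)) * (v - 0) ≤ P.eval v - P.eval 0 := by
    refine Convex.mul_sub_le_image_sub_of_le_deriv (convex_Icc 0 v) P.continuous.continuousOn
      P.differentiable.differentiableOn ?_ 0 ⟨le_rfl, hv0.le⟩ v ⟨hv0.le, le_rfl⟩ hv0.le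
    rw [interior_Icc]
    intro s hs
    rw [Polynomial.deriv]
    exact hlow s hs
  rw [hv, hM] at hmvt
  have h5 : P.eval 0 ≤ P.eval 0 * (l * v * (2 ^ |b| * 2 ^ (b + 1)) / (a + 1)) := by
    have e : P.eval 0 * (l * v * (2 ^ |b| * 2 ^ (b + 1)) / (a + 1)) =
      l * P.eval 0 * 2 ^ |b| / (a + 1) * 2 ^ (b + 1) * (v - 0) := by ring
    rw [e]
    linarith
  have h6 : 1 ≤ l * v * (2 ^ |b| * 2 ^ (b + 1)) / (a + 1) := by
    by_contra hcon
    push Not at hcon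
    nlinarith
  rw [div_le_iff₀ (by positivity)]
  rwa [le_div_iff₀ ha1, one_mul] at h6

/-- The smallest zero of a solution is bounded below by a multiple of `1 / l`. -/
lemma JacobiODE.endConst_le (h : JacobiODE a b l P) (ha : -1 < a) (hb : -1 < b)
    (hl : 1 ≤ l) (hP0 : P ≠ 0) {v : ℝ} (hv0 : 0 < v) (hv1 : v < 1) (hv : P.eval v = 0)
    (hP : ∀ s ∈ Ioo 0 v, P.eval s ≠ 0) : endConst a b ≤ l * v := by
  have hzero := h.eval_zero_ne ha hP0
  have hne : ∀ s ∈ Ico 0 v, P.eval s ≠ 0 := by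
    intro s hs
    rcases hs.1.eq_or_lt with rfl | h0
    · exact hzero
    · exact hP s ⟨h0, hs.2⟩
  have hivt : ∀ Q : ℝ[X], (∀ s ∈ Ico 0 v, Q.eval s ≠ 0) → 0 < Q.eval 0 →
      ∀ s ∈ Ico 0 v, 0 < Q.eval s := by
    intro Q hQ hQ0 s hs
    by_contra hcon
    push Not at hcon
    obtain ⟨t, ht, ht0⟩ := intermediate_value_Icc' hs.1 Q.continuous.continuousOn
      (⟨hcon, hQ0.le⟩ : (0 : ℝ) ∈ Icc _ _)
    exact hQ t ⟨ht.1, ht.2.trans_lt hs.2⟩ ht0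
  rcases lt_or_gt_of_ne hzero with hs | hs
  · have hneg : JacobiODE a b l (-P) := by
      unfold JacobiODE at h ⊢
      simp only [derivative_neg]
      linear_combination -h
    refine hneg.endConst_le_of_pos ha hb hl hv0 hv1 (by simp [hv]) (hivt (-P) ?_ ?_)
    · intro s hs
      simpa using hne s hs
    · simpa using hs
  · exact h.endConst_le_of_pos ha hb hl hv0 hv1 hv (hivt P hne hs)

end Spacing

/-! ### Regular intervals -/

/-- The interval `[u,v]` is at most comparable in size to its distances from `0` and `1`, and its
length is `O(√(u (1 - v) / l))`. -/
structure RegularInterval (K l u v : ℝ) : Prop where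
  pos : 0 < u
  le : u ≤ v
  lt_one : v < 1
  left : v ≤ K * u
  right : 1 - u ≤ K * (1 - v)
  length : l * (v - u) ^ 2 ≤ K * (u * (1 - v))

namespace RegularInterval

variable {K K' l u v t : ℝ}

lemma mono (h : RegularInterval K l u v) (hK : K ≤ K') : RegularInterval K' l u v where
  pos := h.pos
  le := h.le
  lt_one := h.lt_one
  left := h.left.trans (mul_le_mul_of_nonneg_right hK h.pos.le)
  right := h.right.trans (mul_le_mul_of_nonneg_right hK (by linarith [h.lt_one]))
  length := h.length.trans (mul_le_mul_of_nonneg_right hK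
    (mul_nonneg h.pos.le (by linarith [h.lt_one])))

lemma reflect (h : RegularInterval K l u v) : RegularInterval K l (1 - v) (1 - u) where
  pos := by linarith [h.lt_one]
  le := by linarith [h.le]
  lt_one := by linarith [h.pos]
  left := h.right
  right := by linarith [h.left]
  length := by have := h.length; ring_nf at this ⊢; exact this

/-- The ratios multiply to `K ^ 2`. For the length, `(x + y)² ≤ 2 x² + 2 y²` and replacing the
intermediate point by the outer one give `2 + 2` times `K ^ 2`. -/
lemma trans (h : RegularInterval K l u v) (h' : RegularInterval K l v t) (hK : 1 ≤ K)
    (hl : 0 ≤ l) : RegularInterval (4 * K ^ 2) l u t := by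
  have hu := h.pos
  have ht : 0 < 1 - t := by linarith [h'.lt_one]
  have h1 : t ≤ K * (K * u) := h'.left.trans (by gcongr; exact h.left)
  have h2 : 1 - u ≤ K * (K * (1 - t)) := h.right.trans (by gcongr; exact h'.right)
  refine ⟨hu, h.le.trans h'.le, h'.lt_one, ?_, ?_, ?_⟩
  · have : 0 ≤ K ^ 2 * u := by positivity
    linarith
  · have : 0 ≤ K ^ 2 * (1 - t) := by positivity
    linarith
  · have h3 : K * (u * (1 - v)) ≤ K * (u * (K * (1 - t))) := by gcongr; exact h'.right
    have h4 : K * (v * (1 - t)) ≤ K * (K * u * (1 - t)) := by gcongr; exact h.left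
    have h5 : (t - u) ^ 2 ≤ 2 * (v - u) ^ 2 + 2 * (t - v) ^ 2 := by
      nlinarith [sq_nonneg ((v - u) - (t - v))]
    have h6 := mul_le_mul_of_nonneg_left h5 hl
    have h7 := h.length
    have h8 := h'.length
    linarith

end RegularInterval

section Regular

variable {a b l c : ℝ} {P : ℝ[X]}

/-- If `v ≤ 2 u`, the gap bound applies directly. Otherwise it applies to `(v / 2, v)` and gives `l
v ≤ 4 D`; together with `c ≤ l u` this makes `v` comparable to `u`. -/
lemma JacobiODE.left_gap (h : JacobiODE a b l P) (hl : 1 ≤ l) (hc : 0 < c) (hc2 : c ≤ 1 / 2)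
    {u v : ℝ} (hu : 0 < u) (huv : u < v) (hv : v ≤ 1 / 2) (hP : ∀ s ∈ Ioo u v, P.eval s ≠ 0)
    (hcu : c ≤ l * u) :
    v ≤ 16 * gapConst a b ^ 2 / c * u ∧ l * (v - u) ^ 2 ≤ 16 * gapConst a b ^ 2 / c * u := by
  have hD := one_le_gapConst a b
  set D := gapConst a b with hDdef
  have hl0 : 0 < l := by linarith
  have hDK : 32 * D ^ 2 ≤ 16 * D ^ 2 / c := by
    rw [le_div_iff₀ hc]
    nlinarith [sq_nonneg D]
  have hD2 : D ≤ D ^ 2 := by nlinarith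
  rcases le_or_gt v (2 * u) with h2 | h2
  · refine ⟨h2.trans (mul_le_mul_of_nonneg_right (by linarith) hu.le), ?_⟩
    have := h.sq_gap_le hl0.le huv h2 (by linarith) hP
    refine this.trans ?_
    rw [← hDdef]
    calc D * (v * (1 - u)) ≤ D * ((2 * u) * 1) := by
          gcongr
          · linarith
          · linarith
      _ = (2 * D) * u := by ring
      _ ≤ _ := mul_le_mul_of_nonneg_right (by linarith) hu.le
  · have hv0 : 0 < v := hu.trans huv
    have := h.sq_gap_le hl0.le (u := v / 2) (v := v) (by linarith) (by linarith) (by linarith)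
      fun s hs => hP s ⟨by linarith [hs.1], hs.2⟩
    rw [← hDdef] at this
    have h3 : l * v ≤ 4 * D := by
      have h4 : D * (v * (1 - v / 2)) ≤ D * v := by
        refine mul_le_mul_of_nonneg_left ?_ (by linarith)
        nlinarith
      have h5 : v * (l * v) ≤ v * (4 * D) := by nlinarith
      exact le_of_mul_le_mul_left h5 hv0
    have h6 : 4 * D ≤ 4 * D / c * (l * u) := by
      rw [div_mul_eq_mul_div, le_div_iff₀ hc]
      gcongr
    have h7 : v ≤ 4 * D / c * u := by
      have : l * v ≤ l * (4 * D / c * u) := by linarith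
      exact le_of_mul_le_mul_left this hl0
    have h8 : 4 * D / c ≤ 16 * D ^ 2 / c := by
      gcongr
      linarith
    refine ⟨h7.trans (mul_le_mul_of_nonneg_right h8 hu.le), ?_⟩
    calc l * (v - u) ^ 2 ≤ l * v ^ 2 := by
          gcongr
          linarith
      _ = (l * v) * v := by ring
      _ ≤ (4 * D) * (4 * D / c * u) := by gcongr
      _ = 16 * D ^ 2 / c * u := by ring

/-- The gap is cut at `1 / 2`; the left piece is handled by `left_gap` and the right piece by its
reflection. -/
lemma JacobiODE.regularInterval (h : JacobiODE a b l P) (hl : 1 ≤ l) (hc : 0 < c)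
    (hc2 : c ≤ 1 / 2) {u v : ℝ} (hu : 0 < u) (huv : u < v) (hv : v < 1)
    (hP : ∀ s ∈ Ioo u v, P.eval s ≠ 0) (hcu : c ≤ l * u) (hcv : c ≤ l * (1 - v)) :
    RegularInterval (16 * (16 * gapConst a b ^ 2 / c) ^ 2) l u v := by
  have hD := one_le_gapConst a b
  have hK1 : 1 ≤ 16 * gapConst a b ^ 2 / c := by
    rw [le_div_iff₀ hc]
    nlinarith
  set K := 16 * gapConst a b ^ 2 / c with hK
  have hv' : 0 < 1 - v := by linarith
  have hleft : u < 1 / 2 → min v (1 / 2) ≤ K * u ∧ l * (min v (1 / 2) - u) ^ 2 ≤ K * u :=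
    fun hu2 => h.left_gap hl hc hc2 hu (lt_min huv hu2) (min_le_right _ _)
      (fun s hs => hP s ⟨hs.1, hs.2.trans_le (min_le_left _ _)⟩) hcu
  have hright : 1 / 2 < v → min (1 - u) (1 / 2) ≤ K * (1 - v) ∧
      l * (min (1 - u) (1 / 2) - (1 - v)) ^ 2 ≤ K * (1 - v) := by
    intro hv2
    have := h.reflect.left_gap hl hc hc2 (u := 1 - v) (v := min (1 - u) (1 / 2)) hv'
      (lt_min (by linarith) (by linarith)) (min_le_right _ _) (fun s hs => ?_) hcv
    · rwa [gapConst_comm b a] at this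
    · have h1 := hs.2.trans_le (min_le_left _ _)
      have h2 := hs.1
      simpa using hP (1 - s) ⟨by linarith, by linarith⟩
  have h16 : 2 * K ≤ 16 * K ^ 2 := by nlinarith
  have hKu : K ≤ K * K := by nlinarith
  have hl0 : 0 ≤ l := by linarith
  have hvu : v ≤ 2 * K * u := by
    rcases lt_or_ge u (1 / 2) with h1 | h1
    · have := (hleft h1).1
      rcases le_total v (1 / 2) with h2 | h2
      · rw [min_eq_left h2] at this; nlinarith
      · rw [min_eq_right h2] at this; nlinarith
    · nlinarith
  have huv' : 1 - u ≤ 2 * K * (1 - v) := by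
    rcases lt_or_ge (1 / 2) v with h1 | h1
    · have := (hright h1).1
      rcases le_total (1 - u) (1 / 2) with h2 | h2
      · rw [min_eq_left h2] at this; nlinarith
      · rw [min_eq_right h2] at this; nlinarith
    · nlinarith
  refine ⟨hu, huv.le, hv, ?_, ?_, ?_⟩
  · exact hvu.trans (mul_le_mul_of_nonneg_right h16 hu.le)
  · exact huv'.trans (mul_le_mul_of_nonneg_right h16 hv'.le)
  · rcases le_or_gt v (1 / 2) with h1 | h1
    · have := (hleft (by linarith)).2
      rw [min_eq_left h1] at this
      calc l * (v - u) ^ 2 ≤ K * u := this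
        _ = K * u * 1 := (mul_one _).symm
        _ ≤ K * u * (2 * (1 - v)) := by gcongr; linarith
        _ = (2 * K) * (u * (1 - v)) := by ring
        _ ≤ _ := mul_le_mul_of_nonneg_right h16 (by positivity)
    · rcases le_or_gt (1 / 2) u with h2 | h2
      · have := (hright h1).2
        rw [min_eq_left (by linarith)] at this
        calc l * (v - u) ^ 2 = l * ((1 - u) - (1 - v)) ^ 2 := by ring
          _ ≤ K * (1 - v) := this
          _ = K * (1 - v) * 1 := (mul_one _).symm
          _ ≤ K * (1 - v) * (2 * u) := by gcongr; linarith
          _ = (2 * K) * (u * (1 - v)) := by ring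
          _ ≤ _ := mul_le_mul_of_nonneg_right h16 (by positivity)
      -- The gap straddles `1 / 2`, so `u` and `1 - v` are both at least `1 / (4 K)`; hence each is
      -- bounded by a multiple of their product.
      · have e1 := (hleft h2).2
        have e2 := (hright h1).2
        rw [min_eq_right h1.le] at e1
        rw [min_eq_right (by linarith)] at e2
        have e3 : (v - u) ^ 2 ≤ 2 * (1 / 2 - u) ^ 2 + 2 * (1 / 2 - (1 - v)) ^ 2 := by
          nlinarith [sq_nonneg ((1 / 2 - u) - (1 / 2 - (1 - v)))]
        have e4 := mul_le_mul_of_nonneg_left e3 hl0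
        have e5 : 1 ≤ 4 * K * u := by linarith
        have e6 : 1 ≤ 4 * K * (1 - v) := by linarith
        have e7 : u ≤ 4 * K * (1 - v) * u := le_mul_of_one_le_left hu.le e6
        have e8 : 1 - v ≤ 4 * K * u * (1 - v) := le_mul_of_one_le_left hv'.le e5
        have e9 : K * u ≤ K * (4 * K * (1 - v) * u) := by gcongr
        have e10 : K * (1 - v) ≤ K * (4 * K * u * (1 - v)) := by gcongr
        linarith

/-- Bounds for the first zero `v` in terms of its distance from `1`. -/
lemma JacobiODE.first_zero_bounds (h : JacobiODE a b l P) (hl : 1 ≤ l) (hc : 0 < c)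
    (hc2 : c ≤ 1 / 2) {v : ℝ} (hv0 : 0 < v) (hv1 : v < 1)
    (hP : ∀ s ∈ Ioo 0 v, P.eval s ≠ 0) (hcv : c ≤ l * (1 - v)) :
    c / (8 * gapConst a b) ≤ 1 - v ∧ l * v ≤ 8 * gapConst a b := by
  have hD := one_le_gapConst a b
  set D := gapConst a b with hDdef
  have hl0 : 0 < l := by linarith
  rcases le_or_gt v (1 / 2) with h1 | h1
  · have := h.sq_gap_le hl0.le (u := v / 2) (v := v) (by linarith) (by linarith) (by linarith)
      fun s hs => hP s ⟨by linarith [hs.1], hs.2⟩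
    rw [← hDdef] at this
    constructor
    · rw [div_le_iff₀ (by positivity)]
      nlinarith
    · have h4 : D * (v * (1 - v / 2)) ≤ D * v := by
        refine mul_le_mul_of_nonneg_left ?_ (by linarith)
        nlinarith
      have h5 : v * (l * v) ≤ v * (4 * D) := by nlinarith
      linarith [le_of_mul_le_mul_left h5 hv0]
  -- Here `(1 / 4, 1 / 2)` is zero-free, which bounds `l` itself; then `c ≤ l (1 - v)` bounds `1 -
  -- v` below.
  · have := h.sq_gap_le hl0.le (u := 1 / 4) (v := 1 / 2) (by linarith) (by linarith) (by linarith)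
      fun s hs => hP s ⟨by linarith [hs.1], by linarith [hs.2]⟩
    rw [← hDdef] at this
    norm_num at this
    have hl8 : l ≤ 8 * D := by linarith
    constructor
    · rw [div_le_iff₀ (by positivity)]
      nlinarith
    · nlinarith

/-- By `first_zero_bounds`, `1 - v` is bounded below and `l v` above, so `l (v / 2)²` is controlled
by the distance to `0` alone. -/
lemma JacobiODE.regularInterval_end (h : JacobiODE a b l P) (hl : 1 ≤ l) (hc : 0 < c)
    (hc2 : c ≤ 1 / 2) {v : ℝ} (hv0 : 0 < v) (hv1 : v < 1)
    (hP : ∀ s ∈ Ioo 0 v, P.eval s ≠ 0) (hcv : c ≤ l * (1 - v)) :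
    RegularInterval (32 * gapConst a b ^ 2 / c) l (v / 2) v := by
  obtain ⟨h1, h2⟩ := h.first_zero_bounds hl hc hc2 hv0 hv1 hP hcv
  have hD := one_le_gapConst a b
  set D := gapConst a b with hDdef
  have hD2 : D ≤ D ^ 2 := by nlinarith
  have hKc : 4 * D ≤ 32 * D ^ 2 / c * (1 - v) := by
    calc 4 * D = 32 * D ^ 2 / c * (c / (8 * D)) := by field_simp; norm_num
      _ ≤ _ := by gcongr
  have hK2 : 2 ≤ 32 * D ^ 2 / c := by
    rw [le_div_iff₀ hc]
    nlinarith
  refine ⟨by linarith, by linarith, hv1, ?_, ?_, ?_⟩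
  · nlinarith
  · linarith
  · calc l * (v - v / 2) ^ 2 = (l * v) * (v / 4) := by ring
      _ ≤ (8 * D) * (v / 4) := by gcongr
      _ = (4 * D) * (v / 2) := by ring
      _ ≤ (32 * D ^ 2 / c * (1 - v)) * (v / 2) := by gcongr
      _ = _ := by ring

/-- Near `0` the Jacobi weight has the doubling property. -/
lemma integral_unitWeight_le_half (ha : -1 < a) (hb : -1 < b) {δ v : ℝ} (hδ : 0 < δ)
    (hv0 : 0 < v) (hv : δ ≤ 1 - v) :
    ∫ s in (0 : ℝ)..v, unitWeight a b s ≤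
      (1 / δ) ^ |b| * (1 / δ) ^ |b| * 2 ^ |a| * 2 / (a + 1) *
        ∫ s in v / 2..v, unitWeight a b s := by
  have ha1 : 0 < a + 1 := by linarith
  -- On `[0,v]` the factor `1 - s` stays in `[δ,1]`, so `(1 - s) ^ b` lies between `1 / B` and `B`
  -- and only `s ^ a` has to be integrated.
  set B : ℝ := (1 / δ) ^ |b| with hB
  have hBpos : 0 < B := by positivity
  have hδ1 : 1 ≤ 1 / δ := by rw [le_div_iff₀ hδ]; linarith
  have hfac : ∀ s ∈ Icc 0 v, (1 - s) ^ b ≤ B ∧ 1 ≤ B * (1 - s) ^ b := by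
    intro s hs
    have h1 : δ ≤ 1 - s := by linarith [hs.2]
    have h2 : 0 < 1 - s := by linarith
    have h3 : 1 ≤ 1 / δ * (1 - s) := by rw [div_mul_eq_mul_div, le_div_iff₀ hδ]; linarith
    have h4 : 1 - s ≤ 1 / δ * 1 := by linarith [hs.1]
    exact ⟨by simpa [hB] using rpow_le_of_ratio h2 one_pos h4 h3 b,
      by simpa [hB] using rpow_le_of_ratio one_pos h2 h3 h4 b⟩
  have hi : ∀ {x y : ℝ}, x ∈ Icc 0 v → y ∈ Icc 0 v →
      IntervalIntegrable (unitWeight a b) volume x y := fun hx hy =>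
    intervalIntegrable_unitWeight_of_mem ha hb ⟨hx.1, by linarith [hx.2]⟩
      ⟨hy.1, by linarith [hy.2]⟩
  have hup : ∫ s in (0 : ℝ)..v, unitWeight a b s ≤ B * (v ^ (a + 1) / (a + 1)) := by
    have e : ∫ s in (0 : ℝ)..v, s ^ a = v ^ (a + 1) / (a + 1) := by
      rw [integral_rpow (Or.inl ha), Real.zero_rpow ha1.ne', sub_zero]
    rw [← e, ← intervalIntegral.integral_const_mul]
    refine intervalIntegral.integral_mono_on hv0.le (hi ⟨le_rfl, hv0.le⟩ ⟨hv0.le, le_rfl⟩)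
      ((intervalIntegral.intervalIntegrable_rpow' ha).const_mul B) fun s hs => ?_
    rw [unitWeight, mul_comm]
    exact mul_le_mul_of_nonneg_right (hfac s hs).1 (Real.rpow_nonneg hs.1 _)
  have hlow : (v / 2) * (v ^ a / (2 ^ |a| * B)) ≤ ∫ s in v / 2..v, unitWeight a b s := by
    have e : ∫ _ in v / 2..v, v ^ a / (2 ^ |a| * B) = (v / 2) * (v ^ a / (2 ^ |a| * B)) := by
      rw [intervalIntegral.integral_const, smul_eq_mul]
      ring
    rw [← e]
    refine intervalIntegral.integral_mono_on (by linarith) intervalIntegrable_const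
      (hi ⟨by linarith, by linarith⟩ ⟨hv0.le, le_rfl⟩) fun s hs => ?_
    have hs0 : 0 < s := by linarith [hs.1]
    have h1 : v ^ a ≤ 2 ^ |a| * s ^ a :=
      rpow_le_of_ratio hv0 hs0 (by linarith [hs.1]) (by linarith [hs.2]) a
    have h2 := (hfac s ⟨hs0.le, hs.2⟩).2
    rw [div_le_iff₀ (by positivity), unitWeight]
    calc v ^ a ≤ 2 ^ |a| * s ^ a * 1 := by rw [mul_one]; exact h1
      _ ≤ 2 ^ |a| * s ^ a * (B * (1 - s) ^ b) := by gcongr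
      _ = _ := by ring
  refine hup.trans ?_
  calc B * (v ^ (a + 1) / (a + 1))
      = B * B * 2 ^ |a| * 2 / (a + 1) * ((v / 2) * (v ^ a / (2 ^ |a| * B))) := by
        rw [Real.rpow_add_one hv0.ne']
        field_simp
    _ ≤ _ := by gcongr

end Regular

/-! ### The Gauss nodes and weights -/

/-- The Gauss nodes together with one additional point on each side. -/
noncomputable def extendedNodes (N : ℕ) (x : ℕ → ℝ) : ℕ → ℝ
  | 0 => x 0 / 2
  | i + 1 => if i ≤ N then x i else (1 + x N) / 2

section Nodes

variable {N : ℕ} {a b : ℝ} {x : ℕ → ℝ}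

lemma extendedNodes_zero : extendedNodes N x 0 = x 0 / 2 := rfl

/-- The shift by one puts the neighbours of `x j` at the indices `j` and `j + 2`. -/
lemma extendedNodes_succ {i : ℕ} (hi : i ≤ N) : extendedNodes N x (i + 1) = x i := by
  simp [extendedNodes, hi]

lemma extendedNodes_last : extendedNodes N x (N + 2) = (1 + x N) / 2 := by
  simp [extendedNodes]

lemma IsJacobiNodes.ne_zero_of_mem_gap (hx : IsJacobiNodes N a b x) {i : ℕ} (hi : i < N) {s : ℝ}
    (hs : s ∈ Ioo (x i) (x (i + 1))) : (unitJacobi (N + 1) a b).eval s ≠ 0 := by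
  intro h0
  have h1 := hx.mem i hi.le
  have h2 := hx.mem (i + 1) hi
  obtain ⟨j, hj, rfl⟩ := hx.exhaust s ⟨h1.1.trans hs.1, hs.2.trans h2.2⟩ h0
  have h3 := (hx.strictMonoOn.lt_iff_lt (mem_Iic.2 hi.le) (mem_Iic.2 hj)).1 hs.1
  have h4 := (hx.strictMonoOn.lt_iff_lt (mem_Iic.2 hj) (mem_Iic.2 hi)).1 hs.2
  omega

lemma IsJacobiNodes.ne_zero_of_lt (hx : IsJacobiNodes N a b x) {s : ℝ}
    (hs : s ∈ Ioo 0 (x 0)) : (unitJacobi (N + 1) a b).eval s ≠ 0 := by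
  intro h0
  obtain ⟨j, hj, rfl⟩ := hx.exhaust s ⟨hs.1, hs.2.trans (hx.mem 0 (Nat.zero_le _)).2⟩ h0
  have := (hx.strictMonoOn.lt_iff_lt (mem_Iic.2 hj) (mem_Iic.2 (Nat.zero_le _))).1 hs.2
  omega

lemma IsJacobiNodes.ne_zero_of_gt (hx : IsJacobiNodes N a b x) {s : ℝ}
    (hs : s ∈ Ioo (x N) 1) : (unitJacobi (N + 1) a b).eval s ≠ 0 := by
  intro h0
  obtain ⟨j, hj, rfl⟩ := hx.exhaust s ⟨(hx.mem N le_rfl).1.trans hs.1, hs.2⟩ h0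
  have := (hx.strictMonoOn.lt_iff_lt (mem_Iic.2 le_rfl) (mem_Iic.2 hj)).1 hs.1
  omega

/-- The neighbouring Gauss nodes span regular intervals, whose weights dominate the Christoffel
numbers. -/
theorem exists_regularInterval (ha : -1 < a) (hb : -1 < b) :
    ∃ K : ℝ, 1 ≤ K ∧ ∀ (N : ℕ) (x : ℕ → ℝ), 1 ≤ N → IsJacobiNodes N a b x →
      (∀ i ≤ N + 1, RegularInterval K (jacobiEigenvalue (N + 1) a b) (extendedNodes N x i)
        (extendedNodes N x (i + 1))) ∧
      ∀ j ≤ N, christoffel N a b x j ≤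
        K * ∫ s in extendedNodes N x j..extendedNodes N x (j + 2), unitWeight a b s := by
  set c := min (endConst a b) (endConst b a) with hcdef
  have hc : 0 < c := lt_min (endConst_pos ha b) (endConst_pos hb a)
  have hc2 : c ≤ 1 / 2 := (min_le_left _ _).trans (min_le_left _ _)
  set D := gapConst a b with hD
  have hD1 : 1 ≤ D := one_le_gapConst a b
  set δ := c / (8 * D) with hδdef
  have hδ : 0 < δ := by positivity
  set C1 : ℝ := (1 / δ) ^ |b| * (1 / δ) ^ |b| * 2 ^ |a| * 2 / (a + 1) with hC1
  set C2 : ℝ := (1 / δ) ^ |a| * (1 / δ) ^ |a| * 2 ^ |b| * 2 / (b + 1) with hC2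
  have ha1 : 0 < a + 1 := by linarith
  have hb1 : 0 < b + 1 := by linarith
  have hC1pos : 0 < C1 := by positivity
  have hC2pos : 0 < C2 := by positivity
  -- The sum dominates the constants of the interior gaps, of the two end intervals, and `1` plus
  -- the doubling constants.
  set K : ℝ := 16 * (16 * D ^ 2 / c) ^ 2 + 32 * D ^ 2 / c + C1 + C2 + 1 with hK
  have hK1 : 16 * (16 * D ^ 2 / c) ^ 2 ≤ K := by
    have : 0 ≤ 32 * D ^ 2 / c := by positivity
    linarith
  have hK2 : 32 * D ^ 2 / c ≤ K := by
    have : 0 ≤ 16 * (16 * D ^ 2 / c) ^ 2 := by positivity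
    linarith
  have hK34 : 1 + C1 + C2 ≤ K := by
    have : 0 ≤ 16 * (16 * D ^ 2 / c) ^ 2 := by positivity
    have : 0 ≤ 32 * D ^ 2 / c := by positivity
    linarith
  have haux : ∀ {C I₁ I₂ : ℝ}, 0 < C → 1 + C ≤ K → 0 < I₁ → 0 < I₂ →
      C * I₁ + I₂ ≤ K * (I₁ + I₂) := by
    intro C I₁ I₂ hC hCK h1 h2
    calc C * I₁ + I₂ ≤ (1 + C) * (I₁ + I₂) := by nlinarith [mul_pos hC h2]
      _ ≤ _ := by gcongr
  refine ⟨K, by linarith, fun N x hN hx => ?_⟩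
  set l := jacobiEigenvalue (N + 1) a b with hldef
  have hl : 1 ≤ l := by
    have h1 := le_jacobiEigenvalue ha hb hN
    have h2 : (1 : ℝ) ≤ N := by exact_mod_cast hN
    nlinarith
  have hl0 : 0 < l := by linarith
  have hode := jacobiODE_unitJacobi (N + 1) a b
  have hP0 := unitJacobi_ne_zero (N + 1) a hb
  set P := unitJacobi (N + 1) a b with hPdef
  have hx0 := hx.mem 0 (Nat.zero_le _)
  have hxN := hx.mem N le_rfl
  have hrefl0 : P.comp (1 - X) ≠ 0 := by
    intro h0
    apply hP0
    have := congrArg (fun Q : ℝ[X] => Q.comp (1 - X)) h0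
    simpa [comp_assoc] using this
  have hgap0 : ∀ s ∈ Ioo 0 (x 0), P.eval s ≠ 0 := fun s hs => hx.ne_zero_of_lt hs
  have hgapN : ∀ s ∈ Ioo 0 (1 - x N), (P.comp (1 - X)).eval s ≠ 0 := fun s hs => by
    simpa using hx.ne_zero_of_gt (s := 1 - s) ⟨by linarith [hs.2], by linarith [hs.1]⟩
  have hc0 : c ≤ l * x 0 := (min_le_left _ _).trans
    (hode.endConst_le ha hb hl hP0 hx0.1 hx0.2 (hx.root 0 (Nat.zero_le _)) hgap0)
  have hcN : c ≤ l * (1 - x N) := (min_le_right _ _).trans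
    (hode.reflect.endConst_le hb ha hl hrefl0 (by linarith [hxN.2]) (by linarith [hxN.1])
      (by simpa using hx.root N le_rfl) hgapN)
  have hmono := hx.strictMonoOn.monotoneOn
  have hci : ∀ i ≤ N, c ≤ l * x i := fun i hi => hc0.trans
    (mul_le_mul_of_nonneg_left (hmono (mem_Iic.2 (Nat.zero_le _)) (mem_Iic.2 hi) (Nat.zero_le _))
      hl0.le)
  have hci' : ∀ i ≤ N, c ≤ l * (1 - x i) := fun i hi => hcN.trans
    (mul_le_mul_of_nonneg_left
      (by linarith [hmono (mem_Iic.2 hi) (mem_Iic.2 le_rfl) hi]) hl0.le)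
  have hbd0 := (hode.first_zero_bounds hl hc hc2 hx0.1 hx0.2 hgap0
    (hci' 0 (Nat.zero_le _))).1
  have hbdN := (hode.reflect.first_zero_bounds hl hc hc2 (by linarith [hxN.2])
    (by linarith [hxN.1]) hgapN (by simpa using hci N le_rfl)).1
  rw [gapConst_comm b a] at hbdN
  have hreg : ∀ i ≤ N + 1, RegularInterval K l (extendedNodes N x i)
      (extendedNodes N x (i + 1)) := by
    intro i hi
    rcases i with _ | i
    · rw [extendedNodes_zero, extendedNodes_succ (Nat.zero_le _)]
      exact (hode.regularInterval_end hl hc hc2 hx0.1 hx0.2 hgap0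
        (hci' 0 (Nat.zero_le _))).mono hK2
    · have hi' : i ≤ N := by omega
      rw [extendedNodes_succ hi']
      rcases hi'.lt_or_eq with hlt | rfl
      · rw [extendedNodes_succ hlt]
        exact (hode.regularInterval hl hc hc2 (hx.mem i hi').1
          (hx.strictMonoOn (mem_Iic.2 hi') (mem_Iic.2 hlt) (Nat.lt_succ_self i))
          (hx.mem (i + 1) hlt).2 (fun s hs => hx.ne_zero_of_mem_gap hlt hs)
          (hci i hi') (hci' (i + 1) hlt)).mono hK1
      · rw [extendedNodes_last]
        have := hode.reflect.regularInterval_end hl hc hc2 (by linarith [hxN.2])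
          (by linarith [hxN.1]) hgapN (by simpa using hci i le_rfl)
        rw [gapConst_comm b a] at this
        have h2 := (this.mono hK2).reflect
        rw [show 1 - (1 - x i) = x i by ring,
          show 1 - (1 - x i) / 2 = (1 + x i) / 2 by ring] at h2
        exact h2
  refine ⟨hreg, fun j hj => ?_⟩
  -- The Stieltjes inequalities at `x (j + 1)` and `x (j - 1)` bound the first sum above and the
  -- second below; for an interior node the difference is at most the mass between these neighbours.
  have hω : christoffel N a b x j = ∑ i ∈ Finset.range (j + 1), christoffel N a b x i -
      ∑ i ∈ Finset.range j, christoffel N a b x i := by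
    rw [Finset.sum_range_succ]; ring
  have hz : ∀ i ≤ N, x i ∈ Icc (0 : ℝ) 1 := fun i hi =>
    ⟨(hx.mem i hi).1.le, (hx.mem i hi).2.le⟩
  have hKI : ∀ {u v : ℝ}, 0 ≤ u → u < v → v ≤ 1 →
      0 < ∫ s in u..v, unitWeight a b s := fun h1 h2 h3 => integral_unitWeight_pos ha hb h1 h2 h3
  rw [hω]
  -- The first node has no left neighbour: the mass of `(0, x 0)` is traded for a multiple of that
  -- of `(x 0 / 2, x 0)`. The assumption `1 ≤ N` supplies `x 1`.
  rcases Nat.eq_zero_or_pos j with rfl | hj0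
  · rw [extendedNodes_zero, extendedNodes_succ hN, Finset.range_zero, Finset.sum_empty, sub_zero]
    have hx1 := hx.mem 1 hN
    have hx01 : x 0 < x 1 := hx.strictMonoOn (mem_Iic.2 (Nat.zero_le _)) (mem_Iic.2 hN) one_pos
    have h1 := (hx.stieltjes ha hb hN).1
    have h2 := integral_unitWeight_le_half ha hb hδ hx0.1 hbd0
    rw [← hC1] at h2
    have h3 := weightPrimitive_sub (a := a) (b := b) ha hb (hz 0 (Nat.zero_le _)) (hz 1 hN)
    have h4 : x 0 / 2 ∈ Icc (0 : ℝ) 1 := ⟨by linarith [hx0.1], by linarith [hx0.2]⟩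
    have h5 := intervalIntegral.integral_add_adjacent_intervals
      (intervalIntegrable_unitWeight_of_mem ha hb h4 (hz 0 (Nat.zero_le _)))
      (intervalIntegrable_unitWeight_of_mem ha hb (hz 0 (Nat.zero_le _)) (hz 1 hN))
    have p1 := hKI (u := x 0 / 2) (v := x 0) h4.1 (by linarith [hx0.1]) hx0.2.le
    have p2 := hKI hx0.1.le hx01 hx1.2.le
    rw [← h5]
    change weightPrimitive a b (x 0) ≤ _ at h2
    linarith [haux hC1pos (by linarith) p1 p2]
  · obtain ⟨k, rfl⟩ : ∃ k, j = k + 1 := ⟨j - 1, by omega⟩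
    have hkN : k ≤ N := by omega
    have hlow := (hx.stieltjes ha hb hkN).2
    rw [extendedNodes_succ hkN]
    rcases hj.lt_or_eq with hlt | heq
    · rw [extendedNodes_succ (by omega : k + 1 + 1 ≤ N)]
      have hup := (hx.stieltjes ha hb (j := k + 1 + 1) (by omega)).1
      have h3 := weightPrimitive_sub (a := a) (b := b) ha hb (hz k hkN) (hz (k + 1 + 1) (by omega))
      have p1 := hKI (hx.mem k hkN).1.le (hx.strictMonoOn (mem_Iic.2 hkN)
        (mem_Iic.2 (by omega : k + 1 + 1 ≤ N)) (by omega)) (hx.mem (k + 1 + 1) (by omega)).2.le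
      linarith [le_mul_of_one_le_left p1.le (by linarith : 1 ≤ K)]
    -- The last node is treated likewise, the doubling property near `1` being obtained by
    -- reflection.
    · have hkk : k + 1 + 2 = N + 2 := by omega
      rw [heq] at hlow
      rw [hkk, extendedNodes_last, heq, hx.sum_christoffel ha hb]
      have hkx : x k < x N := hx.strictMonoOn (mem_Iic.2 hkN) (mem_Iic.2 le_rfl) (by omega)
      have h2 := integral_unitWeight_le_half hb ha hδ (v := 1 - x N) (by linarith [hxN.2]) hbdN
      rw [← hC2] at h2
      have r1 : ∫ s in (0 : ℝ)..(1 - x N), unitWeight b a s = ∫ s in x N..1, unitWeight a b s := by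
        have := intervalIntegral.integral_comp_sub_left (fun s => unitWeight a b s) (1 : ℝ)
          (a := 0) (b := 1 - x N)
        simpa [unitWeight_reflect] using this
      have r2 : ∫ s in (1 - x N) / 2..(1 - x N), unitWeight b a s =
          ∫ s in x N..(1 + x N) / 2, unitWeight a b s := by
        have := intervalIntegral.integral_comp_sub_left (fun s => unitWeight a b s) (1 : ℝ)
          (a := (1 - x N) / 2) (b := 1 - x N)
        rw [show 1 - (1 - x N) / 2 = (1 + x N) / 2 by ring,
          show 1 - (1 - x N) = x N by ring] at this
        simpa [unitWeight_reflect] using this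
      rw [r1, r2] at h2
      have h4 : (1 + x N) / 2 ∈ Icc (0 : ℝ) 1 := ⟨by linarith [hxN.1], by linarith [hxN.2]⟩
      have h5 := intervalIntegral.integral_add_adjacent_intervals
        (intervalIntegrable_unitWeight_of_mem ha hb (hz k hkN) (hz N le_rfl))
        (intervalIntegrable_unitWeight_of_mem ha hb (hz N le_rfl) h4)
      have h6 := weightPrimitive_sub (a := a) (b := b) ha hb (hz N le_rfl)
        ⟨zero_le_one, le_rfl⟩
      have h7 := weightPrimitive_sub (a := a) (b := b) ha hb (hz k hkN) (hz N le_rfl)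
      have p1 := hKI (hx.mem k hkN).1.le hkx hxN.2.le
      have p2 := hKI (u := x N) (v := (1 + x N) / 2) hxN.1.le (by linarith [hxN.2]) h4.2
      rw [← h5]
      linarith [haux hC2pos (by linarith) p2 p1]

end Nodes

/-! ### Stability of Gauss interpolation on the unit interval -/

/-- Cauchy–Schwarz, by integrating `(|G| - m)² ≥ 0` with `m` the mean of `|G|`. -/
lemma sq_integral_abs_le {G : ℝ → ℝ} {u v : ℝ} (huv : u ≤ v)
    (hG : IntervalIntegrable G volume u v)
    (hG2 : IntervalIntegrable (fun s => G s ^ 2) volume u v) :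
    (∫ s in u..v, |G s|) ^ 2 ≤ (v - u) * ∫ s in u..v, G s ^ 2 := by
  set I := ∫ s in u..v, |G s| with hI
  rcases huv.eq_or_lt with rfl | hlt
  · simp [hI]
  have hd : 0 < v - u := sub_pos.2 hlt
  set m := I / (v - u) with hm
  have h0 : 0 ≤ ∫ s in u..v, (G s ^ 2 - 2 * m * |G s| + m ^ 2) := by
    refine intervalIntegral.integral_nonneg huv fun s _ => ?_
    have : G s ^ 2 - 2 * m * |G s| + m ^ 2 = (|G s| - m) ^ 2 := by
      rw [← sq_abs (G s)]; ring
    rw [this]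
    exact sq_nonneg _
  rw [intervalIntegral.integral_add (hG2.sub (hG.abs.const_mul _)) intervalIntegrable_const,
    intervalIntegral.integral_sub hG2 (hG.abs.const_mul _), intervalIntegral.integral_const_mul,
    intervalIntegral.integral_const, smul_eq_mul, ← hI] at h0
  have h1 : m * (v - u) = I := by rw [hm]; field_simp
  have h2 : (v - u) * (∫ s in u..v, G s ^ 2) - I ^ 2 =
      (v - u) * ((∫ s in u..v, G s ^ 2) - 2 * m * I + (v - u) * m ^ 2) := by
    rw [← h1]; ring
  have := mul_nonneg hd.le h0
  linarith

section Core

variable {a b : ℝ} {F G : ℝ → ℝ}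

lemma intervalIntegrable_of_integrableOn_Ioo {h : ℝ → ℝ} (hh : IntegrableOn h (Ioo 0 1)) {u v : ℝ}
    (hu : u ∈ Ioo (0 : ℝ) 1) (hv : v ∈ Ioo (0 : ℝ) 1) : IntervalIntegrable h volume u v := by
  rw [intervalIntegrable_iff]
  refine hh.mono_set fun s hs => ?_
  exact ⟨(lt_min hu.1 hv.1).trans hs.1, hs.2.trans_lt (max_lt hu.2 hv.2)⟩

/-- The weighted trace inequality on a regular interval. -/
lemma RegularInterval.trace_le {K l u v : ℝ} (h : RegularInterval K l u v) (hK : 1 ≤ K)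
    (hl : 0 < l)
    (hF : IntegrableOn (fun s => F s ^ 2 * unitWeight a b s) (Ioo 0 1))
    (hG : IntegrableOn (fun s => G s ^ 2 * unitWeight (a + 1) (b + 1) s) (Ioo 0 1))
    (hGi : ∀ x ∈ Ioo (0 : ℝ) 1, ∀ y ∈ Ioo (0 : ℝ) 1, IntervalIntegrable G volume x y)
    (hFG : ∀ x ∈ Ioo (0 : ℝ) 1, ∀ y ∈ Ioo (0 : ℝ) 1, ∫ s in x..y, G s = F y - F x)
    {x : ℝ} (hx : x ∈ Icc u v) :
    (∫ s in u..v, unitWeight a b s) * F x ^ 2 ≤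
      2 * (∫ s in u..v, F s ^ 2 * unitWeight a b s) +
        2 * K ^ (|a| + |b|) * K / l * ∫ s in u..v, G s ^ 2 * unitWeight (a + 1) (b + 1) s := by
  have hmem : ∀ s ∈ Icc u v, s ∈ Ioo (0 : ℝ) 1 := fun s hs =>
    ⟨h.pos.trans_le hs.1, hs.2.trans_lt h.lt_one⟩
  have hu := hmem u ⟨le_rfl, h.le⟩
  have hv := hmem v ⟨h.le, le_rfl⟩
  have hsub : uIcc u v ⊆ Ioo 0 1 := by rw [uIcc_of_le h.le]; exact hmem
  have hwi : IntervalIntegrable (unitWeight a b) volume u v :=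
    ((continuousOn_unitWeight a b).mono hsub).intervalIntegrable
  have hFi := intervalIntegrable_of_integrableOn_Ioo hF hu hv
  have hGp := intervalIntegrable_of_integrableOn_Ioo hG hu hv
  have hGuv := hGi u hu v hv
  have hG2 : IntervalIntegrable (fun s => G s ^ 2) volume u v := by
    -- The weight is continuous and positive on `[u,v]`, so dividing by it recovers integrability of
    -- `G ^ 2`.
    have hc : ContinuousOn (fun s => (unitWeight (a + 1) (b + 1) s)⁻¹) (uIcc u v) :=
      ((continuousOn_unitWeight _ _).mono hsub).inv₀ fun s hs =>
        (unitWeight_pos _ _ (hsub hs).1 (hsub hs).2).ne'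
    refine IntervalIntegrable.congr (fun s hs => ?_) (hGp.mul_continuousOn hc)
    have hs' := hsub (uIoc_subset_uIcc hs)
    have := (unitWeight_pos (a + 1) (b + 1) hs'.1 hs'.2).ne'
    field_simp
  set I := ∫ s in u..v, |G s| with hI
  set J := ∫ s in u..v, G s ^ 2 with hJ
  set W := ∫ s in u..v, unitWeight a b s with hW
  have hIJ : I ^ 2 ≤ (v - u) * J := sq_integral_abs_le h.le hGuv hG2
  -- The base point `y` is free; integrating this bound against `w` in `y` produces `W * F x ^ 2`.
  have hpt : ∀ y ∈ Icc u v, F x ^ 2 ≤ 2 * F y ^ 2 + 2 * I ^ 2 := by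
    intro y hy
    have h1 := hFG y (hmem y hy) x (hmem x hx)
    have h2 : |∫ s in y..x, G s| ≤ I := by
      rw [hI, intervalIntegral.integral_of_le h.le]
      simp only [← Real.norm_eq_abs]
      refine intervalIntegral.norm_integral_le_integral_norm_uIoc.trans ?_
      refine setIntegral_mono_set hGuv.1.norm (Filter.Eventually.of_forall fun _ => norm_nonneg _)
        (Filter.Eventually.of_forall fun s hs => ?_)
      exact ⟨(le_min hy.1 hx.1).trans_lt hs.1, hs.2.trans (max_le hy.2 hx.2)⟩
    rw [h1] at h2
    have h3 : (F x - F y) ^ 2 ≤ I ^ 2 := sq_le_sq' (by linarith [abs_le.1 h2]) (le_of_abs_le h2)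
    nlinarith [sq_nonneg (F x - 2 * F y)]
  have hint : W * F x ^ 2 ≤ 2 * (∫ s in u..v, F s ^ 2 * unitWeight a b s) + 2 * I ^ 2 * W := by
    rw [hW, mul_comm, ← intervalIntegral.integral_const_mul, ← intervalIntegral.integral_const_mul,
      ← intervalIntegral.integral_const_mul,
      ← intervalIntegral.integral_add (hFi.const_mul 2) (hwi.const_mul _)]
    refine intervalIntegral.integral_mono_on h.le (hwi.const_mul _)
      ((hFi.const_mul 2).add (hwi.const_mul _)) fun s hs => ?_
    have hw := unitWeight_pos a b (hmem s hs).1 (hmem s hs).2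
    have := mul_le_mul_of_nonneg_right (hpt s hs) hw.le
    linarith
  set M : ℝ := K ^ (|a| + |b|) with hM
  have hMpos : 0 < M := by positivity
  have hd : 0 ≤ v - u := sub_nonneg.2 h.le
  have hWle : ∀ s ∈ Icc u v, W ≤ M * unitWeight a b s * (v - u) := by
    intro s hs
    have e : ∫ _ in u..v, M * unitWeight a b s = M * unitWeight a b s * (v - u) := by
      rw [intervalIntegral.integral_const, smul_eq_mul, mul_comm]
    rw [← e]
    refine intervalIntegral.integral_mono_on h.le hwi intervalIntegrable_const fun t ht => ?_
    have key : ∀ {y z : ℝ}, y ∈ Icc u v → z ∈ Icc u v → y ≤ K * z ∧ 1 - y ≤ K * (1 - z) := by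
      intro y z hy hz
      constructor
      · exact hy.2.trans (h.left.trans (by gcongr; exact hz.1))
      · have h1 : 1 - v ≤ 1 - z := by linarith [hz.2]
        have h2 : K * (1 - v) ≤ K * (1 - z) := by gcongr
        linarith [h.right, hy.1]
    exact unitWeight_le_of_ratio (hmem t ht) (hmem s hs) (key ht hs).1 (key hs ht).1
      (key ht hs).2 (key hs ht).2 a b
  -- After `W ≤ M w(s) (v - u)`, the length condition trades `(v - u)²` for `K s (1 - s) / l`, and
  -- `w s (1 - s)` is precisely the weight carried by `G`.
  have hfin : W * ((v - u) * J) ≤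
      M * K / l * ∫ s in u..v, G s ^ 2 * unitWeight (a + 1) (b + 1) s := by
    rw [hJ, ← mul_assoc, ← intervalIntegral.integral_const_mul,
      ← intervalIntegral.integral_const_mul]
    refine intervalIntegral.integral_mono_on h.le (hG2.const_mul _) (hGp.const_mul _)
      fun s hs => ?_
    have hs' := hmem s hs
    have hw := unitWeight_pos a b hs'.1 hs'.2
    have h1 : (v - u) ^ 2 ≤ K * (s * (1 - s)) / l := by
      rw [le_div_iff₀ hl]
      have : K * (u * (1 - v)) ≤ K * (s * (1 - s)) := by
        have := hs.1
        have := hs.2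
        have := hs'.1
        gcongr
        linarith [hv.2]
      linarith [h.length]
    rw [unitWeight_succ a b hs'.1 hs'.2]
    calc W * (v - u) * G s ^ 2 ≤ M * unitWeight a b s * (v - u) * (v - u) * G s ^ 2 := by
          gcongr
          exact hWle s hs
      _ = M * unitWeight a b s * (v - u) ^ 2 * G s ^ 2 := by ring
      _ ≤ M * unitWeight a b s * (K * (s * (1 - s)) / l) * G s ^ 2 := by gcongr
      _ = _ := by ring
  have hW0 : 0 ≤ W := intervalIntegral.integral_nonneg h.le fun s hs =>
    (unitWeight_pos a b (hmem s hs).1 (hmem s hs).2).le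
  have h5 := mul_le_mul_of_nonneg_left hIJ hW0
  have e : 2 * M * K / l * (∫ s in u..v, G s ^ 2 * unitWeight (a + 1) (b + 1) s) =
    2 * (M * K / l * ∫ s in u..v, G s ^ 2 * unitWeight (a + 1) (b + 1) s) := by ring
  rw [e]
  linarith

/-- Integrals over the double gaps of an increasing sequence add up to at most twice the
integral. -/
lemma sum_integral_double_gap_le {h : ℝ → ℝ} (hh : IntegrableOn h (Ioo 0 1))
    (h0 : ∀ s ∈ Ioo (0 : ℝ) 1, 0 ≤ h s) {z : ℕ → ℝ} {N : ℕ}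
    (hz : ∀ i ≤ N + 2, z i ∈ Ioo (0 : ℝ) 1) (hmono : ∀ i ≤ N + 1, z i ≤ z (i + 1)) :
    ∑ j ∈ Finset.range (N + 1), ∫ s in z j..z (j + 2), h s ≤ 2 * ∫ s in Ioo (0 : ℝ) 1, h s := by
  have hi : ∀ {i j : ℕ}, i ≤ N + 2 → j ≤ N + 2 → IntervalIntegrable h volume (z i) (z j) :=
    fun hi hj => intervalIntegrable_of_integrableOn_Ioo hh (hz _ hi) (hz _ hj)
  have hle : ∀ i j, i ≤ j → j ≤ N + 2 → z i ≤ z j := by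
    intro i j hij
    induction j, hij using Nat.le_induction with
    | base => exact fun _ => le_rfl
    | succ j _ ih => exact fun hj => (ih (by omega)).trans (hmono j (by omega))
  have hbound : ∀ i j, i ≤ j → j ≤ N + 2 → ∫ s in z i..z j, h s ≤ ∫ s in Ioo (0 : ℝ) 1, h s := by
    intro i j hij hj
    rw [intervalIntegral.integral_of_le (hle i j hij hj)]
    refine setIntegral_mono_set hh ?_ (Filter.Eventually.of_forall fun s hs => ?_)
    · exact (ae_restrict_iff' measurableSet_Ioo).2 (Filter.Eventually.of_forall h0)
    · exact ⟨(hz i (by omega)).1.trans hs.1, hs.2.trans_lt (hz j hj).2⟩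
  have hsplit : ∀ j ∈ Finset.range (N + 1), ∫ s in z j..z (j + 2), h s =
      (∫ s in z j..z (j + 1), h s) + ∫ s in z (j + 1)..z (j + 1 + 1), h s := by
    intro j hj
    have := Finset.mem_range.1 hj
    exact (intervalIntegral.integral_add_adjacent_intervals (hi (by omega) (by omega))
      (hi (by omega) (by omega))).symm
  rw [Finset.sum_congr rfl hsplit, Finset.sum_add_distrib,
    intervalIntegral.sum_integral_adjacent_intervals (a := z) (n := N + 1)
      (fun k hk => hi (by omega) (by omega)),
    intervalIntegral.sum_integral_adjacent_intervals (a := fun i => z (i + 1)) (n := N + 1)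
      (fun k hk => hi (by omega) (by omega))]
  linarith [hbound 0 (N + 1) (by omega) (by omega), hbound 1 (N + 1 + 1) (by omega) (by omega)]

/-- The Gauss sums of `F ^ 2` are bounded by the norms of `F` and of its derivative. -/
theorem exists_sum_christoffel_le (ha : -1 < a) (hb : -1 < b) :
    ∃ C : ℝ, 0 < C ∧ ∀ (N : ℕ) (x : ℕ → ℝ), 1 ≤ N → IsJacobiNodes N a b x →
      ∀ F G : ℝ → ℝ,
        IntegrableOn (fun s => F s ^ 2 * unitWeight a b s) (Ioo 0 1) →
        IntegrableOn (fun s => G s ^ 2 * unitWeight (a + 1) (b + 1) s) (Ioo 0 1) →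
        (∀ x ∈ Ioo (0 : ℝ) 1, ∀ y ∈ Ioo (0 : ℝ) 1, IntervalIntegrable G volume x y) →
        (∀ x ∈ Ioo (0 : ℝ) 1, ∀ y ∈ Ioo (0 : ℝ) 1, ∫ s in x..y, G s = F y - F x) →
        ∑ j ∈ Finset.range (N + 1), christoffel N a b x j * F (x j) ^ 2 ≤
          C * ((∫ s in Ioo (0 : ℝ) 1, F s ^ 2 * unitWeight a b s) +
            ((N : ℝ) ^ 2)⁻¹ * ∫ s in Ioo (0 : ℝ) 1, G s ^ 2 * unitWeight (a + 1) (b + 1) s) := by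
  obtain ⟨K, hK, hreg⟩ := exists_regularInterval ha hb
  set L : ℝ := 4 * K ^ 2 with hL
  have hL1 : 1 ≤ L := by nlinarith
  set M : ℝ := 2 * L ^ (|a| + |b|) * L with hM
  have hMpos : 0 < M := by positivity
  refine ⟨K * (4 + 2 * M), by positivity, fun N x hN hx F G hF hG hGi hFG => ?_⟩
  obtain ⟨hR, hω⟩ := hreg N x hN hx
  set l := jacobiEigenvalue (N + 1) a b with hl
  have hNl : (N : ℝ) ^ 2 ≤ l := le_jacobiEigenvalue ha hb hN
  have hN0 : (0 : ℝ) < (N : ℝ) ^ 2 := by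
    have : (0 : ℝ) < N := by exact_mod_cast hN
    positivity
  have hl0 : 0 < l := by linarith
  set z := extendedNodes N x with hz
  have hzmem : ∀ i ≤ N + 2, z i ∈ Ioo (0 : ℝ) 1 := by
    intro i hi
    rcases Nat.eq_zero_or_pos i with rfl | hi0
    · have := hR 0 (by omega)
      exact ⟨this.pos, this.le.trans_lt this.lt_one⟩
    · obtain ⟨k, rfl⟩ : ∃ k, i = k + 1 := ⟨i - 1, by omega⟩
      have := hR k (by omega)
      exact ⟨this.pos.trans_le this.le, this.lt_one⟩
  have hF0 : ∀ s ∈ Ioo (0 : ℝ) 1, 0 ≤ F s ^ 2 * unitWeight a b s := fun s hs =>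
    mul_nonneg (sq_nonneg _) (unitWeight_pos _ _ hs.1 hs.2).le
  have hG0 : ∀ s ∈ Ioo (0 : ℝ) 1, 0 ≤ G s ^ 2 * unitWeight (a + 1) (b + 1) s := fun s hs =>
    mul_nonneg (sq_nonneg _) (unitWeight_pos _ _ hs.1 hs.2).le
  have hterm : ∀ j ∈ Finset.range (N + 1), christoffel N a b x j * F (x j) ^ 2 ≤
      K * (2 * (∫ s in z j..z (j + 2), F s ^ 2 * unitWeight a b s) +
        M / l * ∫ s in z j..z (j + 2), G s ^ 2 * unitWeight (a + 1) (b + 1) s) := by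
    intro j hj
    have hjN : j ≤ N := Nat.lt_succ_iff.1 (Finset.mem_range.1 hj)
    have h1 := hR j (by omega)
    have h2 := hR (j + 1) (by omega)
    -- The node is the common endpoint of two regular intervals; their union is regular with
    -- constant `L = 4 * K ^ 2`.
    have h3 := (h1.trans h2 hK hl0.le).trace_le hL1 hl0 hF hG hGi hFG
      (x := x j) (by
        have e : z (j + 1) = x j := extendedNodes_succ hjN
        rw [← e]
        exact ⟨h1.le, h2.le⟩)
    have h4 := mul_le_mul_of_nonneg_right (hω j hjN) (sq_nonneg (F (x j)))
    have h5 := mul_le_mul_of_nonneg_left h3 (by linarith : 0 ≤ K)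
    refine h4.trans ?_
    rw [mul_assoc]
    exact h5
  refine (Finset.sum_le_sum hterm).trans ?_
  have hmono : ∀ i ≤ N + 1, z i ≤ z (i + 1) := fun i hi => (hR i hi).le
  have hsF := sum_integral_double_gap_le hF hF0 hzmem hmono
  have hsG := sum_integral_double_gap_le hG hG0 hzmem hmono
  rw [← Finset.mul_sum, Finset.sum_add_distrib, ← Finset.mul_sum, ← Finset.mul_sum]
  set A := ∫ s in Ioo (0 : ℝ) 1, F s ^ 2 * unitWeight a b s with hA
  set B := ∫ s in Ioo (0 : ℝ) 1, G s ^ 2 * unitWeight (a + 1) (b + 1) s with hB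
  have hA0 : 0 ≤ A := setIntegral_nonneg measurableSet_Ioo hF0
  have hB0 : 0 ≤ B := setIntegral_nonneg measurableSet_Ioo hG0
  have h6 : M / l ≤ M * ((N : ℝ) ^ 2)⁻¹ := by
    rw [← div_eq_mul_inv]
    gcongr
  calc K * (2 * (∑ j ∈ Finset.range (N + 1), ∫ s in z j..z (j + 2), F s ^ 2 * unitWeight a b s) +
        M / l * ∑ j ∈ Finset.range (N + 1), ∫ s in z j..z (j + 2),
          G s ^ 2 * unitWeight (a + 1) (b + 1) s)
      ≤ K * (2 * (2 * A) + M / l * (2 * B)) := by gcongr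
    _ ≤ K * (2 * (2 * A) + M * ((N : ℝ) ^ 2)⁻¹ * (2 * B)) := by gcongr
    _ ≤ K * (4 + 2 * M) * (A + ((N : ℝ) ^ 2)⁻¹ * B) := by
      have p1 : 0 ≤ K * (2 * M) * A := by positivity
      have p2 : 0 ≤ K * 4 * (((N : ℝ) ^ 2)⁻¹ * B) := by positivity
      linarith

/-- The interpolation polynomial of `F` at the Gauss nodes. -/
noncomputable def gaussInterpolant (N : ℕ) (x : ℕ → ℝ) (F : ℝ → ℝ) : ℝ[X] :=
  Lagrange.interpolate (Finset.range (N + 1)) x fun j => F (x j)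

/-- The square has degree at most `2 N`, within the exactness of the quadrature, and at the nodes
the interpolant equals `F`. -/
lemma IsJacobiNodes.integral_gaussInterpolant_sq {N : ℕ} {x : ℕ → ℝ} (hx : IsJacobiNodes N a b x)
    (ha : -1 < a) (hb : -1 < b) (F : ℝ → ℝ) :
    ∫ s in Ioo (0 : ℝ) 1, (gaussInterpolant N x F).eval s ^ 2 * unitWeight a b s =
      ∑ j ∈ Finset.range (N + 1), christoffel N a b x j * F (x j) ^ 2 := by
  have hdeg : (gaussInterpolant N x F).natDegree ≤ N := by
    have := Lagrange.degree_interpolate_lt (r := fun j => F (x j)) hx.injOn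
    rw [Finset.card_range] at this
    by_cases h0 : gaussInterpolant N x F = 0
    · simp [h0]
    · exact Nat.lt_succ_iff.1 ((natDegree_lt_iff_degree_lt h0).2 this)
  have hq := hx.quadrature ha hb (q := gaussInterpolant N x F ^ 2)
    (natDegree_pow_le.trans (by omega))
  rw [intervalIntegral.integral_of_le zero_le_one, integral_Ioc_eq_integral_Ioo] at hq
  simp only [eval_pow] at hq
  calc _ = ∫ s in Ioo (0 : ℝ) 1, unitWeight a b s * (gaussInterpolant N x F).eval s ^ 2 := by
        congr 1; ext s; ring
    _ = _ := hq
    _ = _ := Finset.sum_congr rfl fun j hj => by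
        rw [gaussInterpolant, Lagrange.eval_interpolate_at_node _ hx.injOn hj]

end Core

end BackwardInterp

namespace BackwardInterp

open Filter Topology

/-! ### Weak derivatives -/

section WeakDeriv

variable {f f' g g' : ℝ → ℝ}

lemma IsWeakDeriv.congr (h : IsWeakDeriv f g) (hf : EqOn f f' (Ioo 0 1))
    (hg : g =ᵐ[volume.restrict (Ioo 0 1)] g') : IsWeakDeriv f' g' := by
  have hf' : f =ᵐ[volume.restrict (Ioo 0 1)] f' :=
    (ae_restrict_iff' measurableSet_Ioo).2 (Eventually.of_forall hf)
  refine ⟨h.1.congr hf', h.2.1.congr hg, fun φ h1 h2 h3 => ?_⟩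
  have e1 : ∫ t in Ioo (0 : ℝ) 1, f' t * deriv φ t = ∫ t in Ioo (0 : ℝ) 1, f t * deriv φ t :=
    integral_congr_ae (hf'.mono fun t ht => by simp only [ht])
  have e2 : ∫ t in Ioo (0 : ℝ) 1, g' t * φ t = ∫ t in Ioo (0 : ℝ) 1, g t * φ t :=
    integral_congr_ae (hg.mono fun t ht => by simp only [ht])
  rw [e1, e2]
  exact h.2.2 φ h1 h2 h3

lemma integrableOn_mul_of_tsupport {φ : ℝ → ℝ}
    (hg : LocallyIntegrableOn g (Ioo 0 1)) (hφ : Continuous φ) (hc : HasCompactSupport φ)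
    (hs : tsupport φ ⊆ Ioo 0 1) : IntegrableOn (fun t => g t * φ t) (Ioo 0 1) := by
  have h1 : IntegrableOn (fun t => g t * φ t) (tsupport φ) :=
    (hg.integrableOn_compact_subset hs hc).mul_continuousOn hφ.continuousOn hc
  refine h1.of_forall_sdiff_eq_zero measurableSet_Ioo fun t ht => ?_
  rw [image_eq_zero_of_notMem_tsupport ht.2, mul_zero]

/-- By the fundamental lemma of the calculus of variations. It allows an arbitrary backward
derivative `g` to be replaced by the transported one. -/
lemma IsWeakDeriv.ae_unique (h : IsWeakDeriv f g) (h' : IsWeakDeriv f g') :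
    g =ᵐ[volume.restrict (Ioo 0 1)] g' := by
  have hloc : LocallyIntegrableOn (g - g') (Ioo 0 1) := h.2.1.sub h'.2.1
  have := isOpen_Ioo.ae_eq_zero_of_integral_contDiff_smul_eq_zero hloc fun φ h1 h2 h3 => by
    have e : ∫ t, φ t • (g - g') t = ∫ t in Ioo (0 : ℝ) 1, (g t * φ t - g' t * φ t) := by
      rw [← setIntegral_eq_integral_of_forall_compl_eq_zero (s := Ioo (0 : ℝ) 1)]
      · congr 1
        ext t
        simp
        ring
      · intro t ht
        rw [image_eq_zero_of_notMem_tsupport fun hmem => ht (h3 hmem), zero_smul]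
    rw [e, integral_sub (integrableOn_mul_of_tsupport h.2.1 h1.continuous h2 h3)
      (integrableOn_mul_of_tsupport h'.2.1 h1.continuous h2 h3)]
    have e1 := h.2.2 φ h1 h2 h3
    have e2 := h'.2.2 φ h1 h2 h3
    linarith
  rw [EventuallyEq, ae_restrict_iff' measurableSet_Ioo]
  filter_upwards [this] with t ht hmem
  exact sub_eq_zero.1 (ht hmem)

/-! ### Smooth steps as test functions -/

lemma deriv_smoothTransition_eq_zero {u : ℝ} (hu : u < 0 ∨ 1 < u) :
    deriv Real.smoothTransition u = 0 := by
  rcases hu with hu | hu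
  · have : Real.smoothTransition =ᶠ[𝓝 u] fun _ => 0 := by
      filter_upwards [Iio_mem_nhds hu] with t ht
      exact Real.smoothTransition.zero_of_nonpos (le_of_lt ht)
    rw [this.deriv_eq, deriv_const]
  · have : Real.smoothTransition =ᶠ[𝓝 u] fun _ => 1 := by
      filter_upwards [Ioi_mem_nhds hu] with t ht
      exact Real.smoothTransition.one_of_one_le (le_of_lt ht)
    rw [this.deriv_eq, deriv_const]

/-- A smooth approximation of the unit step at `x`. -/
noncomputable def smoothStep (x k t : ℝ) : ℝ := Real.smoothTransition (k * (t - x))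

lemma contDiff_smoothStep (x k : ℝ) : ContDiff ℝ ∞ (smoothStep x k) :=
  Real.smoothTransition.contDiff.comp
    (contDiff_const.mul (contDiff_id.sub contDiff_const))

lemma deriv_smoothStep (x k t : ℝ) :
    deriv (smoothStep x k) t = k * deriv Real.smoothTransition (k * (t - x)) := by
  have h1 : HasDerivAt Real.smoothTransition (deriv Real.smoothTransition (k * (t - x)))
      (k * (t - x)) :=
    ((Real.smoothTransition.contDiff (n := 1)).differentiable one_ne_zero _).hasDerivAt
  have h2 : HasDerivAt (fun t => k * (t - x)) k t := by
    simpa using ((hasDerivAt_id t).sub_const x).const_mul k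
  have := (h1.comp t h2).deriv
  rw [mul_comm]
  exact this

lemma smoothStep_of_le {x k t : ℝ} (hk : 0 ≤ k) (ht : t ≤ x) : smoothStep x k t = 0 :=
  Real.smoothTransition.zero_of_nonpos (mul_nonpos_of_nonneg_of_nonpos hk (by linarith))

lemma smoothStep_of_ge {x k t : ℝ} (hk : 0 < k) (ht : x + 1 / k ≤ t) : smoothStep x k t = 1 := by
  refine Real.smoothTransition.one_of_one_le ?_
  have : 1 / k ≤ t - x := by linarith
  rwa [div_le_iff₀' hk] at this

lemma deriv_smoothStep_eq_zero {x k t : ℝ} (hk : 0 < k) (ht : t ∉ Icc x (x + 1 / k)) :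
    deriv (smoothStep x k) t = 0 := by
  rw [deriv_smoothStep, deriv_smoothTransition_eq_zero, mul_zero]
  by_cases h : x ≤ t
  · right
    have h2 : x + 1 / k < t := by
      by_contra hcon
      exact ht ⟨h, not_lt.1 hcon⟩
    have : 1 / k < t - x := by linarith
    rwa [div_lt_iff₀' hk] at this
  · left
    exact mul_neg_of_pos_of_neg hk (by linarith [not_le.1 h])

lemma continuous_deriv_smoothStep (x k : ℝ) : Continuous (deriv (smoothStep x k)) :=
  (contDiff_smoothStep x k).continuous_deriv (by simp)

lemma integral_deriv_smoothStep {x k : ℝ} (hk : 0 < k) :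
    ∫ t in x..x + 1 / k, deriv (smoothStep x k) t = 1 := by
  rw [intervalIntegral.integral_deriv_eq_sub
    (fun t _ => (contDiff_smoothStep x k).differentiable (by simp) t)
    ((continuous_deriv_smoothStep x k).intervalIntegrable _ _),
    smoothStep_of_ge hk le_rfl, smoothStep_of_le hk.le le_rfl, sub_zero]

lemma deriv_smoothStep_nonneg {x k : ℝ} (hk : 0 ≤ k) (t : ℝ) : 0 ≤ deriv (smoothStep x k) t := by
  rw [deriv_smoothStep]
  exact mul_nonneg hk Real.smoothTransition.monotone.deriv_nonneg

lemma eventually_add_inv_lt {x y : ℝ} (hxy : x < y) :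
    ∀ᶠ k : ℕ in atTop, (0 : ℝ) < k ∧ x + 1 / (k : ℝ) < y := by
  have h1 : ∀ᶠ k : ℕ in atTop, 1 / (k : ℝ) < y - x :=
    tendsto_one_div_atTop_nhds_zero_nat.eventually (gt_mem_nhds (by linarith))
  filter_upwards [h1, eventually_gt_atTop 0] with k hk hk0
  exact ⟨by exact_mod_cast hk0, by linarith⟩

lemma integrableOn_mul_deriv_smoothStep {h : ℝ → ℝ} (hh : ContinuousOn h (Ioo 0 1)) {x k : ℝ}
    (hx : x ∈ Ioo (0 : ℝ) 1) (hk : 0 < k) (hxk : x + 1 / k < 1) :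
    IntegrableOn (fun t => h t * deriv (smoothStep x k) t) (Ioo 0 1) := by
  have hsub : Icc x (x + 1 / k) ⊆ Ioo 0 1 := fun t ht => ⟨hx.1.trans_le ht.1, ht.2.trans_lt hxk⟩
  have hc : ContinuousOn (fun t => h t * deriv (smoothStep x k) t) (Icc x (x + 1 / k)) :=
    (hh.mono hsub).mul (continuous_deriv_smoothStep x k).continuousOn
  refine (hc.integrableOn_Icc).of_forall_sdiff_eq_zero measurableSet_Ioo fun t ht => ?_
  rw [deriv_smoothStep_eq_zero hk ht.2, mul_zero]

/-- The derivatives of the smooth steps form an approximate identity. -/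
lemma tendsto_integral_mul_deriv_smoothStep {h : ℝ → ℝ} (hh : ContinuousOn h (Ioo 0 1)) {x : ℝ}
    (hx : x ∈ Ioo (0 : ℝ) 1) :
    Tendsto (fun k : ℕ => ∫ t in Ioo (0 : ℝ) 1, h t * deriv (smoothStep x k) t) atTop
      (𝓝 (h x)) := by
  rw [Metric.tendsto_nhds]
  intro ε hε
  have hcont : ContinuousAt h x := hh.continuousAt (Ioo_mem_nhds hx.1 hx.2)
  obtain ⟨δ, hδ, hδh⟩ := Metric.continuousAt_iff.1 hcont (ε / 2) (by positivity)
  filter_upwards [eventually_add_inv_lt hx.2,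
    eventually_add_inv_lt (show x < x + δ by linarith)] with k hk1 hk2
  obtain ⟨hk, hk1⟩ := hk1
  have hle : x ≤ x + 1 / (k : ℝ) := by
    have : 0 ≤ 1 / (k : ℝ) := by positivity
    linarith
  have hsub : Icc x (x + 1 / (k : ℝ)) ⊆ Ioo 0 1 := fun t ht =>
    ⟨hx.1.trans_le ht.1, ht.2.trans_lt hk1⟩
  have hρ := (continuous_deriv_smoothStep x (k : ℝ)).intervalIntegrable (μ := volume) x
    (x + 1 / (k : ℝ))
  have hi : IntervalIntegrable (fun t => h t * deriv (smoothStep x k) t) volume x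
      (x + 1 / (k : ℝ)) := by
    refine ContinuousOn.intervalIntegrable_of_Icc hle ?_
    exact (hh.mono hsub).mul (continuous_deriv_smoothStep x k).continuousOn
  have e1 : ∫ t in Ioo (0 : ℝ) 1, h t * deriv (smoothStep x k) t =
      ∫ t in x..x + 1 / (k : ℝ), h t * deriv (smoothStep x k) t := by
    rw [intervalIntegral.integral_of_le hle, ← integral_Icc_eq_integral_Ioc]
    refine setIntegral_eq_of_subset_of_forall_sdiff_eq_zero measurableSet_Ioo hsub fun t ht => ?_
    rw [deriv_smoothStep_eq_zero hk ht.2, mul_zero]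
  have e2 : (∫ t in x..x + 1 / (k : ℝ), h t * deriv (smoothStep x k) t) - h x =
      ∫ t in x..x + 1 / (k : ℝ), (h t - h x) * deriv (smoothStep x k) t := by
    have e3 : h x = ∫ t in x..x + 1 / (k : ℝ), h x * deriv (smoothStep x k) t := by
      rw [intervalIntegral.integral_const_mul, integral_deriv_smoothStep hk, mul_one]
    conv_lhs => rw [e3]
    rw [← intervalIntegral.integral_sub hi (hρ.const_mul _)]
    congr 1
    ext t
    ring
  rw [e1, dist_eq_norm, e2]
  have hb := intervalIntegral.norm_integral_le_of_norm_le (μ := volume) hle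
    (f := fun t => (h t - h x) * deriv (smoothStep x k) t)
    (g := fun t => ε / 2 * deriv (smoothStep x k) t)
    (Eventually.of_forall fun t ht => by
      rw [norm_mul, Real.norm_of_nonneg (deriv_smoothStep_nonneg hk.le t)]
      refine mul_le_mul_of_nonneg_right ?_ (deriv_smoothStep_nonneg hk.le t)
      rw [← dist_eq_norm]
      refine (hδh ?_).le
      rw [Real.dist_eq, abs_of_nonneg (by linarith [ht.1])]
      linarith [ht.2, hk2.2]) (hρ.const_mul _)
  rw [intervalIntegral.integral_const_mul, integral_deriv_smoothStep hk, mul_one] at hb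
  linarith

lemma smoothStep_mem_Icc (x k t : ℝ) : smoothStep x k t ∈ Icc (0 : ℝ) 1 :=
  ⟨Real.smoothTransition.nonneg _, Real.smoothTransition.le_one _⟩

lemma tendsto_smoothStep {x t : ℝ} (ht : x < t) :
    Tendsto (fun k : ℕ => smoothStep x k t) atTop (𝓝 1) := by
  refine tendsto_const_nhds.congr' ?_
  filter_upwards [eventually_add_inv_lt ht] with k hk
  exact (smoothStep_of_ge hk.1 hk.2.le).symm

lemma IsWeakDeriv.intervalIntegrable (h : IsWeakDeriv f g) {x y : ℝ} (hx : x ∈ Ioo (0 : ℝ) 1)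
    (hy : y ∈ Ioo (0 : ℝ) 1) : IntervalIntegrable g volume x y := by
  rw [intervalIntegrable_iff']
  refine h.2.1.integrableOn_compact_subset (fun s hs => ?_) isCompact_uIcc
  exact ⟨(lt_min hx.1 hy.1).trans_le hs.1, hs.2.trans_lt (max_lt hx.2 hy.2)⟩

/-- The test functions are differences of smooth steps at `x` and `y`. They tend to the indicator of
`(x,y]`, while their derivatives act on continuous functions as point masses at `x` and `y` in the
limit. -/
lemma IsWeakDeriv.integral_eq_sub_of_lt (h : IsWeakDeriv f g) (hf : ContinuousOn f (Ioo 0 1))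
    {x y : ℝ} (hx : x ∈ Ioo (0 : ℝ) 1) (hy : y ∈ Ioo (0 : ℝ) 1) (hxy : x < y) :
    ∫ t in x..y, g t = f y - f x := by
  -- The room between `y` and `z` gives all late test functions a common compact support `[x,z]`, on
  -- which `g` is integrable and dominates.
  obtain ⟨z, hyz, hz⟩ := exists_between hy.2
  have hev : ∀ᶠ k : ℕ in atTop, (0 : ℝ) < k ∧ x + 1 / (k : ℝ) < 1 ∧ y + 1 / (k : ℝ) < z := by
    filter_upwards [eventually_add_inv_lt hx.2, eventually_add_inv_lt hyz] with k h1 h2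
    exact ⟨h1.1, h1.2, h2.2⟩
  set φ : ℕ → ℝ → ℝ := fun k t => smoothStep x k t - smoothStep y k t with hφ
  have hzero : ∀ k : ℕ, (0 : ℝ) < k → y + 1 / (k : ℝ) < z → ∀ t ∉ Icc x z, φ k t = 0 := by
    intro k hk hkz t ht
    by_cases hxt : x ≤ t
    · have htz : z < t := by
        by_contra hcon
        exact ht ⟨hxt, not_lt.1 hcon⟩
      simp only [hφ]
      rw [smoothStep_of_ge hk (by linarith), smoothStep_of_ge hk (by linarith), sub_self]
    · have htx := not_le.1 hxt
      simp only [hφ]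
      rw [smoothStep_of_le hk.le htx.le, smoothStep_of_le hk.le (by linarith), sub_self]
  have hL : Tendsto (fun k : ℕ => ∫ t in Ioo (0 : ℝ) 1, f t * deriv (φ k) t) atTop
      (𝓝 (f x - f y)) := by
    refine ((tendsto_integral_mul_deriv_smoothStep hf hx).sub
      (tendsto_integral_mul_deriv_smoothStep hf hy)).congr' ?_
    filter_upwards [hev] with k hk
    rw [← integral_sub (integrableOn_mul_deriv_smoothStep hf hx hk.1 hk.2.1)
      (integrableOn_mul_deriv_smoothStep hf hy hk.1 (hk.2.2.trans hz))]
    congr 1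
    ext t
    have : deriv (φ k) t = deriv (smoothStep x k) t - deriv (smoothStep y k) t :=
      deriv_fun_sub ((contDiff_smoothStep x k).differentiable (by simp) t)
        ((contDiff_smoothStep y k).differentiable (by simp) t)
    rw [this]
    ring
  have hR : Tendsto (fun k : ℕ => ∫ t in Ioo (0 : ℝ) 1, g t * φ k t) atTop
      (𝓝 (∫ t in Ioo (0 : ℝ) 1, (Ioc x y).indicator g t)) := by
    have hKsub : Icc x z ⊆ Ioo 0 1 := fun t ht => ⟨hx.1.trans_le ht.1, ht.2.trans_lt hz⟩
    have hgK : IntegrableOn g (Icc x z) := h.2.1.integrableOn_compact_subset hKsub isCompact_Icc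
    refine tendsto_integral_filter_of_dominated_convergence
      (fun t => (Icc x z).indicator (fun t => ‖g t‖) t) ?_ ?_ ?_ ?_
    · refine Eventually.of_forall fun k => h.2.1.aestronglyMeasurable.mul ?_
      exact ((contDiff_smoothStep x k).continuous.sub
        (contDiff_smoothStep y k).continuous).aestronglyMeasurable
    · filter_upwards [hev] with k hk
      refine Eventually.of_forall fun t => ?_
      by_cases ht : t ∈ Icc x z
      · rw [indicator_of_mem ht, norm_mul]
        have h1 := smoothStep_mem_Icc x k t
        have h2 := smoothStep_mem_Icc y k t
        have h3 : ‖φ k t‖ ≤ 1 := by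
          rw [Real.norm_eq_abs, abs_le]
          simp only [hφ]
          constructor <;> linarith [h1.1, h1.2, h2.1, h2.2]
        exact mul_le_of_le_one_right (norm_nonneg _) h3
      · rw [indicator_of_notMem ht, hzero k hk.1 hk.2.2 t ht, mul_zero, norm_zero]
    · rw [integrable_indicator_iff measurableSet_Icc]
      exact (hgK.norm.mono_measure (Measure.restrict_mono le_rfl Measure.restrict_le_self))
    · refine Eventually.of_forall fun t => ?_
      rcases le_or_gt t x with h1 | h1
      · rw [indicator_of_notMem (fun hmem => absurd hmem.1 (not_lt.2 h1))]
        refine tendsto_const_nhds.congr fun k => ?_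
        simp only [hφ]
        rw [smoothStep_of_le k.cast_nonneg h1, smoothStep_of_le k.cast_nonneg (by linarith),
          sub_self, mul_zero]
      · have t1 := tendsto_smoothStep h1
        rcases le_or_gt t y with h2 | h2
        · rw [indicator_of_mem (show t ∈ Ioc x y from ⟨h1, h2⟩)]
          have t2 : Tendsto (fun k : ℕ => smoothStep y k t) atTop (𝓝 0) :=
            tendsto_const_nhds.congr fun k => (smoothStep_of_le k.cast_nonneg h2).symm
          simpa using (t1.sub t2).const_mul (g t)
        · rw [indicator_of_notMem (fun hmem => absurd hmem.2 (not_le.2 h2))]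
          simpa using (t1.sub (tendsto_smoothStep h2)).const_mul (g t)
  have heq : ∀ᶠ k : ℕ in atTop, ∫ t in Ioo (0 : ℝ) 1, f t * deriv (φ k) t =
      -∫ t in Ioo (0 : ℝ) 1, g t * φ k t := by
    filter_upwards [hev] with k hk
    have hsupp : tsupport (φ k) ⊆ Icc x z := by
      refine closure_minimal (fun t ht => ?_) isClosed_Icc
      by_contra hcon
      exact ht (hzero k hk.1 hk.2.2 t hcon)
    refine h.2.2 (φ k) ((contDiff_smoothStep x k).sub (contDiff_smoothStep y k)) ?_ ?_
    · exact HasCompactSupport.intro isCompact_Icc fun t ht => hzero k hk.1 hk.2.2 t ht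
    · exact hsupp.trans fun t ht => ⟨hx.1.trans_le ht.1, ht.2.trans_lt hz⟩
  have hlim := tendsto_nhds_unique (hL.congr' heq) hR.neg
  have hset : Ioo (0 : ℝ) 1 ∩ Ioc x y = Ioc x y :=
    inter_eq_right.2 fun t ht => ⟨hx.1.trans ht.1, ht.2.trans_lt hy.2⟩
  rw [setIntegral_indicator measurableSet_Ioc, hset,
    ← intervalIntegral.integral_of_le hxy.le] at hlim
  linarith

/-- A continuous function is a primitive of its weak derivative. -/
lemma IsWeakDeriv.integral_eq_sub (h : IsWeakDeriv f g) (hf : ContinuousOn f (Ioo 0 1))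
    {x y : ℝ} (hx : x ∈ Ioo (0 : ℝ) 1) (hy : y ∈ Ioo (0 : ℝ) 1) :
    ∫ t in x..y, g t = f y - f x := by
  rcases lt_trichotomy x y with hxy | rfl | hxy
  · exact h.integral_eq_sub_of_lt hf hx hy hxy
  · simp
  · rw [intervalIntegral.integral_symm, h.integral_eq_sub_of_lt hf hy hx hxy, neg_sub]

end WeakDeriv

/-! ### The change of variables -/

/-- The substitution `t ↦ 1 - (1 - t) ^ ρ` of `(0,1)`. -/
noncomputable def stretch (ρ t : ℝ) : ℝ := 1 - (1 - t) ^ ρ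

/-- The derivative of `stretch ρ`. -/
noncomputable def stretchDeriv (ρ t : ℝ) : ℝ := ρ * (1 - t) ^ (ρ - 1)

section Stretch

variable {ρ : ℝ}

lemma stretch_mem (hρ : 0 < ρ) {t : ℝ} (ht : t ∈ Ioo (0 : ℝ) 1) : stretch ρ t ∈ Ioo (0 : ℝ) 1 := by
  have h1 : 0 < 1 - t := by linarith [ht.2]
  have h2 := Real.rpow_pos_of_pos h1 ρ
  have h3 := Real.rpow_lt_one h1.le (by linarith [ht.1]) hρ
  exact ⟨by rw [stretch]; linarith, by rw [stretch]; linarith⟩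

lemma stretch_stretch (hρ : 0 < ρ) {t : ℝ} (ht : t < 1) : stretch (1 / ρ) (stretch ρ t) = t := by
  have h1 : 0 < 1 - t := by linarith
  rw [stretch, stretch, sub_sub_cancel, ← Real.rpow_mul h1.le, mul_one_div_cancel hρ.ne',
    Real.rpow_one, sub_sub_cancel]

lemma stretch_stretch' (hρ : 0 < ρ) {t : ℝ} (ht : t < 1) : stretch ρ (stretch (1 / ρ) t) = t := by
  have := stretch_stretch (one_div_pos.2 hρ) ht
  rwa [one_div_one_div] at this

lemma stretchDeriv_pos (hρ : 0 < ρ) {t : ℝ} (ht : t < 1) : 0 < stretchDeriv ρ t :=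
  mul_pos hρ (Real.rpow_pos_of_pos (by linarith) _)

lemma hasDerivAt_stretch (ρ : ℝ) {t : ℝ} (ht : t < 1) :
    HasDerivAt (stretch ρ) (stretchDeriv ρ t) t := by
  have h1 : 0 < 1 - t := by linarith
  have := (((hasDerivAt_id t).const_sub 1).rpow_const (p := ρ) (Or.inl h1.ne')).const_sub 1
  convert! this using 1
  rw [stretchDeriv, id]
  ring

lemma contDiffAt_stretch (ρ : ℝ) {t : ℝ} (ht : t < 1) : ContDiffAt ℝ ∞ (stretch ρ) t := by
  have h1 : 1 - t ≠ 0 := by linarith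
  exact contDiffAt_const.sub ((contDiffAt_const.sub contDiffAt_id).rpow_const_of_ne h1)

lemma continuousOn_stretch (ρ : ℝ) : ContinuousOn (stretch ρ) (Ioo 0 1) := fun _ ht =>
  (hasDerivAt_stretch ρ ht.2).continuousAt.continuousWithinAt

lemma strictMonoOn_stretch (hρ : 0 < ρ) : StrictMonoOn (stretch ρ) (Ioo 0 1) := by
  intro s _ t ht hst
  have := Real.rpow_lt_rpow (by linarith [ht.2] : 0 ≤ 1 - t) (by linarith : 1 - t < 1 - s) hρ
  rw [stretch, stretch]
  linarith

lemma injOn_stretch (hρ : 0 < ρ) : InjOn (stretch ρ) (Ioo 0 1) := (strictMonoOn_stretch hρ).injOn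

lemma image_stretch (hρ : 0 < ρ) : stretch ρ '' Ioo 0 1 = Ioo 0 1 := by
  apply Subset.antisymm
  · rintro _ ⟨t, ht, rfl⟩
    exact stretch_mem hρ ht
  · intro s hs
    exact ⟨stretch (1 / ρ) s, stretch_mem (one_div_pos.2 hρ) hs, stretch_stretch' hρ hs.2⟩

lemma integral_stretch (hρ : 0 < ρ) (h : ℝ → ℝ) :
    ∫ t in Ioo (0 : ℝ) 1, h (stretch ρ t) * stretchDeriv ρ t = ∫ s in Ioo (0 : ℝ) 1, h s := by
  conv_rhs => rw [← image_stretch hρ]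
  rw [integral_image_eq_integral_abs_deriv_smul measurableSet_Ioo
    (fun t ht => (hasDerivAt_stretch ρ ht.2).hasDerivWithinAt) (injOn_stretch hρ)]
  refine setIntegral_congr_fun measurableSet_Ioo fun t ht => ?_
  simp only [abs_of_pos (stretchDeriv_pos hρ ht.2), smul_eq_mul]
  ring

lemma integrableOn_stretch_iff (hρ : 0 < ρ) (h : ℝ → ℝ) {K : Set ℝ} (hK : MeasurableSet K)
    (hK1 : K ⊆ Ioo 0 1) :
    IntegrableOn (fun t => h (stretch ρ t) * stretchDeriv ρ t) K ↔
      IntegrableOn h (stretch ρ '' K) := by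
  rw [integrableOn_image_iff_integrableOn_abs_deriv_smul hK
    (fun t ht => (hasDerivAt_stretch ρ (hK1 ht).2).hasDerivWithinAt)
    ((injOn_stretch hρ).mono hK1)]
  refine integrableOn_congr_fun (fun t ht => ?_) hK
  simp only [abs_of_pos (stretchDeriv_pos hρ (hK1 ht).2), smul_eq_mul]
  ring

/-- The exponent splits as `ρ μ + (ρ - 1)`, the second part being the Jacobian. The exponents swap
because `1 - stretch ρ t = (1 - t) ^ ρ` carries `μ`. -/
lemma weight_eq (μ υ ρ : ℝ) {t : ℝ} (ht : t ∈ Ioo (0 : ℝ) 1) :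
    weight μ υ ρ t = unitWeight υ μ (stretch ρ t) * stretchDeriv ρ t := by
  have h1 : 0 < 1 - t := by linarith [ht.2]
  rw [weight, unitWeight, stretch, stretchDeriv, sub_sub_cancel, ← Real.rpow_mul h1.le]
  have e : (1 - t) ^ (ρ * (μ + 1) - 1) = (1 - t) ^ (ρ * μ) * (1 - t) ^ (ρ - 1) := by
    rw [← Real.rpow_add h1]
    congr 1
    ring
  rw [e]
  ring

lemma stretch_one (t : ℝ) : stretch 1 t = t := by simp [stretch]

lemma weight_one (μ υ : ℝ) {t : ℝ} (ht : t ∈ Ioo (0 : ℝ) 1) :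
    weight μ υ 1 t = unitWeight υ μ t := by
  rw [weight_eq μ υ 1 ht, stretch_one, stretchDeriv]
  simp

/-- A test function in `t` becomes a test function in `s`: its support avoids the end points, and on
`(0,1)` both the substitution and its inverse are smooth. -/
lemma IsWeakDeriv.comp_stretch {F G : ℝ → ℝ} (h : IsWeakDeriv F G) (hF : ContinuousOn F (Ioo 0 1))
    (hρ : 0 < ρ) :
    IsWeakDeriv (fun t => F (stretch ρ t)) (fun t => G (stretch ρ t) * stretchDeriv ρ t) := by
  have hρ' := one_div_pos.2 hρ
  refine ⟨?_, ?_, fun φ h1 h2 h3 => ?_⟩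
  · refine ContinuousOn.locallyIntegrableOn ?_ measurableSet_Ioo
    exact hF.comp (continuousOn_stretch ρ) fun t ht => stretch_mem hρ ht
  · rw [locallyIntegrableOn_iff isOpen_Ioo.isLocallyClosed]
    intro K hK hKc
    rw [integrableOn_stretch_iff hρ G hKc.measurableSet hK]
    refine h.2.1.integrableOn_compact_subset ?_ (hKc.image_of_continuousOn
      ((continuousOn_stretch ρ).mono hK))
    rintro _ ⟨t, ht, rfl⟩
    exact stretch_mem hρ (hK ht)
  · set ψ : ℝ → ℝ := (Ioo (0 : ℝ) 1).indicator fun s => φ (stretch (1 / ρ) s)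
      with hψ
    set K := stretch ρ '' tsupport φ with hKdef
    have hKc : IsCompact K := h2.isCompact.image_of_continuousOn ((continuousOn_stretch ρ).mono h3)
    have hK01 : K ⊆ Ioo 0 1 := by
      rintro _ ⟨t, ht, rfl⟩
      exact stretch_mem hρ (h3 ht)
    have hψ0 : ∀ s ∉ K, ψ s = 0 := by
      intro s hs
      by_cases hs1 : s ∈ Ioo (0 : ℝ) 1
      · rw [hψ, indicator_of_mem hs1]
        refine image_eq_zero_of_notMem_tsupport fun hmem => hs ⟨_, hmem, ?_⟩
        exact stretch_stretch' hρ hs1.2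
      · rw [hψ, indicator_of_notMem hs1]
    have hψsmooth : ContDiff ℝ ∞ ψ := by
      rw [contDiff_iff_contDiffAt]
      intro s
      by_cases hs1 : s ∈ Ioo (0 : ℝ) 1
      · have he : ψ =ᶠ[𝓝 s] fun s => φ (stretch (1 / ρ) s) := by
          filter_upwards [Ioo_mem_nhds hs1.1 hs1.2] with t ht
          rw [hψ, indicator_of_mem ht]
        refine ContDiffAt.congr_of_eventuallyEq ?_ he
        exact h1.contDiffAt.comp s (contDiffAt_stretch _ hs1.2)
      · have he : ψ =ᶠ[𝓝 s] fun _ => 0 := by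
          filter_upwards [hKc.isClosed.isOpen_compl.mem_nhds fun hmem => hs1 (hK01 hmem)] with t ht
          exact hψ0 t ht
        exact contDiffAt_const.congr_of_eventuallyEq he
    have hψt : tsupport ψ ⊆ K := by
      refine closure_minimal (fun s hs => ?_) hKc.isClosed
      by_contra hcon
      exact hs (hψ0 s hcon)
    have hφψ : ∀ t ∈ Ioo (0 : ℝ) 1, ψ (stretch ρ t) = φ t := by
      intro t ht
      rw [hψ, indicator_of_mem (stretch_mem hρ ht), stretch_stretch hρ ht.2]
    have hderiv : ∀ t ∈ Ioo (0 : ℝ) 1,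
        deriv φ t = deriv ψ (stretch ρ t) * stretchDeriv ρ t := by
      intro t ht
      have he : (fun t => ψ (stretch ρ t)) =ᶠ[𝓝 t] φ := by
        filter_upwards [Ioo_mem_nhds ht.1 ht.2] with t ht
        exact hφψ t ht
      have hd : HasDerivAt ψ (deriv ψ (stretch ρ t)) (stretch ρ t) :=
        (hψsmooth.differentiable (by simp) _).hasDerivAt
      rw [← he.deriv_eq]
      exact (hd.comp t (hasDerivAt_stretch ρ ht.2)).deriv
    have hw := h.2.2 ψ hψsmooth (HasCompactSupport.intro hKc hψ0) (hψt.trans hK01)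
    rw [← integral_stretch hρ (fun s => F s * deriv ψ s),
      ← integral_stretch hρ (fun s => G s * ψ s)] at hw
    calc ∫ t in Ioo (0 : ℝ) 1, F (stretch ρ t) * deriv φ t
        = ∫ t in Ioo (0 : ℝ) 1, F (stretch ρ t) *
            deriv ψ (stretch ρ t) * stretchDeriv ρ t :=
          setIntegral_congr_fun measurableSet_Ioo fun t ht => by
            simp only [hderiv t ht]; ring
      _ = _ := hw
      _ = _ := by
          congr 1
          exact setIntegral_congr_fun measurableSet_Ioo fun t ht => by
            simp only [hφψ t ht]; ring

end Stretch

/-! ### The main theorem -/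

section Main

variable {μ υ ρ : ℝ}

lemma memL2_stretch_iff (hρ : 0 < ρ) {h : ℝ → ℝ}
    (hm : AEStronglyMeasurable (fun t => h (stretch ρ t)) (volume.restrict (Ioo 0 1))) :
    MemL2 (weight μ υ ρ) (fun t => h (stretch ρ t)) ↔
      IntegrableOn (fun s => h s ^ 2 * unitWeight υ μ s) (Ioo 0 1) := by
  have e : IntegrableOn (fun t => h (stretch ρ t) ^ 2 * weight μ υ ρ t) (Ioo 0 1) ↔
      IntegrableOn (fun s => h s ^ 2 * unitWeight υ μ s) (Ioo 0 1) := by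
    conv_rhs => rw [← image_stretch hρ, ← integrableOn_stretch_iff hρ
      (fun s => h s ^ 2 * unitWeight υ μ s) measurableSet_Ioo Subset.rfl]
    refine integrableOn_congr_fun (fun t ht => ?_) measurableSet_Ioo
    simp only [weight_eq μ υ ρ ht]
    ring
  exact ⟨fun h => e.1 h.2, fun h => ⟨hm, e.2 h⟩⟩

lemma wnorm_stretch (hρ : 0 < ρ) (h : ℝ → ℝ) :
    wnorm (weight μ υ ρ) (fun t => h (stretch ρ t)) =
      Real.sqrt (∫ s in Ioo (0 : ℝ) 1, h s ^ 2 * unitWeight υ μ s) := by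
  rw [wnorm, ← integral_stretch hρ (fun s => h s ^ 2 * unitWeight υ μ s)]
  congr 1
  refine setIntegral_congr_fun measurableSet_Ioo fun t ht => ?_
  simp only [weight_eq μ υ ρ ht]
  ring

lemma wnorm_congr {w f g : ℝ → ℝ} (h : f =ᵐ[volume.restrict (Ioo (0 : ℝ) 1)] g) :
    wnorm w f = wnorm w g := by
  rw [wnorm, wnorm]
  congr 1
  exact integral_congr_ae (h.mono fun t ht => by simp only [ht])

lemma MemL2.congr {w f g : ℝ → ℝ} (hf : MemL2 w f)
    (h : f =ᵐ[volume.restrict (Ioo (0 : ℝ) 1)] g) : MemL2 w g :=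
  ⟨hf.1.congr h, hf.2.congr_fun_ae (h.mono fun t ht => by simp only [ht])⟩

lemma backwardJacobi_eq (n : ℕ) (μ υ ρ t : ℝ) :
    backwardJacobi n μ υ ρ t = (unitJacobi n υ μ).eval (stretch ρ t) := by
  rw [backwardJacobi, unitJacobi_eval, stretch]
  congr 1
  ring

lemma exists_isGaussNodes (hμ : -1 < μ) (hυ : -1 < υ) (hρ : 0 < ρ) (N : ℕ) :
    ∃ t : Fin (N + 1) → ℝ, IsGaussNodes N μ υ ρ t := by
  have hρ' := one_div_pos.2 hρ
  obtain ⟨x, hx, hr⟩ := exists_strictMono_zeros hυ hμ (N + 1)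
  have hmem : ∀ i, x i ∈ Ioo (0 : ℝ) 1 ∧ (unitJacobi (N + 1) υ μ).eval (x i) = 0 := fun i => by
    have : x i ∈ range x := mem_range_self i
    rwa [hr] at this
  refine ⟨fun i => stretch (1 / ρ) (x i),
    fun i j hij => strictMonoOn_stretch hρ' (hmem i).1 (hmem j).1 (hx hij), ?_⟩
  ext s
  constructor
  · rintro ⟨i, rfl⟩
    refine ⟨stretch_mem hρ' (hmem i).1, ?_⟩
    simp only [backwardJacobi_eq, stretch_stretch' hρ (hmem i).1.2, (hmem i).2]
  · rintro ⟨hs, h0⟩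
    rw [backwardJacobi_eq] at h0
    have : stretch ρ s ∈ range x := by
      rw [hr]
      exact ⟨stretch_mem hρ hs, h0⟩
    obtain ⟨i, hi⟩ := this
    exact ⟨i, by simp only [hi, stretch_stretch hρ hs.2]⟩

/-- The images of the nodes under the substitution, as a sequence. -/
noncomputable def unitNodes (ρ : ℝ) {N : ℕ} (t : Fin (N + 1) → ℝ) (i : ℕ) : ℝ :=
  stretch ρ (t (Fin.ofNat (N + 1) i))

/-- Indices above `N` wrap modulo `N + 1` in `unitNodes`; only those up to `N` matter. -/
lemma unitNodes_val (ρ : ℝ) {N : ℕ} (t : Fin (N + 1) → ℝ) (j : Fin (N + 1)) :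
    unitNodes ρ t j = stretch ρ (t j) := by
  simp [unitNodes]

lemma IsGaussNodes.mem {N : ℕ} {t : Fin (N + 1) → ℝ} (ht : IsGaussNodes N μ υ ρ t)
    (i : Fin (N + 1)) : t i ∈ Ioo (0 : ℝ) 1 ∧ backwardJacobi (N + 1) μ υ ρ (t i) = 0 := by
  have : t i ∈ range t := mem_range_self i
  rwa [ht.2] at this

lemma IsGaussNodes.isJacobiNodes {N : ℕ} {t : Fin (N + 1) → ℝ} (ht : IsGaussNodes N μ υ ρ t)
    (hρ : 0 < ρ) : IsJacobiNodes N υ μ (unitNodes ρ t) := by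
  have hval : ∀ (i : ℕ) (hi : i ≤ N), unitNodes ρ t i = stretch ρ (t ⟨i, by omega⟩) := fun i hi =>
    unitNodes_val ρ t ⟨i, by omega⟩
  refine ⟨fun i hi j hj hij => ?_, fun i hi => ?_, fun i hi => ?_, fun s hs h0 => ?_⟩
  · rw [hval i hi, hval j hj]
    exact strictMonoOn_stretch hρ (ht.mem _).1 (ht.mem _).1 (ht.1 (by simpa using hij))
  · rw [hval i hi]
    exact stretch_mem hρ (ht.mem _).1
  · rw [hval i hi, ← backwardJacobi_eq]
    exact (ht.mem _).2
  · have hmem : stretch (1 / ρ) s ∈ range t := by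
      rw [ht.2]
      refine ⟨stretch_mem (one_div_pos.2 hρ) hs, ?_⟩
      rw [backwardJacobi_eq, stretch_stretch' hρ hs.2, h0]
    obtain ⟨i, hi⟩ := hmem
    exact ⟨i, by omega, by rw [unitNodes_val, hi, stretch_stretch' hρ hs.2]⟩

/-- The Lagrange quotients in `(1 - t) ^ ρ` are unchanged under `z ↦ 1 - z`, which flips the sign of
numerator and denominator alike. -/
lemma interp_eq {N : ℕ} {t : Fin (N + 1) → ℝ} (ht : IsGaussNodes N μ υ ρ t) (hρ : 0 < ρ)
    (f : ℝ → ℝ) (x : ℝ) :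
    interp ρ t f x =
      (gaussInterpolant N (unitNodes ρ t) fun s => f (stretch (1 / ρ) s)).eval (stretch ρ x) := by
  rw [interp, gaussInterpolant, Lagrange.interpolate_apply, Polynomial.eval_finsetSum,
    ← Fin.sum_univ_eq_sum_range
      (fun j => Polynomial.eval (stretch ρ x) (Polynomial.C (f (stretch (1 / ρ)
        (unitNodes ρ t j))) * Lagrange.basis (Finset.range (N + 1)) (unitNodes ρ t) j))]
  refine Finset.sum_congr rfl fun j _ => ?_
  rw [Polynomial.eval_mul, Polynomial.eval_C, unitNodes_val, stretch_stretch hρ (ht.mem j).1.2]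
  congr 1
  rw [Lagrange.basis, Polynomial.eval_prod, lagrangeBasis]
  have himg : (Finset.range (N + 1)).erase (j : ℕ) =
      (Finset.univ.erase j).map Fin.valEmbedding := by
    rw [Finset.map_erase, Fin.map_valEmbedding_univ]
    ext k
    simp
  rw [himg, Finset.prod_map]
  refine Finset.prod_congr rfl fun i _ => ?_
  simp only [Lagrange.basisDivisor, Fin.valEmbedding_apply, unitNodes_val, Polynomial.eval_mul,
    Polynomial.eval_C, Polynomial.eval_sub, Polynomial.eval_X, stretch]
  have e : ∀ u v : ℝ, 1 - u - (1 - v) = -(u - v) := fun u v => by ring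
  rw [div_eq_inv_mul, e, e, inv_neg, neg_mul_neg]

lemma memB_stretch {f : ℝ → ℝ}
    (hB : MemB μ υ 1 1 (fun x => f (1 - (1 - x) ^ (1 / ρ)))) :
    ∃ G : ℝ → ℝ, IsWeakDeriv (fun s => f (stretch (1 / ρ) s)) G ∧
      IntegrableOn (fun s => f (stretch (1 / ρ) s) ^ 2 * unitWeight υ μ s) (Ioo 0 1) ∧
      IntegrableOn (fun s => G s ^ 2 * unitWeight (υ + 1) (μ + 1) s) (Ioo 0 1) := by
  obtain ⟨H, hH0, hH1, hH2⟩ := hB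
  obtain ⟨G, hG, hGae⟩ := hH1 0 one_pos
  have h0 := hH2 0 zero_le_one
  have h1 := hH2 1 le_rfl
  rw [hH0] at hG h0
  have hGH : H 1 =ᵐ[volume.restrict (Ioo 0 1)] G := by
    filter_upwards [hGae] with t ht
    simpa using ht
  refine ⟨G, hG, ?_, ?_⟩
  · refine h0.2.congr_fun (fun s hs => ?_) measurableSet_Ioo
    simp only [Nat.cast_zero, add_zero, weight_one μ υ hs, stretch]
  · refine (h1.congr hGH).2.congr_fun (fun s hs => ?_) measurableSet_Ioo
    simp only [Nat.cast_one, weight_one _ _ hs]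

/-- The prefactor of the backward derivative is the reciprocal of the chain-rule factor, so the
backward derivative of `F ∘ stretch ρ` is `F' ∘ stretch ρ`. -/
lemma rpow_mul_stretchDeriv (hρ : 0 < ρ) {t : ℝ} (ht : t < 1) (u : ℝ) :
    (1 - t) ^ (1 - ρ) / ρ * (u * stretchDeriv ρ t) = u := by
  have h1 : 0 < 1 - t := by linarith
  have h2 : (1 - t) ^ (1 - ρ) * (1 - t) ^ (ρ - 1) = 1 := by
    rw [← Real.rpow_add h1]
    simp
  rw [stretchDeriv]
  calc _ = u * ((1 - t) ^ (1 - ρ) * (1 - t) ^ (ρ - 1)) * (ρ / ρ) := by ring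
    _ = u := by rw [h2, div_self hρ.ne', mul_one, mul_one]

lemma isWeakDeriv_of_stretch (hρ : 0 < ρ) {f G : ℝ → ℝ} (hf : ContinuousOn f (Ioo 0 1))
    (hG : IsWeakDeriv (fun s => f (stretch (1 / ρ) s)) G) :
    IsWeakDeriv f fun t => G (stretch ρ t) * stretchDeriv ρ t := by
  have hρ' := one_div_pos.2 hρ
  have hF : ContinuousOn (fun s => f (stretch (1 / ρ) s)) (Ioo 0 1) :=
    hf.comp (continuousOn_stretch _) fun s hs => stretch_mem hρ' hs
  exact (hG.comp_stretch hF hρ).congr (fun t ht => by simp only [stretch_stretch hρ ht.2])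
    (ae_eq_refl _)

/-- Measurability is read off from the locally integrable weak derivative by cancelling the
Jacobian. -/
lemma aestronglyMeasurable_comp_stretch (hρ : 0 < ρ) {f G : ℝ → ℝ}
    (h : IsWeakDeriv f fun t => G (stretch ρ t) * stretchDeriv ρ t) :
    AEStronglyMeasurable (fun t => G (stretch ρ t)) (volume.restrict (Ioo 0 1)) := by
  have h1 := h.2.1.aestronglyMeasurable
  have h2 : AEStronglyMeasurable (fun t : ℝ => (1 - t) ^ (1 - ρ) / ρ)
      (volume.restrict (Ioo 0 1)) :=
    Measurable.aestronglyMeasurable (by fun_prop)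
  refine (h2.mul h1).congr ((ae_restrict_iff' measurableSet_Ioo).2 (Eventually.of_forall ?_))
  intro t ht
  exact rpow_mul_stretchDeriv hρ ht.2 _

lemma memB_one (hρ : 0 < ρ) {f G : ℝ → ℝ} (hf : ContinuousOn f (Ioo 0 1))
    (hG : IsWeakDeriv (fun s => f (stretch (1 / ρ) s)) G)
    (hF2 : IntegrableOn (fun s => f (stretch (1 / ρ) s) ^ 2 * unitWeight υ μ s) (Ioo 0 1))
    (hG2 : IntegrableOn (fun s => G s ^ 2 * unitWeight (υ + 1) (μ + 1) s) (Ioo 0 1)) :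
    MemB μ υ ρ 1 f := by
  have hw := isWeakDeriv_of_stretch hρ hf hG
  have hff : (fun t => f (stretch (1 / ρ) (stretch ρ t))) =ᵐ[volume.restrict (Ioo (0 : ℝ) 1)] f :=
    (ae_restrict_iff' measurableSet_Ioo).2 (Eventually.of_forall fun t ht => by
      simp only [stretch_stretch hρ ht.2])
  -- Only the entries `0` and `1` are constrained, so the sequence may be constant from `1` on.
  refine ⟨fun k => if k = 0 then f else fun t => G (stretch ρ t), rfl, fun k hk => ?_,
    fun k hk => ?_⟩
  · obtain rfl : k = 0 := by omega
    refine ⟨_, hw, (ae_restrict_iff' measurableSet_Ioo).2 (Eventually.of_forall fun t ht => ?_)⟩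
    exact (rpow_mul_stretchDeriv hρ ht.2 _).symm
  · obtain rfl | rfl : k = 0 ∨ k = 1 := by omega
    · simp only [Nat.cast_zero, add_zero, if_true]
      refine MemL2.congr ((memL2_stretch_iff hρ (h := fun s => f (stretch (1 / ρ) s)) ?_).2 hF2) hff
      exact (hf.aestronglyMeasurable measurableSet_Ioo).congr hff.symm
    · simp only [Nat.cast_one, one_ne_zero, if_false]
      exact (memL2_stretch_iff hρ (aestronglyMeasurable_comp_stretch hρ hw)).2 hG2

lemma memL2_interp (hμ : -1 < μ) (hυ : -1 < υ) (hρ : 0 < ρ) {N : ℕ} {t : Fin (N + 1) → ℝ}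
    (ht : IsGaussNodes N μ υ ρ t) (f : ℝ → ℝ) : MemL2 (weight μ υ ρ) (interp ρ t f) := by
  rw [show interp ρ t f = _ from funext (interp_eq ht hρ f)]
  set p := gaussInterpolant N (unitNodes ρ t) fun s => f (stretch (1 / ρ) s)
  refine (memL2_stretch_iff hρ (h := fun s => p.eval s) ?_).2 ?_
  · exact (p.continuous.comp_continuousOn (continuousOn_stretch ρ)).aestronglyMeasurable
      measurableSet_Ioo
  · have := intervalIntegrable_unitWeight_mul_eval hυ hμ (p ^ 2)
    rw [intervalIntegrable_iff_integrableOn_Ioo_of_le zero_le_one] at this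
    refine this.congr_fun (fun s _ => ?_) measurableSet_Ioo
    simp only [Polynomial.eval_pow]
    ring

lemma wnorm_interp (hμ : -1 < μ) (hυ : -1 < υ) (hρ : 0 < ρ) {N : ℕ} {t : Fin (N + 1) → ℝ}
    (ht : IsGaussNodes N μ υ ρ t) (f : ℝ → ℝ) :
    wnorm (weight μ υ ρ) (interp ρ t f) = Real.sqrt (∑ j ∈ Finset.range (N + 1),
      christoffel N υ μ (unitNodes ρ t) j * f (stretch (1 / ρ) (unitNodes ρ t j)) ^ 2) := by
  rw [show interp ρ t f = _ from funext (interp_eq ht hρ f),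
    wnorm_stretch hρ (fun s => (gaussInterpolant N (unitNodes ρ t)
      fun s => f (stretch (1 / ρ) s)).eval s),
    (ht.isJacobiNodes hρ).integral_gaussInterpolant_sq hυ hμ]

lemma wnorm_eq_of_isBackwardDeriv (hρ : 0 < ρ) {f g G : ℝ → ℝ} (hf : ContinuousOn f (Ioo 0 1))
    (hG : IsWeakDeriv (fun s => f (stretch (1 / ρ) s)) G) (hg : IsBackwardDeriv ρ f g) :
    wnorm (weight (μ + 1) (υ + 1) ρ) g =
      Real.sqrt (∫ s in Ioo (0 : ℝ) 1, G s ^ 2 * unitWeight (υ + 1) (μ + 1) s) := by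
  obtain ⟨f', hf', hgf⟩ := hg
  have he := (isWeakDeriv_of_stretch hρ hf hG).ae_unique hf'
  rw [← wnorm_stretch hρ]
  refine wnorm_congr ?_
  filter_upwards [he, hgf, ae_restrict_mem measurableSet_Ioo] with t h1 h2 h3
  rw [h2, ← h1, rpow_mul_stretchDeriv hρ h3.2]

lemma wnorm_eq_of_stretch (hρ : 0 < ρ) (f : ℝ → ℝ) :
    wnorm (weight μ υ ρ) f =
      Real.sqrt (∫ s in Ioo (0 : ℝ) 1, f (stretch (1 / ρ) s) ^ 2 * unitWeight υ μ s) := by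
  rw [← wnorm_stretch hρ (fun s => f (stretch (1 / ρ) s))]
  refine wnorm_congr ?_
  filter_upwards [ae_restrict_mem measurableSet_Ioo] with t ht
  rw [stretch_stretch hρ ht.2]

lemma sqrt_mul_add_le {C A B r : ℝ} (hC : 0 ≤ C) (hA : 0 ≤ A) (hB : 0 ≤ B) (hr : 0 ≤ r) :
    Real.sqrt (C * (A + (r ^ 2)⁻¹ * B)) ≤
      Real.sqrt C * (Real.sqrt A + r⁻¹ * Real.sqrt B) := by
  rw [Real.sqrt_mul hC]
  refine mul_le_mul_of_nonneg_left ?_ (Real.sqrt_nonneg _)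
  have h1 : 0 ≤ r⁻¹ * Real.sqrt B := by positivity
  refine Real.sqrt_le_iff.2 ⟨by positivity, ?_⟩
  have e : (Real.sqrt A + r⁻¹ * Real.sqrt B) ^ 2 =
      Real.sqrt A ^ 2 + (r ^ 2)⁻¹ * Real.sqrt B ^ 2 + 2 * (Real.sqrt A * (r⁻¹ * Real.sqrt B)) := by
    rw [← inv_pow]
    ring
  rw [e, Real.sq_sqrt hA, Real.sq_sqrt hB]
  have := mul_nonneg (Real.sqrt_nonneg A) h1
  linarith

lemma integral_sq_mul_unitWeight_nonneg (a b : ℝ) (h : ℝ → ℝ) :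
    0 ≤ ∫ s in Ioo (0 : ℝ) 1, h s ^ 2 * unitWeight a b s :=
  setIntegral_nonneg measurableSet_Ioo fun _ hs =>
    mul_nonneg (sq_nonneg _) (unitWeight_pos a b hs.1 hs.2).le

end Main

end BackwardInterp

theorem mainTheorem6 (μ υ ρ : ℝ) (hμ : -1 < μ) (hυ : -1 < υ) (hρ0 : 0 < ρ) (hρ1 : ρ ≤ 1) :
    ∃ c : ℝ, 0 < c ∧ ∀ N : ℕ, 1 ≤ N →
      (∃ t : Fin (N + 1) → ℝ, BackwardInterp.IsGaussNodes N μ υ ρ t) ∧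
      ∀ t : Fin (N + 1) → ℝ, BackwardInterp.IsGaussNodes N μ υ ρ t →
        ∀ f : ℝ → ℝ, ContinuousOn f (Ioo 0 1) →
          BackwardInterp.MemB μ υ 1 1 (fun x => f (1 - (1 - x) ^ (1 / ρ))) →
            BackwardInterp.MemB μ υ ρ 1 f ∧
            BackwardInterp.MemL2 (BackwardInterp.weight μ υ ρ) (BackwardInterp.interp ρ t f) ∧
            ∀ g : ℝ → ℝ, BackwardInterp.IsBackwardDeriv ρ f g →
              BackwardInterp.wnorm (BackwardInterp.weight μ υ ρ) (BackwardInterp.interp ρ t f) ≤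
                c * (BackwardInterp.wnorm (BackwardInterp.weight μ υ ρ) f +
                  (N : ℝ)⁻¹ *
                    BackwardInterp.wnorm (BackwardInterp.weight (μ + 1) (υ + 1) ρ) g) := by
  -- The exponents enter swapped: `υ` belongs to the end point `0` and `μ` to `1`.
  obtain ⟨C, hC, hcore⟩ := BackwardInterp.exists_sum_christoffel_le hυ hμ
  refine ⟨Real.sqrt C, Real.sqrt_pos.2 hC, fun N hN =>
    ⟨BackwardInterp.exists_isGaussNodes hμ hυ hρ0 N, fun t ht f hf hB => ?_⟩⟩
  obtain ⟨G, hG, hF2, hG2⟩ := BackwardInterp.memB_stretch hB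
  refine ⟨BackwardInterp.memB_one hρ0 hf hG hF2 hG2,
    BackwardInterp.memL2_interp hμ hυ hρ0 ht f, fun g hg => ?_⟩
  have hF : ContinuousOn (fun s => f (BackwardInterp.stretch (1 / ρ) s)) (Ioo 0 1) :=
    hf.comp (BackwardInterp.continuousOn_stretch _) fun s hs =>
      BackwardInterp.stretch_mem (one_div_pos.2 hρ0) hs
  rw [BackwardInterp.wnorm_interp hμ hυ hρ0 ht,
    BackwardInterp.wnorm_eq_of_isBackwardDeriv hρ0 hf hG hg,
    BackwardInterp.wnorm_eq_of_stretch hρ0 f]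
  refine (Real.sqrt_le_sqrt (hcore N _ hN (ht.isJacobiNodes hρ0) _ G hF2 hG2
    (fun x hx y hy => hG.intervalIntegrable hx hy)
    fun x hx y hy => hG.integral_eq_sub hF hx hy)).trans ?_
  exact BackwardInterp.sqrt_mul_add_le hC.le
    (BackwardInterp.integral_sq_mul_unitWeight_nonneg _ _ _)
    (BackwardInterp.integral_sq_mul_unitWeight_nonneg _ _ _) N.cast_nonneg
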